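/- For a homogeneous polynomial $f$ in $n$ real variables let $\|f\|_2:=\sup_{\|x\|_2=1}|f(x)|$, and for $f$ of even degree $d$ let $$\Lambda(f):=\inf\Big\{\sup_{\|z\|_2=1}z^{T}Mz\ :\ M\in\mathbb R^{[n]^{d/2}\times[n]^{d/2}}\text{ symmetric},\ (x^{\otimes d/2})^{T}M\,x^{\otimes d/2}=f(x)\ \text{ for all }x\in\mathbb R^n\Big\}$$ be the value of its degree-$d$ sum-of-squares relaxation on the sphere. For a graph $G$ on $[n]$ let $$f_G(x):=\sum_{\{i_1,i_2,i_3,i_4\}\ \text{a 4-clique of }G}x_{i_1}x_{i_2}x_{i_3}x_{i_4}.$$ **Theorem.** There are absolute constants $C\in\mathbb N$, $c>0$ and $N\in\mathbb N$ such that for every $n\ge N$ the following holds. If $G$ is a random graph drawn from $G(n,p)$ with $p=n^{-1/3}$, then $$\Pr\big[\|f_G\|_2\le(\log n)^{C}\big]\ge 1-\tfrac1n\qquad\text{and}\qquad \Pr\Big[\Lambda(f_G)\ge \frac{c\,n^{1/6}}{(\log n)^{C}}\Big]\ge 1-\tfrac1n .$$ In particular, for every $n\ge N$ there is an $n$-variate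 homogeneous polynomial $f$ of degree $4$ with non-negative coefficients, namely $f=f_G$ for some graph $G$ on $[n]$, such that $$\|f\|_2\le(\log n)^{C}\qquad\text{and}\qquad \Lambda(f)\ge \frac{c\,n^{1/6}}{(\log n)^{C}} .$$ -/

import Mathlib

open MvPolynomial

/-- The sup norm of a polynomial on the Euclidean unit sphere:
`‖f‖₂ = sup { |f x| : x ∈ ℝⁿ, ∑ xᵢ² = 1 }`. -/
noncomputable def sphereNorm {n : ℕ} (f : MvPolynomial (Fin n) ℝ) : ℝ :=
  sSup {r : ℝ | ∃ x : Fin n → ℝ, ∑ i, x i ^ 2 = 1 ∧ r = |eval x f|}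

/-- The tensor power `x^{⊗ k}`, a vector indexed by `k`-tuples. -/
def tensorPow {n : ℕ} (k : ℕ) (x : Fin n → ℝ) : (Fin k → Fin n) → ℝ :=
  fun I => ∏ j, x (I j)

/-- `M` is a (symmetric) matrix representation of the degree-`2k` form `f`:
`(x^{⊗ k})ᵀ M x^{⊗ k} = f x` for all `x ∈ ℝⁿ`. -/
def IsMatrixRep {n : ℕ} (k : ℕ) (f : MvPolynomial (Fin n) ℝ)
    (M : Matrix (Fin k → Fin n) (Fin k → Fin n) ℝ) : Prop :=
  M.IsSymm ∧ ∀ x : Fin n → ℝ, tensorPow k x ⬝ᵥ M.mulVec (tensorPow k x) = eval x f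

/-- `sup { zᵀ M z : ‖z‖₂ = 1 }`, the largest eigenvalue of a symmetric matrix. -/
noncomputable def maxQuadForm {ι : Type*} [Fintype ι] (M : Matrix ι ι ℝ) : ℝ :=
  sSup {r : ℝ | ∃ z : ι → ℝ, ∑ i, z i ^ 2 = 1 ∧ r = z ⬝ᵥ M.mulVec z}

/-- The value `Λ(f)` of the sum-of-squares relaxation of a form `f` of degree `2k` on the sphere:
the infimum of `sup_{‖z‖ = 1} zᵀ M z` over all matrix representations `M` of `f`. -/
noncomputable def sosValue {n : ℕ} (k : ℕ) (f : MvPolynomial (Fin n) ℝ) : ℝ :=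
  sInf {r : ℝ | ∃ M : Matrix (Fin k → Fin n) (Fin k → Fin n) ℝ,
    IsMatrixRep k f M ∧ r = maxQuadForm M}

open scoped Classical in
/-- The `4`-clique polynomial of a graph on `[n]`: the sum of `x_{i₁} x_{i₂} x_{i₃} x_{i₄}` over all
(unordered) `4`-cliques `{i₁, i₂, i₃, i₄}`. -/
noncomputable def cliquePoly {n : ℕ} (G : SimpleGraph (Fin n)) : MvPolynomial (Fin n) ℝ :=
  ∑ s ∈ G.cliqueFinset 4, ∏ i ∈ s, X i

/-- The edge probability `p = n^{-1/3}`. -/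
noncomputable def edgeProb (n : ℕ) : unitInterval :=
  ⟨(n : ℝ) ^ (-(1 / 3) : ℝ), Real.rpow_nonneg n.cast_nonneg _, by
    rcases Nat.eq_zero_or_pos n with rfl | h
    · rw [Nat.cast_zero, Real.zero_rpow (by norm_num)]
      exact zero_le_one
    · exact Real.rpow_le_one_of_one_le_of_nonpos (by exact_mod_cast h) (by norm_num)⟩

/-! Put a = n^{1/3} = 1/p. Then np = a², np² = a, np³ = 1, and about n⁴p⁶ = a⁶ cliques are expected.
Both bounds rest on one high-probability event, `Typical`: degrees, codegrees and triple codegrees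
are O(a² log n), O(a log n), O(log n), and no two vertex sets span many more edges than expected.

Upper bound on the sphere norm. Round each |x_i| up to a power 2^{-h}; level h has at most 4^{h+1}
vertices, and O(log n) levels suffice. List the vertices of a clique by decreasing rounded value.
The last one is among the O(log n) common neighbours of the other three and carries a weight no
larger than the third, so the sum reduces to triangles weighted by y_i y_j y_k².
`Typical.triangles_le` says that sets of sizes at most s₁² ≤ s₂² ≤ s₃² span at most polylog · s₁ s₂
s₃² triangles, exactly what cancels these weights. Each triple of levels therefore contributes
polylog (`Typical.abs_eval_cliquePoly_le`).

Lower bound on the relaxation. By weak duality (`le_maxQuadForm_of_isMatrixRep`) it suffices to find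
a linear functional L, non-negative on squares of quadratic forms, with L(f) much larger than
L(‖x‖⁴). With four disjoint classes V₁, …, V₄ and centred edge indicators c, `pseudoExp` takes
fourth derivatives ∂_i∂_j∂_k∂_l weighted by the product of the six values of c, plus a multiple s ≈
√a · polylog of positive functionals weighted by |c_ij|. The correction does not see the multilinear
f, so L(f) is (1-p)⁶ times the number of transversal cliques, of order a⁶ by a second moment
argument; L(‖x‖⁴) is at most of order s Σ|c_ij| ≈ √a · a⁵. The ratio is √a = n^{1/6} up to
logarithms.

Non-negativity of L on squares asks that, for each of the three ways to split {i,j,k,l} into two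
pairs, the bilinear form with these coefficients have |c|-weighted norm at most √a · polylog. Its
square is governed by a Gram matrix, a sum over l ∈ V₄ of positive semidefinite `vertexGram` terms.
Averaging over the edges at l makes a term diagonal, since an off-diagonal entry contains a centred
edge variable to the first power; its entries are then at most 2p³ times a codegree. Each term has
norm at most a · polylog by a Schur test. A matrix Chernoff bound by trace moments
(`trace_add_pow_le`, `bexp_trace_pow_le`) then bounds the sum by a · polylog. The terms share the
edges outside V₄ and are bounded only on typical graphs, so they are truncated and only conditional
means are used. -/

/-! ### Random subsets of a finite set: expectation, independence, tail bounds. -/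

section BernoulliSubset

variable {ι : Type*} [DecidableEq ι]

/-- Expectation of `f ω`, where `ω` is the random subset of `E` which contains every element
independently with probability `p`. -/
noncomputable def bexp (E : Finset ι) (p : ℝ) (f : Finset ι → ℝ) : ℝ :=
  ∑ ω ∈ E.powerset, p ^ ω.card * (1 - p) ^ (E \ ω).card * f ω

open scoped Classical in
/-- Probability of an event about the random subset of `E`. -/
noncomputable def bprob (E : Finset ι) (p : ℝ) (S : Finset ι → Prop) : ℝ :=
  bexp E p fun ω => if S ω then 1 else 0

variable {E : Finset ι} {p : ℝ}

lemma bexp_congr {f g : Finset ι → ℝ} (h : ∀ ω ⊆ E, f ω = g ω) : bexp E p f = bexp E p g :=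
  Finset.sum_congr rfl fun ω hω => by rw [h ω (Finset.mem_powerset.1 hω)]

lemma bexp_add (f g : Finset ι → ℝ) :
    bexp E p (fun ω => f ω + g ω) = bexp E p f + bexp E p g := by
  simp [bexp, mul_add, Finset.sum_add_distrib]

lemma bexp_const_mul (c : ℝ) (f : Finset ι → ℝ) :
    bexp E p (fun ω => c * f ω) = c * bexp E p f := by
  simp only [bexp, Finset.mul_sum]
  exact Finset.sum_congr rfl fun ω _ => by ring

lemma bexp_sum {α : Type*} (s : Finset α) (f : α → Finset ι → ℝ) :
    bexp E p (fun ω => ∑ a ∈ s, f a ω) = ∑ a ∈ s, bexp E p (f a) := by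
  simp only [bexp, Finset.mul_sum]
  exact Finset.sum_comm

lemma bexp_const (c : ℝ) : bexp E p (fun _ => c) = c := by
  have h := Finset.sum_pow_mul_eq_add_pow p (1 - p) E
  simp only [add_sub_cancel, one_pow] at h
  rw [bexp, ← Finset.sum_mul]
  conv_rhs => rw [← one_mul c, ← h]
  congr 1
  refine Finset.sum_congr rfl fun ω hω => ?_
  rw [Finset.card_sdiff_of_subset (Finset.mem_powerset.1 hω)]

lemma bexp_mono (hp0 : 0 ≤ p) (hp1 : p ≤ 1) {f g : Finset ι → ℝ} (h : ∀ ω ⊆ E, f ω ≤ g ω) :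
    bexp E p f ≤ bexp E p g := by
  refine Finset.sum_le_sum fun ω hω => ?_
  have : 0 ≤ 1 - p := by linarith
  exact mul_le_mul_of_nonneg_left (h ω (Finset.mem_powerset.1 hω)) (by positivity)

lemma bexp_nonneg (hp0 : 0 ≤ p) (hp1 : p ≤ 1) {f : Finset ι → ℝ} (h : ∀ ω ⊆ E, 0 ≤ f ω) :
    0 ≤ bexp E p f := by
  simpa [bexp_const] using bexp_mono (E := E) hp0 hp1 (f := fun _ => 0) h

/-- Resampling one element does not change the expectation. -/
lemma bexp_resample {e : ι} (he : e ∈ E) (f : Finset ι → ℝ) :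
    bexp E p f = bexp E p fun ω => p * f (insert e ω) + (1 - p) * f (ω.erase e) := by
  obtain ⟨E', he', rfl⟩ : ∃ E', e ∉ E' ∧ E = insert e E' :=
    ⟨E.erase e, by simp, (Finset.insert_erase he).symm⟩
  simp only [bexp, Finset.sum_powerset_insert he', ← Finset.sum_add_distrib]
  refine Finset.sum_congr rfl fun ω hω => ?_
  have hω' : e ∉ ω := fun h => he' (Finset.mem_powerset.1 hω h)
  have h1 : (insert e E' \ ω).card = (E' \ ω).card + 1 := by
    rw [Finset.insert_sdiff_of_notMem _ hω', Finset.card_insert_of_notMem (by simp [he'])]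
  have h2 : insert e E' \ insert e ω = E' \ ω := by
    rw [Finset.insert_sdiff_insert, Finset.sdiff_insert_of_notMem he']
  rw [h1, h2, Finset.card_insert_of_notMem hω', Finset.insert_idem, Finset.erase_insert hω',
    Finset.erase_eq_of_notMem hω']
  ring

/-- `F` does not depend on whether `e` belongs to the set. -/
def Ignores (e : ι) {β : Type*} (F : Finset ι → β) : Prop := ∀ ω, F (insert e ω) = F ω

lemma Ignores.erase {e : ι} {β : Type*} {F : Finset ι → β} (h : Ignores e F) (ω : Finset ι) :
    F (ω.erase e) = F ω := by
  rw [← h (ω.erase e), ← h ω]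
  by_cases he : e ∈ ω
  · rw [Finset.insert_erase he, Finset.insert_eq_of_mem he]
  · rw [Finset.erase_eq_of_notMem he]

/-- A function of the membership of `e` is independent of everything that ignores `e`. -/
lemma bexp_mul_of_ignores {e : ι} (he : e ∈ E) {F : Finset ι → ℝ} (hF : Ignores e F)
    (φ : Prop → ℝ) :
    bexp E p (fun ω => F ω * φ (e ∈ ω)) = (p * φ True + (1 - p) * φ False) * bexp E p F := by
  rw [bexp_resample he, ← bexp_const_mul]
  refine bexp_congr fun ω _ => ?_
  rw [hF, hF.erase]
  simp only [Finset.mem_insert_self, Finset.notMem_erase]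
  ring

-- Independence peels off one factor p per element of `F`.
open scoped Classical in
lemma bexp_subset {F : Finset ι} (hF : F ⊆ E) :
    bexp E p (fun ω => if F ⊆ ω then 1 else 0) = p ^ F.card := by
  induction F using Finset.induction_on with
  | empty => simp [bexp_const]
  | insert e F he ih =>
    have h1 : Ignores e (fun ω : Finset ι => if F ⊆ ω then (1 : ℝ) else 0) := by
      intro ω
      simp only [Finset.subset_insert_iff_of_notMem he]
    have h2 := bexp_mul_of_ignores (p := p) (hF (Finset.mem_insert_self e F)) h1
      (fun P => if P then 1 else 0)
    rw [ih ((Finset.subset_insert e F).trans hF)] at h2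
    rw [Finset.card_insert_of_notMem he, pow_succ']
    simp only [if_true, if_false, mul_one, mul_zero, add_zero] at h2
    rw [← h2]
    refine bexp_congr fun ω _ => ?_
    by_cases h : e ∈ ω <;> simp [Finset.insert_subset_iff, h]

/-- Markov's inequality. -/
lemma bprob_le_bexp (hp0 : 0 ≤ p) (hp1 : p ≤ 1) {S : Finset ι → Prop} {f : Finset ι → ℝ} {a : ℝ}
    (ha : 0 < a) (hf : ∀ ω ⊆ E, 0 ≤ f ω) (h : ∀ ω ⊆ E, S ω → a ≤ f ω) :
    bprob E p S ≤ bexp E p f / a := by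
  classical
  rw [div_eq_inv_mul, ← bexp_const_mul]
  refine bexp_mono hp0 hp1 fun ω hω => ?_
  rw [← div_eq_inv_mul]
  split_ifs with hS
  · rw [one_le_div ha]; exact h ω hω hS
  · exact div_nonneg (hf ω hω) ha.le

lemma bprob_mono (hp0 : 0 ≤ p) (hp1 : p ≤ 1) {S T : Finset ι → Prop} (h : ∀ ω ⊆ E, S ω → T ω) :
    bprob E p S ≤ bprob E p T := by
  classical
  refine bexp_mono hp0 hp1 fun ω hω => ?_
  by_cases hS : S ω
  · simp [hS, h ω hω hS]
  · rw [if_neg hS]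
    split_ifs <;> norm_num

lemma bprob_exists_le (hp0 : 0 ≤ p) (hp1 : p ≤ 1) {α : Type*} (s : Finset α)
    (S : α → Finset ι → Prop) :
    bprob E p (fun ω => ∃ a ∈ s, S a ω) ≤ ∑ a ∈ s, bprob E p (S a) := by
  classical
  simp only [bprob]
  rw [← bexp_sum]
  refine bexp_mono hp0 hp1 fun ω _ => ?_
  split_ifs with h
  · obtain ⟨a, ha, haS⟩ := h
    calc (1 : ℝ) = if S a ω then 1 else 0 := by simp [haS]
      _ ≤ _ := Finset.single_le_sum (f := fun a => if S a ω then (1 : ℝ) else 0)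
        (fun b _ => by split_ifs <;> norm_num) ha
  · exact Finset.sum_nonneg fun b _ => by split_ifs <;> norm_num

lemma bprob_or_le (hp0 : 0 ≤ p) (hp1 : p ≤ 1) (S T : Finset ι → Prop) :
    bprob E p (fun ω => S ω ∨ T ω) ≤ bprob E p S + bprob E p T := by
  classical
  simp only [bprob]
  rw [← bexp_add]
  refine bexp_mono hp0 hp1 fun ω _ => ?_
  by_cases h1 : S ω <;> by_cases h2 : T ω <;> simp [h1, h2]

lemma bprob_not (S : Finset ι → Prop) : bprob E p (fun ω => ¬ S ω) = 1 - bprob E p S := by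
  classical
  have h := bexp_add (E := E) (p := p) (fun ω => if S ω then (1 : ℝ) else 0)
    (fun ω => if ¬ S ω then (1 : ℝ) else 0)
  have h1 : bexp E p (fun ω => (if S ω then (1 : ℝ) else 0) + if ¬ S ω then (1 : ℝ) else 0) = 1 := by
    refine Eq.trans (bexp_congr fun ω _ => ?_) (bexp_const (E := E) (p := p) 1)
    by_cases h : S ω <;> simp [h]
  rw [h1] at h
  simp only [bprob]
  rw [eq_sub_iff_add_eq']
  refine Eq.trans ?_ h.symm
  congr 1
  exact bexp_congr fun ω _ => by congr

open scoped Classical in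
/-- Exponential moment of the number of members of a disjoint family that are contained in the
random set. -/
lemma bexp_two_pow_card {α : Type*} (K : Finset α) (F : α → Finset ι) (r : ℕ)
    (hF : ∀ a ∈ K, F a ⊆ E) (hr : ∀ a ∈ K, (F a).card = r)
    (hd : (K : Set α).PairwiseDisjoint F) :
    bexp E p (fun ω => 2 ^ (K.filter fun a => F a ⊆ ω).card) = (1 + p ^ r) ^ K.card := by
  -- 2 to the count is the number of subfamilies lying inside ω. By disjointness a subfamily `J`
  -- survives with probability p^{r|J|}, and the binomial theorem resums.
  have h1 : ∀ ω : Finset ι, (2 : ℝ) ^ (K.filter fun a => F a ⊆ ω).card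
      = ∑ J ∈ K.powerset, if J.biUnion F ⊆ ω then 1 else 0 := by
    intro ω
    rw [← Finset.sum_filter, Finset.sum_const, nsmul_one]
    have : K.powerset.filter (fun J => J.biUnion F ⊆ ω)
        = (K.filter fun a => F a ⊆ ω).powerset := by
      ext J
      simp only [Finset.mem_filter, Finset.mem_powerset, Finset.biUnion_subset,
        Finset.subset_iff (s₂ := K.filter _)]
      constructor
      · rintro ⟨h, h'⟩ x hx
        exact ⟨h hx, h' x hx⟩
      · intro h
        exact ⟨fun x hx => (h hx).1, fun x hx => (h hx).2⟩
    rw [this, Finset.card_powerset]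
    norm_cast
  simp only [h1]
  rw [bexp_sum]
  have h2 : ∀ J ∈ K.powerset, bexp E p (fun ω => if J.biUnion F ⊆ ω then 1 else 0)
      = (p ^ r) ^ J.card * 1 ^ (K.card - J.card) := by
    intro J hJ
    have hJ := Finset.mem_powerset.1 hJ
    rw [bexp_subset (Finset.biUnion_subset.2 fun a ha => hF a (hJ ha)),
      Finset.card_biUnion fun a ha b hb hab => hd (hJ ha) (hJ hb) hab,
      Finset.sum_congr rfl fun a ha => hr a (hJ ha)]
    simp [pow_mul, mul_comm]
  rw [Finset.sum_congr rfl h2, Finset.sum_pow_mul_eq_add_pow, add_comm]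

open scoped Classical in
/-- Upper tail for the number of members of a disjoint family contained in the random set. -/
lemma bprob_card_lt (hp0 : 0 ≤ p) (hp1 : p ≤ 1) {α : Type*} (K : Finset α) (F : α → Finset ι)
    (r : ℕ) (hF : ∀ a ∈ K, F a ⊆ E) (hr : ∀ a ∈ K, (F a).card = r)
    (hd : (K : Set α).PairwiseDisjoint F) {t : ℝ} (ht : 0 ≤ t) :
    bprob E p (fun ω => 2 * (K.card * p ^ r) + 10 * t < (K.filter fun a => F a ⊆ ω).card)
      ≤ Real.exp (-(6 * t)) := by
  set μ : ℝ := K.card * p ^ r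
  have hμ : 0 ≤ μ := by positivity
  have hlog : (0.6931471803 : ℝ) < Real.log 2 := Real.log_two_gt_d9
  -- Exponential Markov: log 2 > 0.69 gives (2μ + 10t) log 2 ≥ μ + 6t, while the moment is at most
  -- e^μ.
  have h := bprob_le_bexp (E := E) (S := fun ω => 2 * μ + 10 * t
      < (K.filter fun a => F a ⊆ ω).card) hp0 hp1 (f := fun ω => 2 ^ (K.filter fun a => F a ⊆ ω).card)
      (Real.exp_pos (μ + 6 * t)) (fun ω _ => by positivity) (by
    intro ω _ h
    rw [← Real.exp_log (x := (2 : ℝ) ^ _) (by positivity), Real.log_pow]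
    apply Real.exp_le_exp.2
    have : (0 : ℝ) ≤ (K.filter fun a => F a ⊆ ω).card := by positivity
    nlinarith)
  rw [bexp_two_pow_card K F r hF hr hd] at h
  refine h.trans ?_
  rw [div_le_iff₀ (Real.exp_pos _), ← Real.exp_add]
  have h3 : (1 + p ^ r) ^ K.card ≤ Real.exp (p ^ r) ^ K.card :=
    pow_le_pow_left₀ (by positivity) (by rw [add_comm]; exact Real.add_one_le_exp _) _
  rw [← Real.exp_nat_mul] at h3
  refine h3.trans (Real.exp_le_exp.2 ?_)
  simp only [μ]
  linarith

end BernoulliSubset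

/-! ### From the random graph measure to random edge sets. -/

section Transfer

/-- The set of all possible edges on `[n]`. -/
def allEdges (n : ℕ) : Finset (Sym2 (Fin n)) := Finset.univ.filter fun e => ¬ e.IsDiag

lemma mem_allEdges {n : ℕ} {i j : Fin n} : s(i, j) ∈ allEdges n ↔ i ≠ j := by
  simp [allEdges]

/-- The graph with a given set of edges. -/
def edgeGraph {n : ℕ} (ω : Finset (Sym2 (Fin n))) : SimpleGraph (Fin n) :=
  SimpleGraph.fromEdgeSet (ω : Set (Sym2 (Fin n)))

lemma edgeGraph_adj {n : ℕ} {ω : Finset (Sym2 (Fin n))} (hω : ω ⊆ allEdges n) {i j : Fin n} :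
    (edgeGraph ω).Adj i j ↔ s(i, j) ∈ ω := by
  simp only [edgeGraph, SimpleGraph.fromEdgeSet_adj, Finset.mem_coe, and_iff_left_iff_imp]
  exact fun h => mem_allEdges.1 (hω h)

lemma edgeGraph_edgeSet {n : ℕ} {ω : Finset (Sym2 (Fin n))} (hω : ω ⊆ allEdges n) :
    (edgeGraph ω).edgeSet = ω := by
  ext e
  induction e with
  | _ i j => simp [SimpleGraph.mem_edgeSet, edgeGraph_adj hω]

/-- Graphs correspond to sets of non-diagonal pairs, and the masses of singletons agree; every later
probability is thus a finite sum. -/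
lemma binomialRandom_real_eq_bprob {n : ℕ} (p : unitInterval) (S : Set (SimpleGraph (Fin n))) :
    (SimpleGraph.binomialRandom (Fin n) p).real S
      = bprob (allEdges n) p fun ω => edgeGraph ω ∈ S := by
  classical
  have hsum : (SimpleGraph.binomialRandom (Fin n) p).real S
      = ∑ G : SimpleGraph (Fin n), (SimpleGraph.binomialRandom (Fin n) p).real {G}
        * (if G ∈ S then 1 else 0) := by
    have : MeasurableSingletonClass (SimpleGraph (Fin n)) := ⟨fun G => by
      rw [← SimpleGraph.measurableEmbedding_edgeSet.measurableSet_image, Set.image_singleton]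
      exact MeasurableSet.singleton _⟩
    have h := MeasureTheory.sum_measureReal_singleton
      (μ := SimpleGraph.binomialRandom (Fin n) p) (Finset.univ.filter fun G => G ∈ S)
    simp only [Finset.coe_filter, Finset.mem_univ, true_and, Set.ofPred_mem_eq] at h
    rw [← h, Finset.sum_filter]
    simp
  rw [hsum, bprob, bexp]
  symm
  refine Finset.sum_bij (fun ω _ => edgeGraph ω) (fun _ _ => Finset.mem_univ _) ?_ ?_ ?_
  · intro a ha b hb hab
    have := congrArg SimpleGraph.edgeSet hab
    rw [edgeGraph_edgeSet (Finset.mem_powerset.1 ha),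
      edgeGraph_edgeSet (Finset.mem_powerset.1 hb)] at this
    exact_mod_cast this
  · intro G _
    refine ⟨G.edgeFinset, ?_, ?_⟩
    · rw [Finset.mem_powerset]
      intro e he
      simp only [allEdges, Finset.mem_filter, Finset.mem_univ, true_and]
      exact G.not_isDiag_of_mem_edgeSet (by simpa using he)
    · simp [edgeGraph]
  · intro ω hω
    have hω := Finset.mem_powerset.1 hω
    congr 1
    rw [MeasureTheory.Measure.real, SimpleGraph.binomialRandom_singleton, edgeGraph_edgeSet hω,
      Set.ncard_coe_finset, Finset.card_sdiff_of_subset hω]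
    have hc : (allEdges n).card = (Nat.card (Fin n)).choose 2 := by
      rw [Nat.card_eq_fintype_card, ← Sym2.card_subtype_not_diag, Fintype.card_subtype]
      rfl
    rw [hc]
    simp [ENNReal.toReal_mul, unitInterval.toNNReal]
    rfl

end Transfer

/-! ### Trace inequalities for powers of positive semidefinite matrices. -/

section TracePower

open Matrix

variable {m : Type*} [Fintype m] [DecidableEq m]

lemma exists_orthogonal_diagonalization {N : Matrix m m ℝ} (hN : N.IsHermitian) :
    ∃ (U : Matrix m m ℝ) (d : m → ℝ), Uᵀ * U = 1 ∧ U * Uᵀ = 1 ∧ N = U * diagonal d * Uᵀ := by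
  refine ⟨hN.eigenvectorUnitary, hN.eigenvalues, ?_, ?_, ?_⟩
  · have := Unitary.coe_star_mul_self hN.eigenvectorUnitary
    rwa [star_eq_conjTranspose, conjTranspose_eq_transpose_of_trivial] at this
  · have := Unitary.coe_mul_star_self hN.eigenvectorUnitary
    rwa [Unitary.coe_star, star_eq_conjTranspose, conjTranspose_eq_transpose_of_trivial] at this
  · have := hN.spectral_theorem
    rwa [Unitary.conjStarAlgAut_apply, star_eq_conjTranspose,
      conjTranspose_eq_transpose_of_trivial] at this

lemma conj_diagonal_cancel {U : Matrix m m ℝ} (hU : Uᵀ * U = 1) (d : m → ℝ) :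
    Uᵀ * (U * diagonal d * Uᵀ) * U = diagonal d := by
  calc _ = (Uᵀ * U) * diagonal d * (Uᵀ * U) := by simp only [Matrix.mul_assoc]
    _ = _ := by rw [hU, Matrix.one_mul, Matrix.mul_one]

lemma conj_diagonal_pow {U : Matrix m m ℝ} (hU : Uᵀ * U = 1) (hU' : U * Uᵀ = 1) (d : m → ℝ)
    (k : ℕ) : (U * diagonal d * Uᵀ) ^ k = U * diagonal (fun x => d x ^ k) * Uᵀ := by
  induction k with
  | zero => simp [hU']
  | succ k ih =>
    rw [pow_succ, ih]
    calc U * diagonal (fun x => d x ^ k) * Uᵀ * (U * diagonal d * Uᵀ)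
        = U * diagonal (fun x => d x ^ k) * (Uᵀ * U) * diagonal d * Uᵀ := by
          simp only [Matrix.mul_assoc]
      _ = _ := by
          rw [hU, Matrix.mul_one, Matrix.mul_assoc U, diagonal_mul_diagonal]
          simp only [pow_succ]

lemma trace_mul_conj_diagonal (Z U : Matrix m m ℝ) (d : m → ℝ) :
    (Z * (U * diagonal d * Uᵀ)).trace = ∑ x, (Uᵀ * Z * U) x x * d x := by
  rw [← Matrix.mul_assoc, trace_mul_comm, ← Matrix.mul_assoc, ← Matrix.mul_assoc, trace]
  simp [mul_diagonal]

lemma trace_mul_conj_diagonal_mul (Z U : Matrix m m ℝ) (d d' : m → ℝ) :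
    (Z * (U * diagonal d * Uᵀ) * (Z * (U * diagonal d' * Uᵀ))).trace
      = ∑ x, ∑ y, (Uᵀ * Z * U) x y * (Uᵀ * Z * U) y x * (d y * d' x) := by
  have h : (Z * (U * diagonal d * Uᵀ) * (Z * (U * diagonal d' * Uᵀ))).trace
      = ((Uᵀ * Z * U) * diagonal d * ((Uᵀ * Z * U) * diagonal d')).trace := by
    rw [show Z * (U * diagonal d * Uᵀ) * (Z * (U * diagonal d' * Uᵀ))
      = (Z * (U * diagonal d * Uᵀ) * (Z * (U * diagonal d'))) * Uᵀ by
        simp only [Matrix.mul_assoc], trace_mul_comm]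
    simp only [Matrix.mul_assoc]
  rw [h, trace]
  refine Finset.sum_congr rfl fun x _ => ?_
  rw [diag_apply, mul_apply]
  refine Finset.sum_congr rfl fun y _ => ?_
  rw [mul_diagonal, mul_diagonal]
  ring

/-- The differences x^a - y^a and x^b - y^b have the same sign. -/
lemma mul_pow_add_mul_pow_le {x y : ℝ} (hx : 0 ≤ x) (hy : 0 ≤ y) (a b : ℕ) :
    y ^ a * x ^ b + x ^ a * y ^ b ≤ x ^ (a + b) + y ^ (a + b) := by
  have h : 0 ≤ (x ^ a - y ^ a) * (x ^ b - y ^ b) := by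
    rcases le_total x y with h | h
    · exact mul_nonneg_of_nonpos_of_nonpos (sub_nonpos.2 (pow_le_pow_left₀ hx h a))
        (sub_nonpos.2 (pow_le_pow_left₀ hx h b))
    · exact mul_nonneg (sub_nonneg.2 (pow_le_pow_left₀ hy h a))
        (sub_nonneg.2 (pow_le_pow_left₀ hy h b))
  rw [pow_add, pow_add]
  linarith

/-- From R(RZ - Z²) = (Z-R) Z (Z-R) + Z (R-Z) Z, which avoids diagonalizing. -/
lemma Matrix.PosSemidef.smul_sub_mul_self {Z : Matrix m m ℝ} {R : ℝ} (hR : 0 < R)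
    (hZ : Z.PosSemidef) (hZR : (R • 1 - Z).PosSemidef) : (R • Z - Z * Z).PosSemidef := by
  have h1 := hZ.conjTranspose_mul_mul_same (Z - R • 1)
  have h2 := hZR.conjTranspose_mul_mul_same Z
  have hZh : Zᴴ = Z := hZ.1
  have h3 := (h1.add h2).smul (inv_nonneg.2 hR.le)
  convert h3 using 1
  rw [conjTranspose_sub, conjTranspose_smul, conjTranspose_one, hZh]
  simp only [star_trivial, sub_mul, mul_sub, smul_mul_assoc, mul_smul_comm, one_mul, mul_one,
    smul_sub, smul_add, smul_smul]
  rw [inv_mul_cancel₀ hR.ne', one_smul]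
  rw [show R⁻¹ * (R * R) = R by field_simp]
  simp only [Matrix.mul_assoc]
  abel

/-- The key trace inequality behind the differential inequality for `tr (M + s Z) ^ q`. -/
lemma trace_mul_pow_mul_pow_le {N Z : Matrix m m ℝ} {r R : ℝ} (hr : 0 < r) (hR : 0 < R)
    (hN : (N - r • 1).PosSemidef) (hZ : Z.PosSemidef) (hZR : (R • 1 - Z).PosSemidef) (a b : ℕ) :
    (Z * N ^ a * (Z * N ^ b)).trace ≤ R / r * (Z * N ^ (a + b + 1)).trace := by
  have hNh : N.IsHermitian := by
    have : N = (N - r • 1) + r • (1 : Matrix m m ℝ) := by abel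
    rw [this]
    exact hN.1.add (by simp [IsHermitian])
  obtain ⟨U, d, hU, hU', hNd⟩ := exists_orthogonal_diagonalization hNh
  have hd : ∀ x, r ≤ d x := by
    intro x
    have h := (hN.conjTranspose_mul_mul_same U).diag_nonneg (i := x)
    rw [conjTranspose_eq_transpose_of_trivial, mul_sub, sub_mul, mul_smul_comm, smul_mul_assoc,
      mul_one, hU, hNd] at h
    rw [conj_diagonal_cancel hU] at h
    simpa using h
  -- From here on everything is computed in an eigenbasis of `N`, where `Z` becomes `Z'`.
  set Z' := Uᵀ * Z * U with hZ'
  have hsymm : ∀ x y, Z' x y = Z' y x := by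
    have h := (hZ.conjTranspose_mul_mul_same U).1
    rw [conjTranspose_eq_transpose_of_trivial] at h
    intro x y
    simpa using (h.apply x y).symm
  have hZ'nonneg : ∀ x, 0 ≤ Z' x x := by
    intro x
    have h := (hZ.conjTranspose_mul_mul_same U).diag_nonneg (i := x)
    rwa [conjTranspose_eq_transpose_of_trivial] at h
  have hsq : ∀ x, ∑ y, Z' x y ^ 2 ≤ R * Z' x x := by
    intro x
    have h := ((hZ.smul_sub_mul_self hR hZR).conjTranspose_mul_mul_same U).diag_nonneg (i := x)
    rw [conjTranspose_eq_transpose_of_trivial, mul_sub, sub_mul, mul_smul_comm, smul_mul_assoc]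
      at h
    have h2 : Uᵀ * (Z * Z) * U = Z' * Z' := by
      rw [hZ']
      calc Uᵀ * (Z * Z) * U = Uᵀ * Z * 1 * Z * U := by simp only [Matrix.mul_assoc, Matrix.one_mul]
        _ = _ := by rw [← hU']; simp only [Matrix.mul_assoc]
    rw [h2, ← hZ'] at h
    have h3 : (Z' * Z') x x = ∑ y, Z' x y ^ 2 := by
      rw [mul_apply]
      exact Finset.sum_congr rfl fun y _ => by rw [hsymm y x, sq]
    rw [Matrix.sub_apply, Matrix.smul_apply, smul_eq_mul, h3] at h
    linarith
  rw [hNd, conj_diagonal_pow hU hU', conj_diagonal_pow hU hU', conj_diagonal_pow hU hU',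
    trace_mul_conj_diagonal_mul, trace_mul_conj_diagonal, ← hZ']
  have hdp : ∀ x, 0 ≤ d x := fun x => hr.le.trans (hd x)
  -- Averaging with x and y exchanged, `mul_pow_add_mul_pow_le` moves both exponents onto one
  -- eigenvalue.
  have h1 : ∑ x, ∑ y, Z' x y * Z' y x * (d y ^ a * d x ^ b)
      ≤ ∑ x, ∑ y, Z' x y ^ 2 * d x ^ (a + b) := by
    have e1 : ∑ x, ∑ y, Z' x y * Z' y x * (d y ^ a * d x ^ b)
        = ∑ x, ∑ y, Z' x y ^ 2 * (d x ^ a * d y ^ b) := by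
      rw [Finset.sum_comm]
      exact Finset.sum_congr rfl fun x _ => Finset.sum_congr rfl fun y _ => by
        rw [hsymm y x]; ring
    have e2 : ∑ x, ∑ y, Z' x y * Z' y x * (d y ^ a * d x ^ b)
        = ∑ x, ∑ y, Z' x y ^ 2 * (d y ^ a * d x ^ b) :=
      Finset.sum_congr rfl fun x _ => Finset.sum_congr rfl fun y _ => by
        rw [hsymm y x]; ring
    have e3 : ∑ x, ∑ y, Z' x y ^ 2 * d x ^ (a + b) = ∑ x, ∑ y, Z' x y ^ 2 * d y ^ (a + b) := by
      rw [Finset.sum_comm]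
      exact Finset.sum_congr rfl fun x _ => Finset.sum_congr rfl fun y _ => by rw [hsymm y x]
    have e4 : ∑ x, ∑ y, Z' x y ^ 2 * (d y ^ a * d x ^ b)
          + ∑ x, ∑ y, Z' x y ^ 2 * (d x ^ a * d y ^ b)
        ≤ ∑ x, ∑ y, Z' x y ^ 2 * d x ^ (a + b) + ∑ x, ∑ y, Z' x y ^ 2 * d y ^ (a + b) := by
      simp only [← Finset.sum_add_distrib, ← mul_add]
      exact Finset.sum_le_sum fun x _ => Finset.sum_le_sum fun y _ =>
        mul_le_mul_of_nonneg_left (mul_pow_add_mul_pow_le (hdp x) (hdp y) a b) (sq_nonneg _)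
    linarith
  refine h1.trans ?_
  rw [Finset.mul_sum]
  refine Finset.sum_le_sum fun x _ => ?_
  rw [← Finset.sum_mul]
  calc (∑ y, Z' x y ^ 2) * d x ^ (a + b) ≤ R * Z' x x * d x ^ (a + b) :=
        mul_le_mul_of_nonneg_right (hsq x) (pow_nonneg (hdp x) _)
    _ = R / r * (Z' x x * (d x ^ (a + b) * r)) := by field_simp
    _ ≤ R / r * (Z' x x * d x ^ (a + b + 1)) := by
        rw [pow_succ]
        have := hd x
        have := hZ'nonneg x
        have := pow_nonneg (hdp x) (a + b)
        gcongr

section Deriv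

attribute [local instance] Matrix.linftyOpNormedRing Matrix.linftyOpNormedAlgebra

/-- The noncommutative product rule; the local norm on matrices serves only to make differentiation
available. -/
lemma hasDerivAt_trace_mul_pow (A M Z : Matrix m m ℝ) (k : ℕ) (s : ℝ) :
    HasDerivAt (fun s : ℝ => (A * (M + s • Z) ^ k).trace)
      (∑ i ∈ Finset.range k, (A * ((M + s • Z) ^ (k - 1 - i) * Z * (M + s • Z) ^ i)).trace) s := by
  have h1 : HasDerivAt (fun s : ℝ => M + s • Z) Z s := by
    have h := ((hasDerivAt_id s).smul_const Z).const_add M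
    rwa [one_smul] at h
  have h2 := (h1.fun_pow' k).const_mul A
  have h3 := (LinearMap.toContinuousLinearMap (traceLinearMap m ℝ ℝ)).hasFDerivAt.comp_hasDerivAt
    s h2
  have h4 : (∑ i ∈ Finset.range k, (A * ((M + s • Z) ^ (k - 1 - i) * Z * (M + s • Z) ^ i)).trace)
      = (LinearMap.toContinuousLinearMap (traceLinearMap m ℝ ℝ))
        (A * ∑ i ∈ Finset.range k, (M + s • Z) ^ (k.pred - i) * Z * (M + s • Z) ^ i) := by
    rw [LinearMap.coe_toContinuousLinearMap', traceLinearMap_apply, Finset.mul_sum, trace_sum]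
    rfl
  rw [h4]
  exact h3

end Deriv

/-- One step of the noncommutative Chernoff bound. -/
lemma trace_add_pow_le {M Z : Matrix m m ℝ} {r R : ℝ} (hr : 0 < r) (hR : 0 < R) (q : ℕ)
    (hq : q * R ≤ r) (hM : (M - r • 1).PosSemidef) (hZ : Z.PosSemidef)
    (hZR : (R • 1 - Z).PosSemidef) :
    ((M + Z) ^ q).trace ≤ (M ^ q).trace + 3 * q * (Z * M ^ (q - 1)).trace := by
  rcases Nat.eq_zero_or_pos q with rfl | hq0
  · simp
  -- Each of the q - 1 terms in the derivative of `h` below costs a factor R/r by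
  -- `trace_mul_pow_mul_pow_le`.
  set c : ℝ := (q - 1 : ℕ) * (R / r) with hc
  have hc1 : c ≤ 1 := by
    have : ((q - 1 : ℕ) : ℝ) ≤ q := by exact_mod_cast Nat.sub_le q 1
    calc c ≤ q * (R / r) := by rw [hc]; gcongr
      _ = q * R / r := by ring
      _ ≤ 1 := by rw [div_le_one hr]; exact hq
  have hN : ∀ s : ℝ, 0 ≤ s → (M + s • Z - r • 1).PosSemidef := by
    intro s hs
    have := hM.add (hZ.smul hs)
    convert this using 1
    abel
  set h : ℝ → ℝ := fun s => (Z * (M + s • Z) ^ (q - 1)).trace with hh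
  have hder : ∀ s, HasDerivAt h (∑ i ∈ Finset.range (q - 1),
      (Z * ((M + s • Z) ^ (q - 1 - 1 - i) * Z * (M + s • Z) ^ i)).trace) s :=
    fun s => hasDerivAt_trace_mul_pow Z M Z (q - 1) s
  have hder_le : ∀ s, 0 ≤ s → (∑ i ∈ Finset.range (q - 1),
      (Z * ((M + s • Z) ^ (q - 1 - 1 - i) * Z * (M + s • Z) ^ i)).trace) ≤ c * h s := by
    intro s hs
    calc _ ≤ ∑ i ∈ Finset.range (q - 1), R / r * h s := by
          refine Finset.sum_le_sum fun i hi => ?_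
          have hi := Finset.mem_range.1 hi
          have := trace_mul_pow_mul_pow_le hr hR (hN s hs) hZ hZR (q - 1 - 1 - i) i
          rw [show q - 1 - 1 - i + i + 1 = q - 1 by omega] at this
          refine le_trans (le_of_eq ?_) this
          simp only [Matrix.mul_assoc]
      _ = c * h s := by simp [hc]; ring
  -- Grönwall: h' ≤ c h.
  have hmono : AntitoneOn (fun s => h s * Real.exp (-(c * s))) (Set.Ici 0) := by
    have hd : ∀ s, HasDerivAt (fun s => h s * Real.exp (-(c * s))) _ s := fun s =>
      (hder s).mul (((hasDerivAt_id s).const_mul c).neg.exp)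
    refine antitoneOn_of_deriv_nonpos (convex_Ici 0)
      (fun s _ => (hd s).continuousAt.continuousWithinAt)
      (fun s _ => (hd s).differentiableAt.differentiableWithinAt) fun s hs => ?_
    rw [interior_Ici] at hs
    rw [(hd s).deriv]
    have := hder_le s (le_of_lt hs)
    have he := Real.exp_pos (-(c * s))
    simp only [id, Pi.neg_apply] at *
    nlinarith
  have h0 : 0 ≤ h 0 := by
    have hMp : (M ^ (q - 1)).PosSemidef := by
      have : M.PosSemidef := by
        have := hM.add ((PosSemidef.one (n := m) (R := ℝ)).smul hr.le)
        simpa using this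
      exact this.pow _
    simp only [hh, zero_smul, add_zero]
    obtain ⟨U, d, hU, hU', hNd⟩ := exists_orthogonal_diagonalization hMp.1
    rw [hNd, trace_mul_conj_diagonal]
    refine Finset.sum_nonneg fun x _ => mul_nonneg ?_ ?_
    · have h := (hZ.conjTranspose_mul_mul_same U).diag_nonneg (i := x)
      rwa [conjTranspose_eq_transpose_of_trivial] at h
    · have h := (hMp.conjTranspose_mul_mul_same U).diag_nonneg (i := x)
      rw [conjTranspose_eq_transpose_of_trivial, hNd] at h
      rw [conj_diagonal_cancel hU] at h
      simpa using h
  have hbound : ∀ s ∈ Set.Icc (0 : ℝ) 1, h s ≤ 3 * h 0 := by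
    intro s hs
    have hc0 : 0 ≤ c := by positivity
    have h1 := hmono (Set.mem_Ici.2 le_rfl) (Set.mem_Ici.2 hs.1) hs.1
    simp only [mul_zero, neg_zero, Real.exp_zero, mul_one] at h1
    have h2 : h s ≤ h 0 * Real.exp (c * s) := by
      have := mul_le_mul_of_nonneg_right h1 (Real.exp_pos (c * s)).le
      rwa [mul_assoc, ← Real.exp_add, neg_add_cancel, Real.exp_zero, mul_one] at this
    -- Since c ≤ 1 and e < 3; this is the 3 in the conclusion.
    have h3 : Real.exp (c * s) ≤ 3 := by
      have : Real.exp (c * s) ≤ Real.exp 1 := Real.exp_le_exp.2 (by nlinarith [hs.1, hs.2])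
      linarith [Real.exp_one_lt_d9]
    nlinarith
  -- Under the trace all q terms of the product rule coincide by cyclicity.
  have hg : ∀ s, HasDerivAt (fun s : ℝ => ((M + s • Z) ^ q).trace) (q * h s) s := by
    intro s
    have := hasDerivAt_trace_mul_pow 1 M Z q s
    simp only [one_mul] at this
    convert this using 1
    rw [show (q : ℝ) * h s = ∑ i ∈ Finset.range q, h s by simp]
    refine Finset.sum_congr rfl fun i hi => ?_
    have hi := Finset.mem_range.1 hi
    rw [trace_mul_comm, ← Matrix.mul_assoc, ← pow_add, trace_mul_comm]
    simp only [hh]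
    congr 3
    omega
  have hfin : AntitoneOn (fun s : ℝ => ((M + s • Z) ^ q).trace - q * (3 * h 0) * s)
      (Set.Icc 0 1) := by
    have hd : ∀ s, HasDerivAt (fun s : ℝ => ((M + s • Z) ^ q).trace - q * (3 * h 0) * s) _ s :=
      fun s => (hg s).sub ((hasDerivAt_id s).const_mul (q * (3 * h 0)))
    refine antitoneOn_of_deriv_nonpos (convex_Icc 0 1)
      (fun s _ => (hd s).continuousAt.continuousWithinAt)
      (fun s _ => (hd s).differentiableAt.differentiableWithinAt) fun s hs => ?_
    rw [interior_Icc] at hs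
    rw [(hd s).deriv]
    have := hbound s ⟨hs.1.le, hs.2.le⟩
    have hq' : (0 : ℝ) ≤ q := by positivity
    nlinarith
  have := hfin (Set.left_mem_Icc.2 zero_le_one) (Set.right_mem_Icc.2 zero_le_one) zero_le_one
  simp only [one_smul, zero_smul, add_zero, mul_one, mul_zero, sub_zero] at this
  simp only [hh, zero_smul, add_zero] at this
  linarith

/-- The quadratic form of a positive semidefinite matrix is controlled by the trace of a power. -/
lemma quadForm_le_of_trace_pow_le {N : Matrix m m ℝ} (hN : N.PosSemidef) {B : ℝ} (hB : 0 ≤ B)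
    {q : ℕ} (hq : q ≠ 0) (h : (N ^ q).trace ≤ B ^ q) : (B • 1 - N).PosSemidef := by
  obtain ⟨U, d, hU, hU', hNd⟩ := exists_orthogonal_diagonalization hN.1
  have hdp : ∀ x, 0 ≤ d x := by
    intro x
    have h := (hN.conjTranspose_mul_mul_same U).diag_nonneg (i := x)
    rw [conjTranspose_eq_transpose_of_trivial, hNd] at h
    rw [conj_diagonal_cancel hU] at h
    simpa using h
  have htr : (N ^ q).trace = ∑ x, d x ^ q := by
    have := trace_mul_conj_diagonal 1 U (fun x => d x ^ q)
    rw [one_mul, mul_one, hU] at this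
    rw [hNd, conj_diagonal_pow hU hU', this]
    simp
  have hd : ∀ x, d x ≤ B := by
    intro x
    refine le_of_pow_le_pow_left₀ hq hB (le_trans ?_ (htr ▸ h))
    exact Finset.single_le_sum (f := fun x => d x ^ q) (fun y _ => pow_nonneg (hdp y) q)
      (Finset.mem_univ x)
  have h1 : (diagonal fun x => B - d x).PosSemidef :=
    posSemidef_diagonal_iff.2 fun x => sub_nonneg.2 (hd x)
  have h2 := h1.mul_mul_conjTranspose_same U
  convert h2 using 1
  rw [conjTranspose_eq_transpose_of_trivial, hNd]
  have : (diagonal fun x => B - d x) = B • (1 : Matrix m m ℝ) - diagonal d := by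
    ext i j
    by_cases hij : i = j
    · subst hij; simp
    · simp [hij]
  rw [this, mul_sub, sub_mul, mul_smul_comm, smul_mul_assoc, mul_one, hU']

end TracePower

/-! ### A matrix Chernoff bound from conditional means. -/

section MatrixChernoff

open Matrix

variable {ι : Type*} [DecidableEq ι] {E : Finset ι} {p : ℝ}
variable {m : Type*}

lemma Matrix.posSemidef_finset_sum {α : Type*} (J : Finset α) (Z : α → Matrix m m ℝ)
    (h : ∀ l ∈ J, (Z l).PosSemidef) : (∑ l ∈ J, Z l).PosSemidef := by
  classical
  induction J using Finset.induction_on with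
  | empty => simpa using PosSemidef.zero
  | insert a J ha ih =>
    rw [Finset.sum_insert ha]
    exact (h a (Finset.mem_insert_self a J)).add
      (ih fun l hl => h l (Finset.mem_insert_of_mem hl))

variable [Fintype m] [DecidableEq m]

lemma Matrix.PosSemidef.trace_mul_nonneg_real {A B : Matrix m m ℝ} (hA : A.PosSemidef)
    (hB : B.PosSemidef) : 0 ≤ (A * B).trace := by
  obtain ⟨U, d, hU, hU', hNd⟩ := exists_orthogonal_diagonalization hB.1
  rw [hNd, trace_mul_conj_diagonal]
  refine Finset.sum_nonneg fun x _ => mul_nonneg ?_ ?_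
  · have h := (hA.conjTranspose_mul_mul_same U).diag_nonneg (i := x)
    rwa [conjTranspose_eq_transpose_of_trivial] at h
  · have h := (hB.conjTranspose_mul_mul_same U).diag_nonneg (i := x)
    rw [conjTranspose_eq_transpose_of_trivial, hNd] at h
    rw [conj_diagonal_cancel hU] at h
    simpa using h

/-- Moment form of the matrix Chernoff bound for sums of bounded positive semidefinite random
matrices, under a bound for the conditional means. -/
lemma bexp_trace_pow_le (hp0 : 0 ≤ p) (hp1 : p ≤ 1) {α : Type*} [DecidableEq α] (V : Finset α)
    (Z : α → Finset ι → Matrix m m ℝ) {r R μ : ℝ} (hr : 0 < r) (hR : 0 < R) (hμ : 0 ≤ μ) {q : ℕ}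
    (hq0 : q ≠ 0) (hq : q * R ≤ r) (hZ : ∀ l ω, (Z l ω).PosSemidef)
    (hZR : ∀ l ω, (R • 1 - Z l ω).PosSemidef)
    (hmean : ∀ J ⊆ V, ∀ l ∈ V, l ∉ J →
      bexp E p (fun ω => (Z l ω * (r • 1 + ∑ a ∈ J, Z a ω) ^ (q - 1)).trace)
        ≤ μ * bexp E p (fun ω => ((r • 1 + ∑ a ∈ J, Z a ω) ^ (q - 1)).trace)) :
    bexp E p (fun ω => ((r • 1 + ∑ a ∈ V, Z a ω) ^ q).trace)
      ≤ (1 + 3 * q * μ / r) ^ V.card * (Fintype.card m * r ^ q) := by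
  suffices H : ∀ J ⊆ V, bexp E p (fun ω => ((r • 1 + ∑ a ∈ J, Z a ω) ^ q).trace)
      ≤ (1 + 3 * q * μ / r) ^ J.card * (Fintype.card m * r ^ q) from H V subset_rfl
  intro J
  induction J using Finset.induction_on with
  | empty =>
    intro _
    simp [smul_pow, bexp_const]
    exact le_of_eq (mul_comm _ _)
  | insert l J hl ih =>
    intro hJ
    have hJV : J ⊆ V := (Finset.subset_insert l J).trans hJ
    have ih := ih hJV
    set M : Finset ι → Matrix m m ℝ := fun ω => r • 1 + ∑ a ∈ J, Z a ω with hM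
    have hMr : ∀ ω, (M ω - r • 1).PosSemidef := by
      intro ω
      simp only [hM, add_sub_cancel_left]
      exact posSemidef_finset_sum _ _ fun a _ => hZ a ω
    have hMp : ∀ ω, (M ω).PosSemidef := by
      intro ω
      have := (hMr ω).add ((PosSemidef.one (n := m) (R := ℝ)).smul hr.le)
      simpa using this
    have h1 : bexp E p (fun ω => ((r • 1 + ∑ a ∈ insert l J, Z a ω) ^ q).trace)
        ≤ bexp E p (fun ω => (M ω ^ q).trace + 3 * q * (Z l ω * M ω ^ (q - 1)).trace) := by
      refine bexp_mono hp0 hp1 fun ω _ => ?_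
      have := trace_add_pow_le hr hR q hq (hMr ω) (hZ l ω) (hZR l ω)
      rw [Finset.sum_insert hl, add_comm (Z l ω), ← add_assoc]
      exact this
    -- The shift by r • 1 makes M ≥ r, so the missing power of `M` is recovered at cost 1/r and the
    -- recursion closes.
    have h2 : bexp E p (fun ω => (M ω ^ (q - 1)).trace)
        ≤ r⁻¹ * bexp E p (fun ω => (M ω ^ q).trace) := by
      rw [← bexp_const_mul]
      refine bexp_mono hp0 hp1 fun ω _ => ?_
      rw [← div_eq_inv_mul, le_div_iff₀ hr]
      have h := (hMr ω).trace_mul_nonneg_real ((hMp ω).pow (q - 1))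
      rw [sub_mul, trace_sub, ← pow_succ', Nat.sub_add_cancel (Nat.pos_of_ne_zero hq0),
        smul_mul_assoc, one_mul, trace_smul, smul_eq_mul] at h
      linarith
    have h3 := hmean J hJV l (hJ (Finset.mem_insert_self l J)) hl
    rw [bexp_add, bexp_const_mul] at h1
    have h4 : 0 ≤ bexp E p (fun ω => (M ω ^ q).trace) :=
      bexp_nonneg hp0 hp1 fun ω _ => ((hMp ω).pow q).trace_nonneg
    have hqp : (0 : ℝ) ≤ 3 * q := by positivity
    calc _ ≤ _ := h1
      _ ≤ bexp E p (fun ω => (M ω ^ q).trace)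
          + 3 * q * (μ * (r⁻¹ * bexp E p (fun ω => (M ω ^ q).trace))) := by
          gcongr
          exact h3.trans (mul_le_mul_of_nonneg_left h2 hμ)
      _ = (1 + 3 * q * μ / r) * bexp E p (fun ω => (M ω ^ q).trace) := by ring
      _ ≤ (1 + 3 * q * μ / r) * ((1 + 3 * q * μ / r) ^ J.card * (Fintype.card m * r ^ q)) := by
          gcongr
      _ = _ := by rw [Finset.card_insert_of_notMem hl, pow_succ']; ring

end MatrixChernoff

/-! ### The Gram matrix of the clique form and its conditional means. -/

section CliqueMatrix

open Matrix

variable {n : ℕ}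

/-- The centred indicator of the edge `{i, j}`. -/
noncomputable def edgeDev (p : ℝ) (ω : Finset (Sym2 (Fin n))) (i j : Fin n) : ℝ :=
  (if s(i, j) ∈ ω then 1 else 0) - p

lemma edgeDev_comm (p : ℝ) (ω : Finset (Sym2 (Fin n))) (i j : Fin n) :
    edgeDev p ω i j = edgeDev p ω j i := by
  rw [edgeDev, edgeDev, Sym2.eq_swap]

lemma edgeDev_insert_of_ne (p : ℝ) (ω : Finset (Sym2 (Fin n))) {a l u w : Fin n} (hu : u ≠ l)
    (hw : w ≠ l) : edgeDev p (insert s(a, l) ω) u w = edgeDev p ω u w := by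
  have : s(u, w) ≠ s(a, l) := by
    rw [Ne, Sym2.eq_iff]
    tauto
  simp [edgeDev, this]

lemma edgeDev_insert_of_ne_left (p : ℝ) (ω : Finset (Sym2 (Fin n))) {a l u : Fin n} (hu : u ≠ a) :
    edgeDev p (insert s(a, l) ω) u l = edgeDev p ω u l := by
  have : s(u, l) ≠ s(a, l) := by
    rwa [Ne, Sym2.congr_left]
  simp [edgeDev, this]

/-- Used with ψ the identity (mean zero), the square (at most p) and the absolute value (at most
2p). -/
lemma bexp_mul_edgeDev (p : ℝ) {a l : Fin n} (hal : a ≠ l) {F : Finset (Sym2 (Fin n)) → ℝ}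
    (hF : Ignores s(a, l) F) (ψ : ℝ → ℝ) :
    bexp (allEdges n) p (fun ω => F ω * ψ (edgeDev p ω a l))
      = (p * ψ (1 - p) + (1 - p) * ψ (-p)) * bexp (allEdges n) p F := by
  classical
  have h := bexp_mul_of_ignores (p := p) (mem_allEdges.2 hal) hF
    (fun P => ψ ((if P then 1 else 0) - p))
  simp only [if_true, if_false, zero_sub] at h
  rw [← h]
  refine bexp_congr fun ω _ => ?_
  simp only [edgeDev]
  congr

/-- The row of edge-pair deviations attached to the pair `(k, l)`. -/
noncomputable def pairVec (c : Fin n → Fin n → ℝ) (V₁ V₂ : Finset (Fin n)) (k l : Fin n) :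
    Fin n × Fin n → ℝ := fun x =>
  if x.1 ∈ V₁ ∧ x.2 ∈ V₂ then
    √|c x.1 x.2| * (c x.1 k * c x.2 k * (c x.1 l * c x.2 l)) else 0

/-- The contribution of the vertex `l` to the Gram matrix of the weighted deviations. -/
noncomputable def vertexGram (c : Fin n → Fin n → ℝ) (V₁ V₂ V₃ : Finset (Fin n)) (l : Fin n) :
    Matrix (Fin n × Fin n) (Fin n × Fin n) ℝ :=
  ∑ k ∈ V₃, |c k l| • vecMulVec (pairVec c V₁ V₂ k l) (pairVec c V₁ V₂ k l)

/-- All weighted codegrees from `V₁ × V₂` into `V₃` are at most `D`. -/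
def CodegLE (c : Fin n → Fin n → ℝ) (V₁ V₂ V₃ : Finset (Fin n)) (D : ℝ) : Prop :=
  ∀ i ∈ V₁, ∀ j ∈ V₂, ∑ k ∈ V₃, c i k ^ 2 * c j k ^ 2 ≤ D

open scoped Classical in
/-- `vertexGram`, truncated at norm `R` and at codegree `D`. -/
noncomputable def truncGram (c : Fin n → Fin n → ℝ) (V₁ V₂ V₃ : Finset (Fin n)) (D R : ℝ)
    (l : Fin n) : Matrix (Fin n × Fin n) (Fin n × Fin n) ℝ :=
  if CodegLE c V₁ V₂ V₃ D ∧ (R • 1 - vertexGram c V₁ V₂ V₃ l).PosSemidef then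
    vertexGram c V₁ V₂ V₃ l else 0

lemma vertexGram_posSemidef (c : Fin n → Fin n → ℝ) (V₁ V₂ V₃ : Finset (Fin n)) (l : Fin n) :
    (vertexGram c V₁ V₂ V₃ l).PosSemidef := by
  refine posSemidef_finset_sum _ _ fun k _ => ?_
  have := posSemidef_vecMulVec_self_star (pairVec c V₁ V₂ k l)
  rw [star_trivial] at this
  exact this.smul (abs_nonneg _)

lemma truncGram_posSemidef (c : Fin n → Fin n → ℝ) (V₁ V₂ V₃ : Finset (Fin n)) (D R : ℝ)
    (l : Fin n) : (truncGram c V₁ V₂ V₃ D R l).PosSemidef := by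
  unfold truncGram
  split_ifs
  · exact vertexGram_posSemidef ..
  · exact PosSemidef.zero

lemma sub_truncGram_posSemidef (c : Fin n → Fin n → ℝ) (V₁ V₂ V₃ : Finset (Fin n)) (D : ℝ) {R : ℝ}
    (hR : 0 ≤ R) (l : Fin n) : (R • 1 - truncGram c V₁ V₂ V₃ D R l).PosSemidef := by
  unfold truncGram
  split_ifs with h
  · exact h.2
  · rw [sub_zero]
    exact PosSemidef.one.smul hR

lemma codegLE_congr {c c' : Fin n → Fin n → ℝ} {V₁ V₂ V₃ : Finset (Fin n)} {l : Fin n}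
    (h₁ : l ∉ V₁) (h₂ : l ∉ V₂) (h₃ : l ∉ V₃) (hc : ∀ u w, u ≠ l → w ≠ l → c u w = c' u w)
    (D : ℝ) : CodegLE c V₁ V₂ V₃ D ↔ CodegLE c' V₁ V₂ V₃ D := by
  unfold CodegLE
  refine forall₂_congr fun i hi => forall₂_congr fun j hj => ?_
  rw [Finset.sum_congr rfl fun k hk => by
    rw [hc i k (ne_of_mem_of_not_mem hi h₁) (ne_of_mem_of_not_mem hk h₃),
      hc j k (ne_of_mem_of_not_mem hj h₂) (ne_of_mem_of_not_mem hk h₃)]]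

/-- This is the independence between summands: the term of another vertex l' sees no edge at l. -/
lemma truncGram_congr {c c' : Fin n → Fin n → ℝ} {V₁ V₂ V₃ : Finset (Fin n)} {l l' : Fin n}
    (h₁ : l ∉ V₁) (h₂ : l ∉ V₂) (h₃ : l ∉ V₃) (hl : l' ≠ l)
    (hc : ∀ u w, u ≠ l → w ≠ l → c u w = c' u w) (D R : ℝ) :
    truncGram c V₁ V₂ V₃ D R l' = truncGram c' V₁ V₂ V₃ D R l' := by
  have hg : vertexGram c V₁ V₂ V₃ l' = vertexGram c' V₁ V₂ V₃ l' := by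
    refine Finset.sum_congr rfl fun k hk => ?_
    have hk' := ne_of_mem_of_not_mem hk h₃
    have hv : pairVec c V₁ V₂ k l' = pairVec c' V₁ V₂ k l' := by
      funext x
      unfold pairVec
      split_ifs with hx
      · have hx1 := ne_of_mem_of_not_mem hx.1 h₁
        have hx2 := ne_of_mem_of_not_mem hx.2 h₂
        rw [hc _ _ hx1 hx2, hc _ _ hx1 hk', hc _ _ hx2 hk', hc _ _ hx1 hl, hc _ _ hx2 hl]
      · rfl
    rw [hv, hc _ _ hk' hl]
  unfold truncGram
  rw [hg, codegLE_congr h₁ h₂ h₃ hc D]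

set_option maxHeartbeats 1000000 in
open scoped Classical in
/-- The mean of the contribution of a vertex is diagonal, hence small. -/
lemma bexp_trace_truncGram_mul_le {p : ℝ} (hp0 : 0 ≤ p) (hp1 : p ≤ 1) {V₁ V₂ V₃ : Finset (Fin n)}
    (h12 : Disjoint V₁ V₂) (h13 : Disjoint V₁ V₃) (h23 : Disjoint V₂ V₃) {l : Fin n}
    (h₁ : l ∉ V₁) (h₂ : l ∉ V₂) (h₃ : l ∉ V₃) {D R : ℝ} (hD : 0 ≤ D)
    (F : Finset (Sym2 (Fin n)) → Matrix (Fin n × Fin n) (Fin n × Fin n) ℝ)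
    (hF : ∀ ω, (F ω).PosSemidef) (hFi : ∀ a, Ignores s(a, l) F) :
    bexp (allEdges n) p (fun ω => (truncGram (edgeDev p ω) V₁ V₂ V₃ D R l * F ω).trace)
      ≤ 2 * p ^ 3 * D * bexp (allEdges n) p (fun ω => (F ω).trace) := by
  set A : Finset (Sym2 (Fin n)) → ℝ := fun ω =>
    if CodegLE (edgeDev p ω) V₁ V₂ V₃ D then 1 else 0 with hA
  have hAi : ∀ a, Ignores s(a, l) A := by
    intro a ω
    simp only [hA]
    rw [codegLE_congr h₁ h₂ h₃ fun u w hu hw => edgeDev_insert_of_ne p ω hu hw]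
  have hA0 : ∀ ω, 0 ≤ A ω := fun ω => by simp only [hA]; split_ifs <;> norm_num
  set T : Fin n → Fin n × Fin n → Fin n × Fin n → Finset (Sym2 (Fin n)) → ℝ := fun k x y ω =>
    A ω * (|edgeDev p ω k l| * (pairVec (edgeDev p ω) V₁ V₂ k l x
      * pairVec (edgeDev p ω) V₁ V₂ k l y) * F ω y x) with hT
  -- The truncation of the norm depends on edges at l and would spoil the centring. Dropping it only
  -- increases the trace; the codegree truncation `A` ignores the edges at l and is kept.
  have h1 : bexp (allEdges n) p (fun ω => (truncGram (edgeDev p ω) V₁ V₂ V₃ D R l * F ω).trace)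
      ≤ bexp (allEdges n) p (fun ω => ∑ k ∈ V₃, ∑ x, ∑ y, T k x y ω) := by
    refine bexp_mono hp0 hp1 fun ω _ => ?_
    have h2 : ∑ k ∈ V₃, ∑ x, ∑ y, T k x y ω
        = A ω * (vertexGram (edgeDev p ω) V₁ V₂ V₃ l * F ω).trace := by
      simp only [hT, vertexGram, Finset.sum_mul, trace_sum, Finset.mul_sum]
      refine Finset.sum_congr rfl fun k _ => ?_
      rw [trace, Finset.mul_sum]
      refine Finset.sum_congr rfl fun x _ => ?_
      rw [diag_apply, mul_apply, Finset.mul_sum]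
      refine Finset.sum_congr rfl fun y _ => ?_
      rw [Matrix.smul_apply, vecMulVec_apply, smul_eq_mul]
    rw [h2]
    have hnn := (vertexGram_posSemidef (edgeDev p ω) V₁ V₂ V₃ l).trace_mul_nonneg_real (hF ω)
    unfold truncGram
    split_ifs with h
    · simp [hA, h.1]
    · rw [zero_mul, trace_zero]
      exact mul_nonneg (hA0 ω) hnn
  refine h1.trans ?_
  have hoff : ∀ k ∈ V₃, ∀ x y, x ≠ y → bexp (allEdges n) p (T k x y) = 0 := by
    intro k hk x y hxy
    have hkl := ne_of_mem_of_not_mem hk h₃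
    by_cases hx : x.1 ∈ V₁ ∧ x.2 ∈ V₂
    swap
    · have : T k x y = fun _ => 0 := by
        funext ω
        simp [hT, pairVec, hx]
      rw [this, bexp_const]
    by_cases hy : y.1 ∈ V₁ ∧ y.2 ∈ V₂
    swap
    · have : T k x y = fun _ => 0 := by
        funext ω
        simp [hT, pairVec, hy]
      rw [this, bexp_const]
    obtain ⟨i, j⟩ := x
    obtain ⟨i', j'⟩ := y
    simp only at hx hy
    have hil := ne_of_mem_of_not_mem hx.1 h₁
    have hjl := ne_of_mem_of_not_mem hx.2 h₂
    have hil' := ne_of_mem_of_not_mem hy.1 h₁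
    have hjl' := ne_of_mem_of_not_mem hy.2 h₂
    have hTe : T k (i, j) (i', j') = fun ω => A ω * (|edgeDev p ω k l| *
        (√|edgeDev p ω i j| * (edgeDev p ω i k * edgeDev p ω j k *
          (edgeDev p ω i l * edgeDev p ω j l)) *
        (√|edgeDev p ω i' j'| * (edgeDev p ω i' k * edgeDev p ω j' k *
          (edgeDev p ω i' l * edgeDev p ω j' l)))) * F ω (i', j') (i, j)) := by
      funext ω
      simp [hT, pairVec, hx, hy]
    -- If i = i' then j ≠ j' and the centred variable of {j, l} occurs exactly once; otherwise that
    -- of {i, l} does. Disjointness of the classes excludes any other occurrence.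
    by_cases hii : i = i'
    · have hjj : j' ≠ j := by
        rintro rfl
        exact hxy (by rw [hii])
      have hij : i ≠ j := fun h => Finset.disjoint_left.1 h12 hx.1 (h ▸ hx.2)
      have hij' : i' ≠ j := hii ▸ hij
      have hkj : k ≠ j := fun h => Finset.disjoint_left.1 h23 hx.2 (h ▸ hk)
      have hI : Ignores s(j, l) fun ω => A ω * (|edgeDev p ω k l| *
        (√|edgeDev p ω i j| * (edgeDev p ω i k * edgeDev p ω j k *
          (edgeDev p ω i l)) *
        (√|edgeDev p ω i' j'| * (edgeDev p ω i' k * edgeDev p ω j' k *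
          (edgeDev p ω i' l * edgeDev p ω j' l)))) * F ω (i', j') (i, j)) := by
        intro ω
        simp only [hAi j ω, hFi j ω, edgeDev_insert_of_ne_left p ω hkj,
          edgeDev_insert_of_ne_left p ω hij, edgeDev_insert_of_ne_left p ω hij',
          edgeDev_insert_of_ne_left p ω hjj, edgeDev_insert_of_ne p ω hil hjl,
          edgeDev_insert_of_ne p ω hil hkl, edgeDev_insert_of_ne p ω hjl hkl,
          edgeDev_insert_of_ne p ω hil' hjl', edgeDev_insert_of_ne p ω hil' hkl,
          edgeDev_insert_of_ne p ω hjl' hkl]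
      have := bexp_mul_edgeDev p hjl hI id
      rw [show p * id (1 - p) + (1 - p) * id (-p) = 0 by simp only [id]; ring, zero_mul] at this
      rw [hTe, ← this]
      refine bexp_congr fun ω _ => ?_
      simp only [id]
      ring
    · have hij : j ≠ i := fun h => Finset.disjoint_left.1 h12 hx.1 (h ▸ hx.2)
      have hij' : j' ≠ i := fun h => Finset.disjoint_left.1 h12 hx.1 (h ▸ hy.2)
      have hii' : i' ≠ i := fun h => hii h.symm
      have hki : k ≠ i := fun h => Finset.disjoint_left.1 h13 hx.1 (h ▸ hk)
      have hI : Ignores s(i, l) fun ω => A ω * (|edgeDev p ω k l| *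
        (√|edgeDev p ω i j| * (edgeDev p ω i k * edgeDev p ω j k *
          (edgeDev p ω j l)) *
        (√|edgeDev p ω i' j'| * (edgeDev p ω i' k * edgeDev p ω j' k *
          (edgeDev p ω i' l * edgeDev p ω j' l)))) * F ω (i', j') (i, j)) := by
        intro ω
        simp only [hAi i ω, hFi i ω, edgeDev_insert_of_ne_left p ω hki,
          edgeDev_insert_of_ne_left p ω hij, edgeDev_insert_of_ne_left p ω hij',
          edgeDev_insert_of_ne_left p ω hii', edgeDev_insert_of_ne p ω hil hjl,
          edgeDev_insert_of_ne p ω hil hkl, edgeDev_insert_of_ne p ω hjl hkl,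
          edgeDev_insert_of_ne p ω hil' hjl', edgeDev_insert_of_ne p ω hil' hkl,
          edgeDev_insert_of_ne p ω hjl' hkl]
      have := bexp_mul_edgeDev p hil hI id
      rw [show p * id (1 - p) + (1 - p) * id (-p) = 0 by simp only [id]; ring, zero_mul] at this
      rw [hTe, ← this]
      refine bexp_congr fun ω _ => ?_
      simp only [id]
      ring
  -- Integrate out {k, l}, {j, l}, {i, l}: the factors are at most 2p, p and p. The remaining |c_ij|
  -- is at most 1.
  have hdiag : ∀ k ∈ V₃, ∀ i ∈ V₁, ∀ j ∈ V₂, bexp (allEdges n) p (T k (i, j) (i, j))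
      ≤ 2 * p ^ 3 * bexp (allEdges n) p (fun ω => A ω * F ω (i, j) (i, j) *
        (edgeDev p ω i k ^ 2 * edgeDev p ω j k ^ 2)) := by
    intro k hk i hi j hj
    have hkl := ne_of_mem_of_not_mem hk h₃
    have hil := ne_of_mem_of_not_mem hi h₁
    have hjl := ne_of_mem_of_not_mem hj h₂
    have hij : i ≠ j := fun h => Finset.disjoint_left.1 h12 hi (h ▸ hj)
    have hik : i ≠ k := fun h => Finset.disjoint_left.1 h13 hi (h ▸ hk)
    have hjk : j ≠ k := fun h => Finset.disjoint_left.1 h23 hj (h ▸ hk)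
    set B : Finset (Sym2 (Fin n)) → ℝ := fun ω => A ω * F ω (i, j) (i, j) *
        (|edgeDev p ω i j| * (edgeDev p ω i k ^ 2 * edgeDev p ω j k ^ 2)) with hB
    have hBi : ∀ a, Ignores s(a, l) B := by
      intro a ω
      simp only [hB, hAi a ω, hFi a ω, edgeDev_insert_of_ne p ω hil hjl,
          edgeDev_insert_of_ne p ω hil hkl, edgeDev_insert_of_ne p ω hjl hkl]
    have e1 : Ignores s(j, l) fun ω => B ω * edgeDev p ω i l ^ 2 := fun ω => by
      simp only [hBi j ω, edgeDev_insert_of_ne_left p ω hij]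
    have e2 : Ignores s(k, l) fun ω => B ω * edgeDev p ω i l ^ 2 * edgeDev p ω j l ^ 2 :=
      fun ω => by
        simp only [hBi k ω, edgeDev_insert_of_ne_left p ω hik, edgeDev_insert_of_ne_left p ω hjk]
    have f0 := bexp_mul_edgeDev p hil (hBi i) (fun t => t ^ 2)
    have f1 := bexp_mul_edgeDev p hjl e1 (fun t => t ^ 2)
    have f2 := bexp_mul_edgeDev p hkl e2 (fun t => |t|)
    have hT2 : bexp (allEdges n) p (T k (i, j) (i, j)) =
        bexp (allEdges n) p (fun ω => B ω * edgeDev p ω i l ^ 2 * edgeDev p ω j l ^ 2 *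
          |edgeDev p ω k l|) := by
      refine bexp_congr fun ω _ => ?_
      simp only [hT, hB, pairVec, hi, hj, and_self, if_true]
      have := Real.mul_self_sqrt (abs_nonneg (edgeDev p ω i j))
      linear_combination (A ω * F ω (i, j) (i, j) * (edgeDev p ω i k ^ 2 * edgeDev p ω j k ^ 2)
        * edgeDev p ω i l ^ 2 * edgeDev p ω j l ^ 2 * |edgeDev p ω k l|) * this
    rw [hT2]
    refine f2.trans_le ?_
    refine (congrArg _ (f1.trans (congrArg _ f0))).trans_le ?_
    have hB0 : 0 ≤ bexp (allEdges n) p B := by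
      refine bexp_nonneg hp0 hp1 fun ω _ => ?_
      have := hA0 ω
      have := (hF ω).diag_nonneg (i := (i, j))
      positivity
    have hBle : bexp (allEdges n) p B ≤ bexp (allEdges n) p (fun ω => A ω * F ω (i, j) (i, j) *
        (edgeDev p ω i k ^ 2 * edgeDev p ω j k ^ 2)) := by
      refine bexp_mono hp0 hp1 fun ω _ => ?_
      have := hA0 ω
      have := (hF ω).diag_nonneg (i := (i, j))
      have h1 : |edgeDev p ω i j| ≤ 1 := by
        unfold edgeDev
        split_ifs <;> rw [abs_le] <;> constructor <;> linarith
      simp only [hB]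
      refine mul_le_mul_of_nonneg_left ?_ (by positivity)
      exact mul_le_of_le_one_left (by positivity) h1
    have hc1 : p * |1 - p| + (1 - p) * |-p|
        ≤ 2 * p := by
      simp only [abs_neg, abs_of_nonneg hp0,
        abs_of_nonneg (sub_nonneg.2 hp1)]
      nlinarith
    have hc1' : 0 ≤ p * |1 - p| + (1 - p) * |-p| := by
      have : 0 ≤ 1 - p := by linarith
      positivity
    have hc2 : p * (1 - p) ^ 2 + (1 - p) * (-p) ^ 2
        ≤ p := by
      nlinarith [mul_nonneg hp0 hp0]
    have hc2' : 0 ≤ p * (1 - p) ^ 2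
        + (1 - p) * (-p) ^ 2 := by
      have : 0 ≤ 1 - p := by linarith
      positivity
    calc _ ≤ 2 * p * (p * (p * bexp (allEdges n) p B)) := by gcongr
      _ = 2 * p ^ 3 * bexp (allEdges n) p B := by ring
      _ ≤ _ := by gcongr
  have hsplit : bexp (allEdges n) p (fun ω => ∑ k ∈ V₃, ∑ x, ∑ y, T k x y ω)
      = ∑ x, ∑ k ∈ V₃, bexp (allEdges n) p (T k x x) := by
    rw [bexp_sum, Finset.sum_comm]
    refine Finset.sum_congr rfl fun k hk => ?_
    rw [bexp_sum]
    refine Finset.sum_congr rfl fun x _ => ?_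
    rw [bexp_sum, Finset.sum_eq_single x]
    · intro y _ hy
      exact hoff k hk x y hy.symm
    · simp
  rw [hsplit]
  simp only [trace, diag_apply]
  rw [bexp_sum, Finset.mul_sum]
  refine Finset.sum_le_sum fun x _ => ?_
  have hFx : 0 ≤ bexp (allEdges n) p (fun ω => F ω x x) :=
    bexp_nonneg hp0 hp1 fun ω _ => (hF ω).diag_nonneg
  by_cases hx : x.1 ∈ V₁ ∧ x.2 ∈ V₂
  swap
  · have : ∀ k, T k x x = fun _ => 0 := by
      intro k
      funext ω
      simp [hT, pairVec, hx]
    simp only [this, bexp_const, Finset.sum_const_zero]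
    positivity
  obtain ⟨i, j⟩ := x
  calc _ ≤ ∑ k ∈ V₃, 2 * p ^ 3 * bexp (allEdges n) p (fun ω => A ω * F ω (i, j) (i, j) *
        (edgeDev p ω i k ^ 2 * edgeDev p ω j k ^ 2)) :=
        Finset.sum_le_sum fun k hk => hdiag k hk i hx.1 j hx.2
    _ = 2 * p ^ 3 * bexp (allEdges n) p (fun ω => A ω * F ω (i, j) (i, j) *
        ∑ k ∈ V₃, (edgeDev p ω i k ^ 2 * edgeDev p ω j k ^ 2)) := by
        rw [← Finset.mul_sum, ← bexp_sum]
        simp only [Finset.mul_sum]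
    -- The codegree truncation `A` bounds the sum over k by `D`.
    _ ≤ 2 * p ^ 3 * bexp (allEdges n) p (fun ω => D * F ω (i, j) (i, j)) := by
        refine mul_le_mul_of_nonneg_left (bexp_mono hp0 hp1 fun ω _ => ?_) (by positivity)
        have hf := (hF ω).diag_nonneg (i := (i, j))
        by_cases h : CodegLE (edgeDev p ω) V₁ V₂ V₃ D
        · simp only [hA, h, if_true, one_mul]
          rw [mul_comm]
          exact mul_le_mul_of_nonneg_right (h i hx.1 j hx.2) hf
        · simp only [hA, h, if_false, zero_mul]
          positivity
    _ = _ := by rw [bexp_const_mul]; ring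

end CliqueMatrix

/-! ### Norm bounds for the Gram matrix and for the clique form. -/

section CliqueMatrixBound

open Matrix

variable {n : ℕ}

/-- Tail bound for the largest eigenvalue of the truncated Gram matrix. -/
lemma bprob_sum_truncGram_le {p : ℝ} (hp0 : 0 ≤ p) (hp1 : p ≤ 1) {V₁ V₂ V₃ V₄ : Finset (Fin n)}
    (h12 : Disjoint V₁ V₂) (h13 : Disjoint V₁ V₃) (h23 : Disjoint V₂ V₃) (h14 : Disjoint V₁ V₄)
    (h24 : Disjoint V₂ V₄) (h34 : Disjoint V₃ V₄) {D R : ℝ} (hD : 0 ≤ D) (hR : 0 < R)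
    (hDR : n * (2 * p ^ 3 * D) ≤ R) {q : ℕ} (hq : q ≠ 0) :
    bprob (allEdges n) p (fun ω => ¬ ((3 * (q * R)) • 1 -
      ∑ l ∈ V₄, truncGram (edgeDev p ω) V₁ V₂ V₃ D R l).PosSemidef)
      ≤ Real.exp 3 * n ^ 2 * Real.exp (-q) := by
  set r : ℝ := q * R with hr
  have hq0 : (0 : ℝ) < q := by exact_mod_cast Nat.pos_of_ne_zero hq
  have hr0 : 0 < r := by positivity
  have hmain := bexp_trace_pow_le (E := allEdges n) hp0 hp1 V₄
    (fun l ω => truncGram (edgeDev p ω) V₁ V₂ V₃ D R l) (r := r) (R := R) (μ := 2 * p ^ 3 * D)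
    hr0 hR (by positivity) hq le_rfl (fun l ω => truncGram_posSemidef ..)
    (fun l ω => sub_truncGram_posSemidef _ _ _ _ _ hR.le _) (by
      intro J _ l hl hlJ
      have hl1 : l ∉ V₁ := fun h => Finset.disjoint_left.1 h14 h hl
      have hl2 : l ∉ V₂ := fun h => Finset.disjoint_left.1 h24 h hl
      have hl3 : l ∉ V₃ := fun h => Finset.disjoint_left.1 h34 h hl
      refine bexp_trace_truncGram_mul_le hp0 hp1 h12 h13 h23 hl1 hl2 hl3 hD
        (fun ω => (r • 1 + ∑ a ∈ J, truncGram (edgeDev p ω) V₁ V₂ V₃ D R a) ^ (q - 1)) ?_ ?_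
      · intro ω
        exact ((PosSemidef.one.smul hr0.le).add
          (posSemidef_finset_sum _ _ fun a _ => truncGram_posSemidef ..)).pow _
      · intro a ω
        have : ∀ b ∈ J, truncGram (edgeDev p (insert s(a, l) ω)) V₁ V₂ V₃ D R b
            = truncGram (edgeDev p ω) V₁ V₂ V₃ D R b := fun b hb =>
          truncGram_congr hl1 hl2 hl3 (ne_of_mem_of_not_mem hb hlJ)
            (fun u w hu hw => edgeDev_insert_of_ne p ω hu hw) D R
        simp only [Finset.sum_congr rfl this])
  have hN : ∀ ω, (r • 1 + ∑ l ∈ V₄, truncGram (edgeDev p ω) V₁ V₂ V₃ D R l).PosSemidef :=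
    fun ω => (PosSemidef.one.smul hr0.le).add
      (posSemidef_finset_sum _ _ fun a _ => truncGram_posSemidef ..)
  have hmarkov := bprob_le_bexp (E := allEdges n) (p := p) (S := fun ω => ¬ ((3 * (q * R)) • 1 -
      ∑ l ∈ V₄, truncGram (edgeDev p ω) V₁ V₂ V₃ D R l).PosSemidef)
    (f := fun ω => ((r • 1 + ∑ l ∈ V₄, truncGram (edgeDev p ω) V₁ V₂ V₃ D R l) ^ q).trace)
    (a := (3 * r) ^ q) hp0 hp1 (by positivity) (fun ω _ => ((hN ω).pow q).trace_nonneg) (by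
      intro ω _ h
      by_contra hlt
      apply h
      have h1 := quadForm_le_of_trace_pow_le (hN ω) (by positivity : (0 : ℝ) ≤ 3 * r) hq
        (not_le.1 hlt).le
      -- The trace controls the shifted matrix r • 1 + Σ, so a slack of r is given away here.
      have h2 := h1.add ((PosSemidef.one (n := Fin n × Fin n) (R := ℝ)).smul hr0.le)
      convert h2 using 1
      abel)
  refine hmarkov.trans ?_
  rw [div_le_iff₀ (by positivity)]
  refine hmain.trans ?_
  have hcard : (V₄.card : ℝ) ≤ n := by
    exact_mod_cast (Finset.card_le_univ V₄).trans_eq (Fintype.card_fin n)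
  have hx : 3 * q * (2 * p ^ 3 * D) / r = 3 * (2 * p ^ 3 * D) / R := by
    rw [hr]
    field_simp
  -- With r = qR the growth rate is 3μ/R, μ = 2p³D, and nμ ≤ R by `hDR`.
  have h1 : (1 + 3 * q * (2 * p ^ 3 * D) / r) ^ V₄.card ≤ Real.exp 3 := by
    rw [hx]
    calc (1 + 3 * (2 * p ^ 3 * D) / R) ^ V₄.card
        ≤ Real.exp (3 * (2 * p ^ 3 * D) / R) ^ V₄.card := by
          refine pow_le_pow_left₀ (by positivity) ?_ _
          rw [add_comm]
          exact Real.add_one_le_exp _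
      _ = Real.exp (V₄.card * (3 * (2 * p ^ 3 * D) / R)) := by rw [← Real.exp_nat_mul]
      _ ≤ Real.exp 3 := by
          apply Real.exp_le_exp.2
          calc V₄.card * (3 * (2 * p ^ 3 * D) / R) ≤ n * (3 * (2 * p ^ 3 * D) / R) := by gcongr
            _ = 3 * (n * (2 * p ^ 3 * D) / R) := by ring
            _ ≤ 3 * 1 := by gcongr; rwa [div_le_one hR]
            _ = 3 := by norm_num
  -- The Markov threshold is (3r)^q against a moment of order r^q; the gain 3^{-q} is at most
  -- e^{-q}.
  have h2 : 1 ≤ Real.exp (-q) * 3 ^ q := by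
    have : Real.exp q ≤ 3 ^ q := by
      rw [← mul_one (q : ℝ), Real.exp_nat_mul]
      exact pow_le_pow_left₀ (Real.exp_pos 1).le (by linarith [Real.exp_one_lt_d9]) q
    calc (1 : ℝ) = Real.exp (-q) * Real.exp q := by rw [← Real.exp_add]; simp
      _ ≤ _ := by gcongr
  calc _ ≤ Real.exp 3 * (Fintype.card (Fin n × Fin n) * r ^ q) := by gcongr
    _ = Real.exp 3 * n ^ 2 * r ^ q * 1 := by simp; ring
    _ ≤ Real.exp 3 * n ^ 2 * r ^ q * (Real.exp (-q) * 3 ^ q) := by gcongr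
    _ = _ := by rw [mul_pow]; ring

lemma sum_ite_mem_prod (V₁ V₂ : Finset (Fin n)) (f : Fin n × Fin n → ℝ) :
    ∑ x : Fin n × Fin n, (if x.1 ∈ V₁ ∧ x.2 ∈ V₂ then f x else 0) = ∑ i ∈ V₁, ∑ j ∈ V₂, f (i, j) := by
  rw [← Finset.sum_product', ← Finset.sum_filter]
  refine Finset.sum_congr ?_ fun _ _ => rfl
  ext x
  simp

lemma dotProduct_vertexGram (c : Fin n → Fin n → ℝ) (V₁ V₂ V₃ : Finset (Fin n)) (l : Fin n)
    (z : Fin n × Fin n → ℝ) : z ⬝ᵥ vertexGram c V₁ V₂ V₃ l *ᵥ z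
      = ∑ k ∈ V₃, |c k l| * (∑ x, pairVec c V₁ V₂ k l x * z x) ^ 2 := by
  rw [vertexGram, sum_mulVec, dotProduct_sum]
  refine Finset.sum_congr rfl fun k _ => ?_
  rw [smul_mulVec, dotProduct_smul, vecMulVec_mulVec, dotProduct_smul]
  simp only [smul_eq_mul, MulOpposite.smul_eq_mul_unop, MulOpposite.unop_op, dotProduct]
  rw [sq]
  congr 2
  exact Finset.sum_congr rfl fun x _ => mul_comm _ _

/-- Schur test for the contribution of one vertex. -/
lemma sub_vertexGram_posSemidef {c : Fin n → Fin n → ℝ} {V₁ V₂ V₃ : Finset (Fin n)} {l : Fin n}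
    (hc : ∀ i, |c i l| ≤ 1) {R₁ R₂ : ℝ} (hR₁ : 0 ≤ R₁) (hR₂ : 0 ≤ R₂)
    (h₁ : ∀ k ∈ V₃, ∑ i ∈ V₁, ∑ j ∈ V₂, |c i j| * (|c i k| * |c j k| * (|c i l| * |c j l|)) ≤ R₁)
    (h₂ : ∀ i ∈ V₁, ∀ j ∈ V₂, ∑ k ∈ V₃, |c k l| * (|c i k| * |c j k|) ≤ R₂) :
    ((R₁ * R₂) • 1 - vertexGram c V₁ V₂ V₃ l).PosSemidef := by
  rw [posSemidef_iff_dotProduct_mulVec]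
  refine ⟨?_, fun z => ?_⟩
  · exact (isHermitian_one.smul (IsSelfAdjoint.all _)).sub (vertexGram_posSemidef ..).1
  rw [star_trivial, sub_mulVec, dotProduct_sub, dotProduct_vertexGram, smul_mulVec, one_mulVec,
    dotProduct_smul, smul_eq_mul, sub_nonneg]
  set H : Fin n → Fin n × Fin n → ℝ := fun k x =>
    |c x.1 k| * |c x.2 k| * (|c x.1 l| * |c x.2 l|) with hH
  have hH0 : ∀ k x, 0 ≤ H k x := fun k x => by positivity
  have hCS : ∀ k ∈ V₃, (∑ x, pairVec c V₁ V₂ k l x * z x) ^ 2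
      ≤ R₁ * ∑ i ∈ V₁, ∑ j ∈ V₂, H k (i, j) * z (i, j) ^ 2 := by
    intro k hk
    -- Cauchy–Schwarz with the entry split as (|c_ij| H) · (H z²), so that |c_ij| stays in the row
    -- sum bounded by `R₁`.
    have h := Finset.sum_sq_le_sum_mul_sum_of_sq_le_mul (Finset.univ : Finset (Fin n × Fin n))
      (r := fun x => pairVec c V₁ V₂ k l x * z x)
      (f := fun x => if x.1 ∈ V₁ ∧ x.2 ∈ V₂ then |c x.1 x.2| * H k x else 0)
      (g := fun x => if x.1 ∈ V₁ ∧ x.2 ∈ V₂ then H k x * z x ^ 2 else 0)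
      (fun x _ => by split_ifs <;> [exact mul_nonneg (abs_nonneg _) (hH0 k x); rfl])
      (fun x _ => by split_ifs <;> [exact mul_nonneg (hH0 k x) (sq_nonneg _); rfl])
      (fun x _ => le_of_eq <| by
        simp only [pairVec]
        split_ifs
        · have h1 := Real.sq_sqrt (abs_nonneg (c x.1 x.2))
          simp only [mul_pow, h1, hH]
          have e : ∀ t : ℝ, t ^ 2 = |t| * |t| := fun t => by rw [← abs_mul, ← sq, abs_sq]
          rw [e (c x.1 k), e (c x.2 k), e (c x.1 l), e (c x.2 l)]
          ring
        · simp)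
    rw [sum_ite_mem_prod V₁ V₂ (fun x => |c x.1 x.2| * H k x),
      sum_ite_mem_prod V₁ V₂ (fun x => H k x * z x ^ 2)] at h
    refine h.trans (mul_le_mul_of_nonneg_right (h₁ k hk) ?_)
    exact Finset.sum_nonneg fun i _ => Finset.sum_nonneg fun j _ =>
      mul_nonneg (hH0 k _) (sq_nonneg _)
  calc ∑ k ∈ V₃, |c k l| * (∑ x, pairVec c V₁ V₂ k l x * z x) ^ 2
      ≤ ∑ k ∈ V₃, |c k l| * (R₁ * ∑ i ∈ V₁, ∑ j ∈ V₂, H k (i, j) * z (i, j) ^ 2) :=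
        Finset.sum_le_sum fun k hk => mul_le_mul_of_nonneg_left (hCS k hk) (abs_nonneg _)
    _ = R₁ * ∑ i ∈ V₁, ∑ j ∈ V₂, (∑ k ∈ V₃, |c k l| * H k (i, j)) * z (i, j) ^ 2 := by
        simp only [Finset.mul_sum, Finset.sum_mul]
        rw [Finset.sum_comm]
        refine Finset.sum_congr rfl fun i _ => ?_
        rw [Finset.sum_comm]
        refine Finset.sum_congr rfl fun j _ => Finset.sum_congr rfl fun k _ => by ring
    _ ≤ R₁ * ∑ i ∈ V₁, ∑ j ∈ V₂, R₂ * z (i, j) ^ 2 := by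
        refine mul_le_mul_of_nonneg_left (Finset.sum_le_sum fun i hi => Finset.sum_le_sum
          fun j hj => mul_le_mul_of_nonneg_right (le_trans ?_ (h₂ i hi j hj)) (sq_nonneg _)) hR₁
        refine Finset.sum_le_sum fun k _ => mul_le_mul_of_nonneg_left ?_ (abs_nonneg _)
        -- In the column sum the two factors at l are bounded by 1.
        exact mul_le_of_le_one_right (by positivity)
          (mul_le_one₀ (hc i) (abs_nonneg _) (hc j))
    _ = R₁ * R₂ * ∑ i ∈ V₁, ∑ j ∈ V₂, z (i, j) ^ 2 := by simp only [← Finset.mul_sum]; ring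
    _ ≤ R₁ * R₂ * (z ⬝ᵥ z) := by
        refine mul_le_mul_of_nonneg_left ?_ (by positivity)
        rw [← sum_ite_mem_prod V₁ V₂ (fun x => z x ^ 2), dotProduct]
        refine Finset.sum_le_sum fun x _ => ?_
        split_ifs
        · rw [sq]
        · exact mul_self_nonneg _

/-- A bound for the Gram matrix gives a bound for the bilinear clique form. -/
lemma neg_le_clique_form {c : Fin n → Fin n → ℝ} {V₁ V₂ V₃ V₄ : Finset (Fin n)} {B t : ℝ}
    (ht : 0 < t) (hBt : B ≤ t ^ 2)
    (hB : (B • 1 - ∑ l ∈ V₄, vertexGram c V₁ V₂ V₃ l).PosSemidef) (u w : Fin n → Fin n → ℝ) :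
    -(t / 2 * (∑ i ∈ V₁, ∑ j ∈ V₂, |c i j| * u i j ^ 2 + ∑ k ∈ V₃, ∑ l ∈ V₄, |c k l| * w k l ^ 2))
      ≤ ∑ i ∈ V₁, ∑ j ∈ V₂, ∑ k ∈ V₃, ∑ l ∈ V₄,
        c i j * c k l * (c i k * c i l * (c j k * c j l)) * (u i j * w k l) := by
  set b : Fin n → Fin n → ℝ := fun k l => ∑ i ∈ V₁, ∑ j ∈ V₂,
    c i j * u i j * (c i k * c j k * (c i l * c j l)) with hb
  -- Sign times square root of |c|: pairing with `pairVec` restores c itself, while a ⬝ᵥ a is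
  -- bounded by the |c|-weighted norm of `u`.
  set a : Fin n × Fin n → ℝ := fun x =>
    if x.1 ∈ V₁ ∧ x.2 ∈ V₂ then (SignType.sign (c x.1 x.2) : ℝ) * √|c x.1 x.2| * u x.1 x.2 else 0
    with ha
  have hab : ∀ k l, ∑ x, pairVec c V₁ V₂ k l x * a x = b k l := by
    intro k l
    simp only [hb]
    rw [← sum_ite_mem_prod V₁ V₂
      (fun x => c x.1 x.2 * u x.1 x.2 * (c x.1 k * c x.2 k * (c x.1 l * c x.2 l)))]
    refine Finset.sum_congr rfl fun x _ => ?_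
    simp only [pairVec, ha]
    split_ifs
    · have h1 := Real.mul_self_sqrt (abs_nonneg (c x.1 x.2))
      have h2 := sign_mul_abs (c x.1 x.2)
      set s : ℝ := √|c x.1 x.2|
      calc _ = (SignType.sign (c x.1 x.2) : ℝ) * (s * s) * u x.1 x.2
            * (c x.1 k * c x.2 k * (c x.1 l * c x.2 l)) := by ring
        _ = _ := by rw [h1, h2]
    · simp
  have hquad : ∑ k ∈ V₃, ∑ l ∈ V₄, |c k l| * b k l ^ 2 ≤ t ^ 2 * ∑ i ∈ V₁, ∑ j ∈ V₂,
      |c i j| * u i j ^ 2 := by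
    have h := (posSemidef_iff_dotProduct_mulVec.1 hB).2 a
    rw [star_trivial, sub_mulVec, dotProduct_sub, smul_mulVec, one_mulVec, dotProduct_smul,
      smul_eq_mul, sub_nonneg, sum_mulVec, dotProduct_sum] at h
    simp only [dotProduct_vertexGram, hab] at h
    rw [Finset.sum_comm]
    refine h.trans ?_
    have haa : a ⬝ᵥ a ≤ ∑ i ∈ V₁, ∑ j ∈ V₂, |c i j| * u i j ^ 2 := by
      rw [← sum_ite_mem_prod V₁ V₂ (fun x => |c x.1 x.2| * u x.1 x.2 ^ 2), dotProduct]
      refine Finset.sum_le_sum fun x _ => ?_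
      simp only [ha]
      split_ifs
      · have h1 := Real.mul_self_sqrt (abs_nonneg (c x.1 x.2))
        have h2 : (SignType.sign (c x.1 x.2) : ℝ) * (SignType.sign (c x.1 x.2) : ℝ) ≤ 1 := by
          rcases SignType.trichotomy (SignType.sign (c x.1 x.2)) with h | h | h <;> simp [h]
        set s : ℝ := √|c x.1 x.2|
        calc _ = ((SignType.sign (c x.1 x.2) : ℝ) * (SignType.sign (c x.1 x.2) : ℝ))
              * (s * s * u x.1 x.2 ^ 2) := by ring
          _ ≤ 1 * (s * s * u x.1 x.2 ^ 2) := by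
              refine mul_le_mul_of_nonneg_right h2 ?_
              rw [h1]; positivity
          _ = _ := by rw [h1, one_mul]
      · simp
    have : 0 ≤ a ⬝ᵥ a := Finset.sum_nonneg fun x _ => mul_self_nonneg _
    calc B * (a ⬝ᵥ a) ≤ t ^ 2 * (a ⬝ᵥ a) := by gcongr
      _ ≤ _ := by gcongr
  have hform : ∑ i ∈ V₁, ∑ j ∈ V₂, ∑ k ∈ V₃, ∑ l ∈ V₄,
        c i j * c k l * (c i k * c i l * (c j k * c j l)) * (u i j * w k l)
      = ∑ k ∈ V₃, ∑ l ∈ V₄, c k l * w k l * b k l := by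
    simp only [hb, Finset.mul_sum]
    calc _ = ∑ i ∈ V₁, ∑ k ∈ V₃, ∑ j ∈ V₂, ∑ l ∈ V₄,
            c i j * c k l * (c i k * c i l * (c j k * c j l)) * (u i j * w k l) :=
          Finset.sum_congr rfl fun i _ => Finset.sum_comm
      _ = ∑ k ∈ V₃, ∑ i ∈ V₁, ∑ l ∈ V₄, ∑ j ∈ V₂,
            c i j * c k l * (c i k * c i l * (c j k * c j l)) * (u i j * w k l) := by
          rw [Finset.sum_comm]
          exact Finset.sum_congr rfl fun k _ => Finset.sum_congr rfl fun i _ => Finset.sum_comm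
      _ = _ := by
          refine Finset.sum_congr rfl fun k _ => ?_
          rw [Finset.sum_comm]
          exact Finset.sum_congr rfl fun l _ => Finset.sum_congr rfl fun i _ =>
            Finset.sum_congr rfl fun j _ => by ring
  rw [hform]
  -- AM–GM weighted by t, which balances against the bound t² in `hquad`.
  have hpt : ∀ k l, -(t / 2 * (|c k l| * w k l ^ 2)) - 1 / (2 * t) * (|c k l| * b k l ^ 2)
      ≤ c k l * w k l * b k l := by
    intro k l
    have h1 : -(|c k l| * (|w k l| * |b k l|)) ≤ c k l * w k l * b k l := by
      have := neg_abs_le (c k l * w k l * b k l)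
      rw [abs_mul, abs_mul] at this
      linarith
    have h2 : |w k l| * |b k l| ≤ t / 2 * w k l ^ 2 + 1 / (2 * t) * b k l ^ 2 := by
      have h3 : 0 ≤ (t * |w k l| - |b k l|) ^ 2 / (2 * t) := by positivity
      have h4 : (t * |w k l| - |b k l|) ^ 2 / (2 * t)
          = t / 2 * |w k l| ^ 2 + 1 / (2 * t) * |b k l| ^ 2 - |w k l| * |b k l| := by
        field_simp
        ring
      rw [h4, sq_abs, sq_abs] at h3
      linarith
    have h5 := mul_le_mul_of_nonneg_left h2 (abs_nonneg (c k l))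
    linarith
  have hsum : ∑ k ∈ V₃, ∑ l ∈ V₄,
      (-(t / 2 * (|c k l| * w k l ^ 2)) - 1 / (2 * t) * (|c k l| * b k l ^ 2))
      ≤ ∑ k ∈ V₃, ∑ l ∈ V₄, c k l * w k l * b k l :=
    Finset.sum_le_sum fun k _ => Finset.sum_le_sum fun l _ => hpt k l
  refine le_trans ?_ hsum
  simp only [Finset.sum_sub_distrib, Finset.sum_neg_distrib, ← Finset.mul_sum]
  have : 1 / (2 * t) * ∑ k ∈ V₃, ∑ l ∈ V₄, |c k l| * b k l ^ 2
      ≤ 1 / (2 * t) * (t ^ 2 * ∑ i ∈ V₁, ∑ j ∈ V₂, |c i j| * u i j ^ 2) := by gcongr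
  have h6 : 1 / (2 * t) * (t ^ 2 * ∑ i ∈ V₁, ∑ j ∈ V₂, |c i j| * u i j ^ 2)
      = t / 2 * ∑ i ∈ V₁, ∑ j ∈ V₂, |c i j| * u i j ^ 2 := by
    field_simp
  linarith

end CliqueMatrixBound

/-! ### Typical graphs and their probability. -/

section Typical

variable {n : ℕ}

/-- Indicator of the edge `{i, j}`. -/
noncomputable def edgeInd (ω : Finset (Sym2 (Fin n))) (i j : Fin n) : ℝ :=
  if s(i, j) ∈ ω then 1 else 0

lemma edgeInd_nonneg (ω : Finset (Sym2 (Fin n))) (i j : Fin n) : 0 ≤ edgeInd ω i j := by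
  unfold edgeInd; split_ifs <;> norm_num

lemma edgeInd_le_one (ω : Finset (Sym2 (Fin n))) (i j : Fin n) : edgeInd ω i j ≤ 1 := by
  unfold edgeInd; split_ifs <;> norm_num

lemma edgeInd_comm (ω : Finset (Sym2 (Fin n))) (i j : Fin n) :
    edgeInd ω i j = edgeInd ω j i := by
  rw [edgeInd, edgeInd, Sym2.eq_swap]

lemma edgeInd_mul_self (ω : Finset (Sym2 (Fin n))) (i j : Fin n) :
    edgeInd ω i j * edgeInd ω i j = edgeInd ω i j := by
  unfold edgeInd; split_ifs <;> norm_num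

lemma edgeInd_self {ω : Finset (Sym2 (Fin n))} (hω : ω ⊆ allEdges n) (i : Fin n) :
    edgeInd ω i i = 0 := by
  rw [edgeInd, if_neg]
  exact fun h => mem_allEdges.1 (hω h) rfl

/-- Edge counts and common neighbourhoods are not much larger than expected. -/
structure Typical (ω : Finset (Sym2 (Fin n))) (p ℓ : ℝ) : Prop where
  nbr : ∀ i j l, ∑ k, edgeInd ω i k * edgeInd ω j k * edgeInd ω l k
    ≤ 2 * (n * p ^ ({i, j, l} : Finset (Fin n)).card) + 10 * ℓ
  edges : ∀ S T : Finset (Fin n), ∑ i ∈ S, ∑ j ∈ T, edgeInd ω i j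
    ≤ 2 * (2 * (S.card * T.card * p) + 10 * (ℓ * (S.card + T.card + 1)))

/-- For k outside {i, j, l} the stars from k to this set are disjoint edge sets, so `bprob_card_lt`
applies; k inside contributes nothing as there are no loops. Coinciding indices are allowed, so
degrees and codegrees are covered too. -/
lemma bprob_nbr_le {p : ℝ} (hp0 : 0 ≤ p) (hp1 : p ≤ 1) {ℓ : ℝ} (hℓ : 0 ≤ ℓ) (i j l : Fin n) :
    bprob (allEdges n) p (fun ω => 2 * (n * p ^ ({i, j, l} : Finset (Fin n)).card) + 10 * ℓ
      < ∑ k, edgeInd ω i k * edgeInd ω j k * edgeInd ω l k) ≤ Real.exp (-(6 * ℓ)) := by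
  classical
  set T : Finset (Fin n) := {i, j, l} with hT
  have h := bprob_card_lt (E := allEdges n) hp0 hp1 Tᶜ (fun k => T.image fun a => s(a, k)) T.card
    (by
      intro k hk e he
      obtain ⟨a, ha, rfl⟩ := Finset.mem_image.1 he
      exact mem_allEdges.2 (ne_of_mem_of_not_mem ha (Finset.mem_compl.1 hk)))
    (by
      intro k _
      exact Finset.card_image_of_injective _ fun a b hab => Sym2.congr_left.1 hab)
    (by
      intro k hk k' hk' hkk
      rw [Function.onFun, Finset.disjoint_left]
      intro e he he'
      obtain ⟨a, ha, rfl⟩ := Finset.mem_image.1 he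
      obtain ⟨b, hb, hab⟩ := Finset.mem_image.1 he'
      rw [Sym2.eq_iff] at hab
      rcases hab with ⟨_, h⟩ | ⟨h, _⟩
      · exact hkk h.symm
      · have hk : k ∉ T := by simpa using hk
        exact hk (h ▸ hb)) hℓ
  refine le_trans (bprob_mono hp0 hp1 fun ω hω hlt => ?_) h
  have hcard : ((Tᶜ.card : ℕ) : ℝ) ≤ n := by
    exact_mod_cast (Finset.card_le_univ _).trans_eq (Fintype.card_fin n)
  have h1 : 2 * (Tᶜ.card * p ^ T.card) + 10 * ℓ ≤ 2 * (n * p ^ T.card) + 10 * ℓ := by gcongr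
  refine h1.trans_lt (hlt.trans_le ?_)
  rw [← Finset.sum_boole]
  have hzero : ∀ k, k ∉ Tᶜ → edgeInd ω i k * edgeInd ω j k * edgeInd ω l k = 0 := by
    intro k hk
    have hk : k = i ∨ k = j ∨ k = l := by
      simpa [hT] using Finset.notMem_compl.1 hk
    rcases hk with rfl | rfl | rfl <;> simp [edgeInd_self hω]
  rw [← Finset.sum_subset (Finset.subset_univ Tᶜ) fun k _ hk => hzero k hk]
  refine Finset.sum_le_sum fun k _ => ?_
  simp only [hT, edgeInd, Finset.image_insert, Finset.image_singleton, Finset.insert_subset_iff,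
    Finset.singleton_subset_iff]
  by_cases h1 : s(i, k) ∈ ω <;> by_cases h2 : s(j, k) ∈ ω <;> by_cases h3 : s(l, k) ∈ ω <;>
    simp [h1, h2, h3]

/-- The deviation grows with |S| + |T| so that a union bound over all pairs of sets converges. The
outer factor 2 is there because `S` and `T` may overlap and an edge may be counted in both
orientations. -/
lemma bprob_edges_le {p : ℝ} (hp0 : 0 ≤ p) (hp1 : p ≤ 1) {ℓ : ℝ} (hℓ : 0 ≤ ℓ)
    (S T : Finset (Fin n)) :
    bprob (allEdges n) p (fun ω =>
      2 * (2 * (S.card * T.card * p) + 10 * (ℓ * (S.card + T.card + 1)))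
        < ∑ i ∈ S, ∑ j ∈ T, edgeInd ω i j)
      ≤ Real.exp (-(6 * (ℓ * (S.card + T.card + 1)))) := by
  classical
  set K : Finset (Sym2 (Fin n)) := ((S ×ˢ T).image fun x => s(x.1, x.2)) ∩ allEdges n with hK
  have h := bprob_card_lt (E := allEdges n) hp0 hp1 K (fun e => {e}) 1
    (fun e he => Finset.singleton_subset_iff.2 (Finset.mem_inter.1 he).2)
    (fun e _ => Finset.card_singleton e)
    (fun e _ e' _ hne => by simpa [Function.onFun] using hne)
    (t := ℓ * (S.card + T.card + 1)) (by positivity)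
  refine le_trans (bprob_mono hp0 hp1 fun ω hω hlt => ?_) h
  have hcard : (K.card : ℝ) ≤ S.card * T.card := by
    have : K.card ≤ S.card * T.card := by
      rw [← Finset.card_product]
      exact (Finset.card_le_card Finset.inter_subset_left).trans Finset.card_image_le
    exact_mod_cast this
  have h1 : 2 * (K.card * p ^ 1) + 10 * (ℓ * (S.card + T.card + 1))
      ≤ 2 * (S.card * T.card * p) + 10 * (ℓ * (S.card + T.card + 1)) := by
    rw [pow_one]
    gcongr
  have h2 : ∑ i ∈ S, ∑ j ∈ T, edgeInd ω i j
      ≤ 2 * ((K.filter fun e => {e} ⊆ ω).card : ℝ) := by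
    rw [← Finset.sum_product']
    simp only [edgeInd]
    rw [Finset.sum_boole]
    have h3 := Finset.card_le_mul_card_image (f := fun x : Fin n × Fin n => s(x.1, x.2))
      ((S ×ˢ T).filter fun x => s(x.1, x.2) ∈ ω) 2 (by
        intro e _
        induction e with
        | _ a b =>
          refine (Finset.card_le_card (t := {(a, b), (b, a)}) ?_).trans Finset.card_le_two
          intro x hx
          have := (Finset.mem_filter.1 hx).2
          rw [Sym2.eq_iff] at this
          simp only [Finset.mem_insert, Finset.mem_singleton, Prod.ext_iff]
          exact this)
    have h4 : ((S ×ˢ T).filter fun x => s(x.1, x.2) ∈ ω).image (fun x => s(x.1, x.2))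
        ⊆ K.filter fun e => {e} ⊆ ω := by
      intro e he
      obtain ⟨x, hx, rfl⟩ := Finset.mem_image.1 he
      have hx := Finset.mem_filter.1 hx
      simp only [hK, Finset.mem_filter, Finset.mem_inter, Finset.singleton_subset_iff]
      exact ⟨⟨Finset.mem_image_of_mem _ hx.1, hω hx.2⟩, hx.2⟩
    exact_mod_cast h3.trans (Nat.mul_le_mul_left 2 (Finset.card_le_card h4))
  linarith

lemma bprob_not_typical_le {p : ℝ} (hp0 : 0 ≤ p) (hp1 : p ≤ 1) (hn : 2 ≤ n) :
    bprob (allEdges n) p (fun ω => ¬ Typical ω p (Real.log n)) ≤ 10 / (n : ℝ) ^ 3 := by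
  have hn0 : (0 : ℝ) < n := by positivity
  have hn2 : (2 : ℝ) ≤ n := by exact_mod_cast hn
  set ℓ := Real.log n with hℓd
  have hℓ : 0 ≤ ℓ := Real.log_natCast_nonneg n
  have hexp : Real.exp (-(6 * ℓ)) = ((n : ℝ) ^ 6)⁻¹ := by
    rw [Real.exp_neg, show (6 : ℝ) * ℓ = (6 : ℕ) * ℓ by norm_num, Real.exp_nat_mul,
      Real.exp_log hn0]
  have hA : bprob (allEdges n) p (fun ω => ∃ x ∈ (Finset.univ : Finset (Fin n × Fin n × Fin n)),
      2 * (n * p ^ ({x.1, x.2.1, x.2.2} : Finset (Fin n)).card) + 10 * ℓ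
      < ∑ k, edgeInd ω x.1 k * edgeInd ω x.2.1 k * edgeInd ω x.2.2 k) ≤ 1 / (n : ℝ) ^ 3 := by
    refine (bprob_exists_le hp0 hp1 _ _).trans ?_
    refine (Finset.sum_le_sum fun x _ => bprob_nbr_le hp0 hp1 hℓ x.1 x.2.1 x.2.2).trans ?_
    rw [Finset.sum_const, hexp]
    simp only [Finset.card_univ, Fintype.card_prod, Fintype.card_fin, nsmul_eq_mul, Nat.cast_mul]
    apply le_of_eq
    field_simp
  have hB : bprob (allEdges n) p (fun ω =>
      ∃ x ∈ (Finset.univ : Finset (Finset (Fin n) × Finset (Fin n))),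
      2 * (2 * (x.1.card * x.2.card * p) + 10 * (ℓ * (x.1.card + x.2.card + 1)))
        < ∑ i ∈ x.1, ∑ j ∈ x.2, edgeInd ω i j) ≤ 9 / (n : ℝ) ^ 3 := by
    refine (bprob_exists_le hp0 hp1 _ _).trans ?_
    refine (Finset.sum_le_sum fun x _ => bprob_edges_le hp0 hp1 hℓ x.1 x.2).trans ?_
    set y := Real.exp (-(6 * ℓ)) with hy
    have e1 : ∀ x : Finset (Fin n) × Finset (Fin n),
        Real.exp (-(6 * (ℓ * (x.1.card + x.2.card + 1)))) = y * (y ^ x.1.card * y ^ x.2.card) := by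
      intro x
      rw [hy, ← Real.exp_nat_mul, ← Real.exp_nat_mul, ← Real.exp_add, ← Real.exp_add]
      congr 1
      ring
    -- The sum is (1 + y)^n with y = n^{-6}, so the union over all pairs of sets costs only a factor
    -- 9.
    have e2 : ∑ S : Finset (Fin n), y ^ S.card ≤ 3 := by
      have := Finset.sum_pow_mul_eq_add_pow y 1 (Finset.univ : Finset (Fin n))
      simp only [one_pow, mul_one, Finset.card_univ, Fintype.card_fin, Finset.powerset_univ] at this
      rw [this]
      calc (y + 1) ^ n ≤ Real.exp y ^ n := pow_le_pow_left₀ (by positivity) (Real.add_one_le_exp y) n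
        _ = Real.exp (n * y) := by rw [← Real.exp_nat_mul]
        _ ≤ Real.exp 1 := by
            apply Real.exp_le_exp.2
            rw [hexp, ← div_eq_mul_inv, div_le_one (by positivity)]
            exact le_self_pow₀ (by linarith) (by norm_num)
        _ ≤ 3 := by linarith [Real.exp_one_lt_d9]
    have e3 : 0 ≤ ∑ S : Finset (Fin n), y ^ S.card := Finset.sum_nonneg fun S _ => by positivity
    rw [Finset.sum_congr rfl fun x _ => e1 x, ← Finset.mul_sum, ← Finset.univ_product_univ,
      Finset.sum_product]
    simp only [← Finset.mul_sum, ← Finset.sum_mul]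
    calc y * ((∑ S : Finset (Fin n), y ^ S.card) * ∑ S : Finset (Fin n), y ^ S.card)
        ≤ y * (3 * 3) := by gcongr
      _ = 9 / (n : ℝ) ^ 6 := by rw [hexp]; ring
      _ ≤ 9 / (n : ℝ) ^ 3 := by
          gcongr
          · linarith
          · norm_num
  refine (bprob_mono hp0 hp1 fun ω _ h => ?_).trans
    ((bprob_or_le hp0 hp1 _ _).trans ((add_le_add hA hB).trans_eq (by ring)))
  by_contra hcon
  push Not at hcon
  refine h ⟨fun i j l => ?_, fun S T => ?_⟩
  · exact hcon.1 (i, j, l) (Finset.mem_univ _)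
  · exact hcon.2 (S, T) (Finset.mem_univ _)

end Typical

/-! ### What typicality gives at p = n^{-1/3}. -/

section TypicalConsequences

variable {n : ℕ} {ω : Finset (Sym2 (Fin n))} {p a ℓ : ℝ}

/-- The degenerate triple (i, i, i), with np = a²; the next two lemmas use np² = a and np³ = 1. -/
lemma Typical.deg_le (h : Typical ω p ℓ) (hn : (n : ℝ) = a ^ 3) (hp : p * a = 1) (ha : 1 ≤ a)
    (hℓ : 1 ≤ ℓ) (i : Fin n) : ∑ k, edgeInd ω i k ≤ 12 * ℓ * a ^ 2 := by
  have h1 := h.nbr i i i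
  simp only [edgeInd_mul_self, Finset.pair_eq_singleton, Finset.card_singleton, pow_one] at h1
  have h2 : (n : ℝ) * p = a ^ 2 := by rw [hn]; linear_combination a ^ 2 * hp
  rw [h2] at h1
  nlinarith [one_le_pow₀ ha (n := 2)]

lemma Typical.codeg_le (h : Typical ω p ℓ) (hn : (n : ℝ) = a ^ 3) (hp : p * a = 1) (ha : 1 ≤ a)
    (hℓ : 1 ≤ ℓ) {i j : Fin n} (hij : i ≠ j) :
    ∑ k, edgeInd ω i k * edgeInd ω j k ≤ 12 * ℓ * a := by
  have h1 := h.nbr i j j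
  simp only [mul_assoc, edgeInd_mul_self, Finset.pair_eq_singleton, Finset.card_pair hij] at h1
  have h2 : (n : ℝ) * p ^ 2 = a := by rw [hn]; linear_combination a * (p * a + 1) * hp
  rw [h2] at h1
  nlinarith

lemma Typical.codeg_three_le (h : Typical ω p ℓ) (hn : (n : ℝ) = a ^ 3) (hp : p * a = 1)
    (hℓ : 1 ≤ ℓ) {i j l : Fin n} (hij : i ≠ j) (hil : i ≠ l) (hjl : j ≠ l) :
    ∑ k, edgeInd ω i k * edgeInd ω j k * edgeInd ω l k ≤ 12 * ℓ := by
  have h1 := h.nbr i j l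
  rw [Finset.card_eq_three.2 ⟨i, j, l, hij, hil, hjl, rfl⟩] at h1
  have h2 : (n : ℝ) * p ^ 3 = 1 := by
    rw [hn]; linear_combination ((p * a) ^ 2 + p * a + 1) * hp
  rw [h2] at h1
  linarith

lemma abs_edgeDev_le (hp : 0 ≤ p) (i j : Fin n) : |edgeDev p ω i j| ≤ edgeInd ω i j + p := by
  unfold edgeDev edgeInd
  rw [abs_le]
  split_ifs <;> constructor <;> linarith

lemma abs_edgeDev_le_one (hp : 0 ≤ p) (hp1 : p ≤ 1) (i j : Fin n) : |edgeDev p ω i j| ≤ 1 := by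
  unfold edgeDev
  rw [abs_le]
  split_ifs <;> constructor <;> linarith

/-- Expand with |c| ≤ edge + p: one codegree and two degree terms of 12ℓa each, plus np² = a, make
37ℓa. -/
lemma Typical.sum_abs_mul_abs_le (h : Typical ω p ℓ) (hn : (n : ℝ) = a ^ 3) (hp : p * a = 1)
    (hp0 : 0 ≤ p) (ha : 1 ≤ a) (hℓ : 1 ≤ ℓ) {i j : Fin n} (hij : i ≠ j) (V : Finset (Fin n)) :
    ∑ k ∈ V, |edgeDev p ω i k| * |edgeDev p ω j k| ≤ 37 * ℓ * a := by
  have h1 : ∑ k ∈ V, |edgeDev p ω i k| * |edgeDev p ω j k|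
      ≤ ∑ k, (edgeInd ω i k + p) * (edgeInd ω j k + p) := by
    refine (Finset.sum_le_univ_sum_of_nonneg fun k => by positivity).trans
      (Finset.sum_le_sum fun k _ => ?_)
    exact mul_le_mul (abs_edgeDev_le hp0 i k) (abs_edgeDev_le hp0 j k) (abs_nonneg _)
      (add_nonneg (edgeInd_nonneg ω i k) hp0)
  have h2 : ∑ k, (edgeInd ω i k + p) * (edgeInd ω j k + p)
      = ∑ k, edgeInd ω i k * edgeInd ω j k + p * ∑ k, edgeInd ω i k + p * ∑ k, edgeInd ω j k
        + n * p ^ 2 := by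
    have : ∀ k, (edgeInd ω i k + p) * (edgeInd ω j k + p) = edgeInd ω i k * edgeInd ω j k
        + p * edgeInd ω i k + p * edgeInd ω j k + p ^ 2 := fun k => by ring
    simp only [this, Finset.sum_add_distrib, ← Finset.mul_sum, Finset.sum_const, Finset.card_univ,
      Fintype.card_fin, nsmul_eq_mul]
  have h3 : (n : ℝ) * p ^ 2 = a := by rw [hn]; linear_combination a * (p * a + 1) * hp
  have h4 := h.codeg_le hn hp ha hℓ hij
  have h5 := mul_le_mul_of_nonneg_left (h.deg_le hn hp ha hℓ i) hp0
  have h6 := mul_le_mul_of_nonneg_left (h.deg_le hn hp ha hℓ j) hp0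
  have h7 : p * (12 * ℓ * a ^ 2) = 12 * ℓ * a := by linear_combination 12 * ℓ * a * hp
  nlinarith

/-- The same expansion: seven terms of size 12ℓ and np³ = 1 make 85ℓ. -/
lemma Typical.sum_abs_mul_abs_mul_abs_le (h : Typical ω p ℓ) (hn : (n : ℝ) = a ^ 3)
    (hp : p * a = 1) (hp0 : 0 ≤ p) (ha : 1 ≤ a) (hℓ : 1 ≤ ℓ) {i j l : Fin n} (hij : i ≠ j)
    (hil : i ≠ l) (hjl : j ≠ l) (V : Finset (Fin n)) :
    ∑ k ∈ V, |edgeDev p ω i k| * |edgeDev p ω j k| * |edgeDev p ω l k| ≤ 85 * ℓ := by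
  have h1 : ∑ k ∈ V, |edgeDev p ω i k| * |edgeDev p ω j k| * |edgeDev p ω l k|
      ≤ ∑ k, (edgeInd ω i k + p) * (edgeInd ω j k + p) * (edgeInd ω l k + p) := by
    refine (Finset.sum_le_univ_sum_of_nonneg fun k => by positivity).trans
      (Finset.sum_le_sum fun k _ => ?_)
    have hi := add_nonneg (edgeInd_nonneg ω i k) hp0
    have hj := add_nonneg (edgeInd_nonneg ω j k) hp0
    exact mul_le_mul (mul_le_mul (abs_edgeDev_le hp0 i k) (abs_edgeDev_le hp0 j k) (abs_nonneg _)
      hi) (abs_edgeDev_le hp0 l k) (abs_nonneg _) (mul_nonneg hi hj)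
  have h2 : ∑ k, (edgeInd ω i k + p) * (edgeInd ω j k + p) * (edgeInd ω l k + p)
      = ∑ k, edgeInd ω i k * edgeInd ω j k * edgeInd ω l k
        + p * ∑ k, edgeInd ω i k * edgeInd ω j k + p * ∑ k, edgeInd ω i k * edgeInd ω l k
        + p * ∑ k, edgeInd ω j k * edgeInd ω l k
        + p ^ 2 * ∑ k, edgeInd ω i k + p ^ 2 * ∑ k, edgeInd ω j k + p ^ 2 * ∑ k, edgeInd ω l k
        + n * p ^ 3 := by
    have : ∀ k, (edgeInd ω i k + p) * (edgeInd ω j k + p) * (edgeInd ω l k + p)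
        = edgeInd ω i k * edgeInd ω j k * edgeInd ω l k
        + p * (edgeInd ω i k * edgeInd ω j k) + p * (edgeInd ω i k * edgeInd ω l k)
        + p * (edgeInd ω j k * edgeInd ω l k)
        + p ^ 2 * edgeInd ω i k + p ^ 2 * edgeInd ω j k + p ^ 2 * edgeInd ω l k + p ^ 3 :=
      fun k => by ring
    simp only [this, Finset.sum_add_distrib, ← Finset.mul_sum, Finset.sum_const, Finset.card_univ,
      Fintype.card_fin, nsmul_eq_mul]
  have h3 : (n : ℝ) * p ^ 3 = 1 := by
    rw [hn]; linear_combination ((p * a) ^ 2 + p * a + 1) * hp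
  have h4 := h.codeg_three_le hn hp hℓ hij hil hjl
  have c1 := mul_le_mul_of_nonneg_left (h.codeg_le hn hp ha hℓ hij) hp0
  have c2 := mul_le_mul_of_nonneg_left (h.codeg_le hn hp ha hℓ hil) hp0
  have c3 := mul_le_mul_of_nonneg_left (h.codeg_le hn hp ha hℓ hjl) hp0
  have hp2 : 0 ≤ p ^ 2 := by positivity
  have d1 := mul_le_mul_of_nonneg_left (h.deg_le hn hp ha hℓ i) hp2
  have d2 := mul_le_mul_of_nonneg_left (h.deg_le hn hp ha hℓ j) hp2
  have d3 := mul_le_mul_of_nonneg_left (h.deg_le hn hp ha hℓ l) hp2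
  have e1 : p * (12 * ℓ * a) = 12 * ℓ := by linear_combination 12 * ℓ * hp
  have e2 : p ^ 2 * (12 * ℓ * a ^ 2) = 12 * ℓ := by
    linear_combination 12 * ℓ * (p * a + 1) * hp
  linarith

/-- The signed clique form on `V₁ × V₂ × V₃ × V₄` is bounded below with constant `t`. -/
def CliqueFormBounded (p : ℝ) (ω : Finset (Sym2 (Fin n))) (V₁ V₂ V₃ V₄ : Finset (Fin n)) (t : ℝ) :
    Prop :=
  ∀ u w : Fin n → Fin n → ℝ,
    -(t / 2 * (∑ i ∈ V₁, ∑ j ∈ V₂, |edgeDev p ω i j| * u i j ^ 2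
      + ∑ k ∈ V₃, ∑ l ∈ V₄, |edgeDev p ω k l| * w k l ^ 2))
    ≤ ∑ i ∈ V₁, ∑ j ∈ V₂, ∑ k ∈ V₃, ∑ l ∈ V₄,
      edgeDev p ω i j * edgeDev p ω k l * (edgeDev p ω i k * edgeDev p ω i l *
        (edgeDev p ω j k * edgeDev p ω j l)) * (u i j * w k l)

open scoped Classical in
/-- On a typical graph nothing is truncated. -/
lemma Typical.truncGram_eq (h : Typical ω p ℓ) (hn : (n : ℝ) = a ^ 3) (hp : p * a = 1)
    (hp0 : 0 ≤ p) (hp1 : p ≤ 1) (ha : 1 ≤ a) (hℓ : 1 ≤ ℓ) {V₁ V₂ V₃ : Finset (Fin n)}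
    (h12 : Disjoint V₁ V₂) (h13 : Disjoint V₁ V₃) {l : Fin n}
    (h₁ : l ∉ V₁) (h₂ : l ∉ V₂) (h₃ : l ∉ V₃) :
    truncGram (edgeDev p ω) V₁ V₂ V₃ (37 * ℓ * a) (37 * ℓ * a * (85 * ℓ) * (85 * ℓ)) l
      = vertexGram (edgeDev p ω) V₁ V₂ V₃ l := by
  rw [truncGram, if_pos]
  refine ⟨fun i hi j hj => ?_, ?_⟩
  · have hij : i ≠ j := fun e => Finset.disjoint_left.1 h12 hi (e ▸ hj)
    refine le_trans (Finset.sum_le_sum fun k _ => ?_)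
      (h.sum_abs_mul_abs_le hn hp hp0 ha hℓ hij V₃)
    have e : ∀ x y : Fin n, edgeDev p ω x y ^ 2 ≤ |edgeDev p ω x y| := fun x y => by
      rw [← sq_abs]
      exact pow_le_of_le_one (abs_nonneg _) (abs_edgeDev_le_one hp0 hp1 x y) two_ne_zero
    exact mul_le_mul (e i k) (e j k) (sq_nonneg _) (abs_nonneg _)
  -- Row sums: at most 85ℓ over j, given i, k, l, then 37ℓa over i, given k, l. Column sums: 85ℓ.
  · refine sub_vertexGram_posSemidef (fun i => abs_edgeDev_le_one hp0 hp1 i l) (by positivity)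
      (by positivity) (fun k hk => ?_) fun i hi j hj => ?_
    · have hkl : k ≠ l := ne_of_mem_of_not_mem hk h₃
      calc _ = ∑ i ∈ V₁, |edgeDev p ω k i| * |edgeDev p ω l i| * ∑ j ∈ V₂,
            |edgeDev p ω i j| * |edgeDev p ω k j| * |edgeDev p ω l j| := by
            refine Finset.sum_congr rfl fun i _ => ?_
            rw [Finset.mul_sum]
            refine Finset.sum_congr rfl fun j _ => ?_
            rw [edgeDev_comm p ω k i, edgeDev_comm p ω l i, edgeDev_comm p ω k j,
              edgeDev_comm p ω l j]
            ring
        _ ≤ ∑ i ∈ V₁, |edgeDev p ω k i| * |edgeDev p ω l i| * (85 * ℓ) := by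
            refine Finset.sum_le_sum fun i hi => mul_le_mul_of_nonneg_left ?_ (by positivity)
            exact h.sum_abs_mul_abs_mul_abs_le hn hp hp0 ha hℓ
              (fun e : i = k => Finset.disjoint_left.1 h13 hi (e ▸ hk))
              (ne_of_mem_of_not_mem hi h₁) hkl V₂
        _ ≤ _ := by
            rw [← Finset.sum_mul]
            exact mul_le_mul_of_nonneg_right (h.sum_abs_mul_abs_le hn hp hp0 ha hℓ hkl V₁)
              (by positivity)
    · have hij : i ≠ j := fun e => Finset.disjoint_left.1 h12 hi (e ▸ hj)
      refine le_trans (le_of_eq (Finset.sum_congr rfl fun k _ => ?_))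
        (h.sum_abs_mul_abs_mul_abs_le hn hp hp0 ha hℓ hij (ne_of_mem_of_not_mem hi h₁)
          (ne_of_mem_of_not_mem hj h₂) V₃)
      rw [edgeDev_comm p ω l k]
      ring

/-- Taking q ≈ 10 log n makes the tail e³n²e^{-q} at most 27/n⁸. The matrix bound 3qR is then of
order ℓ⁴a, and its square root is the constant of the form. -/
lemma bprob_cliqueForm_le (hn : (n : ℝ) = a ^ 3) (hp : p * a = 1) (hp0 : 0 ≤ p) (hp1 : p ≤ 1)
    (ha : 1 ≤ a) (hℓ : 1 ≤ Real.log n) {V₁ V₂ V₃ V₄ : Finset (Fin n)}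
    (h12 : Disjoint V₁ V₂) (h13 : Disjoint V₁ V₃) (h23 : Disjoint V₂ V₃) (h14 : Disjoint V₁ V₄)
    (h24 : Disjoint V₂ V₄) (h34 : Disjoint V₃ V₄) :
    bprob (allEdges n) p (fun ω => Typical ω p (Real.log n) ∧
      ¬ CliqueFormBounded p ω V₁ V₂ V₃ V₄ (3000 * Real.log n ^ 2 * √a)) ≤ 27 / (n : ℝ) ^ 8 := by
  set ℓ := Real.log n with hℓd
  set q : ℕ := ⌈10 * ℓ⌉₊ with hq
  have hq1 : 10 * ℓ ≤ q := Nat.le_ceil _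
  have hq2 : (q : ℝ) ≤ 11 * ℓ := by
    have := Nat.ceil_lt_add_one (by positivity : 0 ≤ 10 * ℓ)
    linarith
  have hq0 : q ≠ 0 := by
    intro h
    rw [h] at hq1
    norm_num at hq1
    linarith
  set R : ℝ := 37 * ℓ * a * (85 * ℓ) * (85 * ℓ) with hR
  have hR0 : 0 < R := by positivity
  have hnp3 : (n : ℝ) * p ^ 3 = 1 := by
    rw [hn]; linear_combination ((p * a) ^ 2 + p * a + 1) * hp
  have htail := bprob_sum_truncGram_le hp0 hp1 h12 h13 h23 h14 h24 h34
    (D := 37 * ℓ * a) (R := R) (by positivity) hR0 (by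
      calc (n : ℝ) * (2 * p ^ 3 * (37 * ℓ * a)) = 37 * ℓ * a * (2 * (n * p ^ 3)) := by ring
        _ = 37 * ℓ * a * 2 := by rw [hnp3]; ring
        _ ≤ 37 * ℓ * a * (85 * ℓ * (85 * ℓ)) := by gcongr; nlinarith
        _ = R := by rw [hR]; ring) hq0
  refine le_trans (bprob_mono hp0 hp1 fun ω _ hω => ?_) (htail.trans ?_)
  · intro hpsd
    apply hω.2
    have heq : ∑ l ∈ V₄, truncGram (edgeDev p ω) V₁ V₂ V₃ (37 * ℓ * a) R l
        = ∑ l ∈ V₄, vertexGram (edgeDev p ω) V₁ V₂ V₃ l :=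
      Finset.sum_congr rfl fun l hl => hω.1.truncGram_eq hn hp hp0 hp1 ha hℓ h12 h13
        (fun h => Finset.disjoint_left.1 h14 h hl) (fun h => Finset.disjoint_left.1 h24 h hl)
        (fun h => Finset.disjoint_left.1 h34 h hl)
    rw [heq] at hpsd
    intro u w
    refine neg_le_clique_form (by positivity) ?_ hpsd u w
    calc 3 * (q * R) ≤ 3 * (11 * ℓ * R) := by gcongr
      _ = 8821725 * ℓ ^ 4 * a := by rw [hR]; ring
      _ ≤ 9000000 * ℓ ^ 4 * a := by gcongr; norm_num
      _ = (3000 * ℓ ^ 2 * √a) ^ 2 := by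
          rw [mul_pow, Real.sq_sqrt (by linarith)]; ring
  · have hn0 : (0 : ℝ) < n := by rw [hn]; positivity
    have h1 : Real.exp (-(q : ℝ)) ≤ ((n : ℝ) ^ 10)⁻¹ := by
      calc Real.exp (-(q : ℝ)) ≤ Real.exp (-(10 * ℓ)) := Real.exp_le_exp.2 (by linarith)
        _ = ((n : ℝ) ^ 10)⁻¹ := by
          rw [Real.exp_neg, show (10 : ℝ) * ℓ = (10 : ℕ) * ℓ by norm_num, Real.exp_nat_mul,
            Real.exp_log hn0]
    have h2 : Real.exp 3 ≤ 27 := by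
      rw [show (3 : ℝ) = (3 : ℕ) * 1 by norm_num, Real.exp_nat_mul]
      calc Real.exp 1 ^ 3 ≤ 3 ^ 3 :=
            pow_le_pow_left₀ (Real.exp_pos 1).le (by linarith [Real.exp_one_lt_d9]) 3
        _ = 27 := by norm_num
    calc Real.exp 3 * n ^ 2 * Real.exp (-(q : ℝ)) ≤ 27 * n ^ 2 * ((n : ℝ) ^ 10)⁻¹ := by gcongr
      _ = 27 / (n : ℝ) ^ 8 := by field_simp

end TypicalConsequences

/-! ### The dual functional. -/

section PseudoExpectation

variable {n : ℕ}

/-- The constant term of a fourth derivative. -/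
noncomputable def polar (i j k l : Fin n) : MvPolynomial (Fin n) ℝ →ₗ[ℝ] ℝ where
  toFun f := constantCoeff (pderiv i (pderiv j (pderiv k (pderiv l f))))
  map_add' f g := by simp
  map_smul' c f := by simp

/-- The constant term of a second derivative. -/
noncomputable def hess (q : MvPolynomial (Fin n) ℝ) (i j : Fin n) : ℝ :=
  constantCoeff (pderiv i (pderiv j q))

lemma MvPolynomial.IsHomogeneous.constantCoeff_eq_zero {q : MvPolynomial (Fin n) ℝ} {d : ℕ}
    (hq : q.IsHomogeneous d) (hd : d ≠ 0) : constantCoeff q = 0 := by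
  rw [constantCoeff_eq]
  exact hq.coeff_eq_zero (by simpa using hd.symm)

/-- In the Leibniz expansion only terms with two derivatives on each factor have a constant term;
each of the three pairings occurs twice. -/
lemma polar_mul_self {q : MvPolynomial (Fin n) ℝ} (hq : q.IsHomogeneous 2) (i j k l : Fin n) :
    polar i j k l (q * q)
      = 2 * (hess q i j * hess q k l + hess q i k * hess q j l + hess q i l * hess q j k) := by
  have h0 : constantCoeff q = 0 := hq.constantCoeff_eq_zero two_ne_zero
  have h1 : ∀ i, constantCoeff (pderiv i q) = 0 := fun i =>
    hq.pderiv.constantCoeff_eq_zero one_ne_zero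
  simp only [polar, LinearMap.coe_mk, AddHom.coe_mk, hess, pderiv_mul, map_add, map_mul, h0, h1]
  ring

/-- The weighted square functional for a pair. -/
noncomputable def pairPolar (i j : Fin n) : MvPolynomial (Fin n) ℝ →ₗ[ℝ] ℝ :=
  polar i i j j + (1 / 6 : ℝ) • (polar i i i i + polar j j j j)

/-- The weight 1/6 completes the square: ∂_i⁴(q²) is 6 times the squared diagonal Hessian entry. -/
lemma pairPolar_mul_self {q : MvPolynomial (Fin n) ℝ} (hq : q.IsHomogeneous 2) (i j : Fin n) :
    pairPolar i j (q * q) = (hess q i i + hess q j j) ^ 2 + 4 * hess q i j ^ 2 := by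
  simp only [pairPolar, LinearMap.add_apply, LinearMap.smul_apply, polar_mul_self hq, smul_eq_mul]
  ring

/-- The product of the six values of `c` on the pairs of `{i, j, k, l}`. -/
def sixProd (c : Fin n → Fin n → ℝ) (i j k l : Fin n) : ℝ :=
  c i j * c k l * (c i k * c i l * (c j k * c j l))

/-- The sum of the functionals `pairPolar` over `A × B`, weighted by `|c|`. -/
noncomputable def pairSum (c : Fin n → Fin n → ℝ) (A B : Finset (Fin n)) :
    MvPolynomial (Fin n) ℝ →ₗ[ℝ] ℝ :=
  ∑ i ∈ A, ∑ j ∈ B, |c i j| • pairPolar i j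

/-- A linear functional on quartic forms that is non-negative on squares. -/
noncomputable def pseudoExp (c : Fin n → Fin n → ℝ) (V₁ V₂ V₃ V₄ : Finset (Fin n)) (s : ℝ) :
    MvPolynomial (Fin n) ℝ →ₗ[ℝ] ℝ :=
  ∑ i ∈ V₁, ∑ j ∈ V₂, ∑ k ∈ V₃, ∑ l ∈ V₄, sixProd c i j k l • polar i j k l
    + s • (pairSum c V₁ V₂ + pairSum c V₃ V₄ + pairSum c V₁ V₃ + pairSum c V₂ V₄
      + pairSum c V₁ V₄ + pairSum c V₂ V₃)

lemma pairSum_mul_self_ge {q : MvPolynomial (Fin n) ℝ} (hq : q.IsHomogeneous 2)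
    (c : Fin n → Fin n → ℝ) (A B : Finset (Fin n)) :
    4 * ∑ i ∈ A, ∑ j ∈ B, |c i j| * hess q i j ^ 2 ≤ pairSum c A B (q * q) := by
  simp only [pairSum, LinearMap.sum_apply, LinearMap.smul_apply, pairPolar_mul_self hq,
    smul_eq_mul, Finset.mul_sum]
  refine Finset.sum_le_sum fun i _ => Finset.sum_le_sum fun j _ => ?_
  have := mul_nonneg (abs_nonneg (c i j)) (sq_nonneg (hess q i i + hess q j j))
  linarith

/-- Each of the three pairings is a clique form evaluated at the Hessian of `q`. Its loss, t/2 times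
the doubling from `polar_mul_self`, is matched exactly by t/4 times the 4 in `pairSum_mul_self_ge`.
-/
lemma pseudoExp_mul_self_nonneg {p t : ℝ} {ω : Finset (Sym2 (Fin n))} (ht : 0 ≤ t)
    {V₁ V₂ V₃ V₄ : Finset (Fin n)} (h1 : CliqueFormBounded p ω V₁ V₂ V₃ V₄ t)
    (h2 : CliqueFormBounded p ω V₁ V₃ V₂ V₄ t) (h3 : CliqueFormBounded p ω V₁ V₄ V₂ V₃ t)
    {q : MvPolynomial (Fin n) ℝ} (hq : q.IsHomogeneous 2) :
    0 ≤ pseudoExp (edgeDev p ω) V₁ V₂ V₃ V₄ (t / 4) (q * q) := by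
  set c := edgeDev p ω with hc
  have hcc : ∀ i j, c i j = c j i := edgeDev_comm p ω
  have b1 := h1 (hess q) (hess q)
  have b2 := h2 (hess q) (hess q)
  have b3 := h3 (hess q) (hess q)
  simp only [← hc] at b1 b2 b3
  have e2 : ∑ i ∈ V₁, ∑ k ∈ V₃, ∑ j ∈ V₂, ∑ l ∈ V₄, c i k * c j l * (c i j * c i l *
      (c k j * c k l)) * (hess q i k * hess q j l)
      = ∑ i ∈ V₁, ∑ j ∈ V₂, ∑ k ∈ V₃, ∑ l ∈ V₄, sixProd c i j k l *
        (hess q i k * hess q j l) := by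
    refine Finset.sum_congr rfl fun i _ => ?_
    rw [Finset.sum_comm]
    refine Finset.sum_congr rfl fun j _ => Finset.sum_congr rfl fun k _ =>
      Finset.sum_congr rfl fun l _ => ?_
    rw [hcc k j, sixProd]
    ring
  have e3 : ∑ i ∈ V₁, ∑ l ∈ V₄, ∑ j ∈ V₂, ∑ k ∈ V₃, c i l * c j k * (c i j * c i k *
      (c l j * c l k)) * (hess q i l * hess q j k)
      = ∑ i ∈ V₁, ∑ j ∈ V₂, ∑ k ∈ V₃, ∑ l ∈ V₄, sixProd c i j k l *
        (hess q i l * hess q j k) := by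
    refine Finset.sum_congr rfl fun i _ => ?_
    rw [Finset.sum_comm]
    refine Finset.sum_congr rfl fun j _ => ?_
    rw [Finset.sum_comm]
    refine Finset.sum_congr rfl fun k _ =>
      Finset.sum_congr rfl fun l _ => ?_
    rw [hcc l j, hcc l k, sixProd]
    ring
  rw [e2] at b2
  rw [e3] at b3
  have hexp : pseudoExp c V₁ V₂ V₃ V₄ (t / 4) (q * q)
      = 2 * (∑ i ∈ V₁, ∑ j ∈ V₂, ∑ k ∈ V₃, ∑ l ∈ V₄, sixProd c i j k l *
          (hess q i j * hess q k l)
        + ∑ i ∈ V₁, ∑ j ∈ V₂, ∑ k ∈ V₃, ∑ l ∈ V₄, sixProd c i j k l * (hess q i k * hess q j l)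
        + ∑ i ∈ V₁, ∑ j ∈ V₂, ∑ k ∈ V₃, ∑ l ∈ V₄, sixProd c i j k l * (hess q i l * hess q j k))
      + t / 4 * (pairSum c V₁ V₂ (q * q) + pairSum c V₃ V₄ (q * q) + pairSum c V₁ V₃ (q * q)
        + pairSum c V₂ V₄ (q * q) + pairSum c V₁ V₄ (q * q) + pairSum c V₂ V₃ (q * q)) := by
    simp only [pseudoExp, LinearMap.add_apply, LinearMap.sum_apply, LinearMap.smul_apply,
      polar_mul_self hq, smul_eq_mul]
    congr 1
    simp only [← Finset.sum_add_distrib, Finset.mul_sum]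
    exact Finset.sum_congr rfl fun i _ => Finset.sum_congr rfl fun j _ =>
      Finset.sum_congr rfl fun k _ => Finset.sum_congr rfl fun l _ => by ring
  rw [hexp]
  have g1 := mul_le_mul_of_nonneg_left (pairSum_mul_self_ge hq c V₁ V₂) ht
  have g2 := mul_le_mul_of_nonneg_left (pairSum_mul_self_ge hq c V₃ V₄) ht
  have g3 := mul_le_mul_of_nonneg_left (pairSum_mul_self_ge hq c V₁ V₃) ht
  have g4 := mul_le_mul_of_nonneg_left (pairSum_mul_self_ge hq c V₂ V₄) ht
  have g5 := mul_le_mul_of_nonneg_left (pairSum_mul_self_ge hq c V₁ V₄) ht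
  have g6 := mul_le_mul_of_nonneg_left (pairSum_mul_self_ge hq c V₂ V₃) ht
  simp only [sixProd] at b2 b3 ⊢
  linarith

/-- The squared Euclidean norm as a polynomial. -/
noncomputable def normSqPoly (n : ℕ) : MvPolynomial (Fin n) ℝ := ∑ i, X i ^ 2

lemma normSqPoly_isHomogeneous : (normSqPoly n).IsHomogeneous 2 :=
  IsHomogeneous.sum _ _ _ fun i _ => isHomogeneous_X_pow i 2

lemma hess_normSqPoly (i j : Fin n) : hess (normSqPoly n) i j = if i = j then 2 else 0 := by
  have h1 : pderiv j (normSqPoly n) = 2 * X j := by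
    simp only [normSqPoly, map_sum, pderiv_pow, pderiv_X]
    rw [Finset.sum_eq_single j]
    · simp
    · intro b _ hb
      simp [Pi.single_eq_of_ne hb]
    · simp
  rw [hess, h1, pderiv_mul, pderiv_X]
  by_cases h : i = j
  · subst h
    simpa using map_ofNat constantCoeff 2
  · simp [h, Ne.symm h]

/-- The Hessian of ‖x‖² is 2 times the identity, so the clique part vanishes on distinct indices.
Each pair gives (2+2)² = 16, and there are six pair sums. -/
lemma pseudoExp_normSq {c : Fin n → Fin n → ℝ} {V₁ V₂ V₃ V₄ : Finset (Fin n)} {s : ℝ}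
    (hs : 0 ≤ s) {W : ℝ}
    (h12 : Disjoint V₁ V₂) (h13 : Disjoint V₁ V₃) (h23 : Disjoint V₂ V₃) (h14 : Disjoint V₁ V₄)
    (h24 : Disjoint V₂ V₄) (h34 : Disjoint V₃ V₄)
    (hW : ∀ A B : Finset (Fin n), ∑ i ∈ A, ∑ j ∈ B, |c i j| ≤ W) :
    pseudoExp c V₁ V₂ V₃ V₄ s (normSqPoly n * normSqPoly n) ≤ 96 * s * W := by
  have hne : ∀ {A B : Finset (Fin n)}, Disjoint A B → ∀ i ∈ A, ∀ j ∈ B, i ≠ j :=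
    fun h i hi j hj e => Finset.disjoint_left.1 h hi (e ▸ hj)
  have hp : ∀ {A B : Finset (Fin n)}, Disjoint A B →
      pairSum c A B (normSqPoly n * normSqPoly n) ≤ 16 * W := by
    intro A B hAB
    simp only [pairSum, LinearMap.sum_apply, LinearMap.smul_apply,
      pairPolar_mul_self normSqPoly_isHomogeneous, hess_normSqPoly, smul_eq_mul]
    calc _ = ∑ i ∈ A, ∑ j ∈ B, 16 * |c i j| := by
          refine Finset.sum_congr rfl fun i hi => Finset.sum_congr rfl fun j hj => ?_
          simp [hne hAB i hi j hj]
          ring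
      _ ≤ 16 * W := by
          simp only [← Finset.mul_sum]
          linarith [hW A B]
  have h0 : ∑ i ∈ V₁, ∑ j ∈ V₂, ∑ k ∈ V₃, ∑ l ∈ V₄, sixProd c i j k l *
      polar i j k l (normSqPoly n * normSqPoly n) = 0 := by
    refine Finset.sum_eq_zero fun i hi => Finset.sum_eq_zero fun j hj => Finset.sum_eq_zero
      fun k hk => Finset.sum_eq_zero fun l hl => ?_
    rw [polar_mul_self normSqPoly_isHomogeneous]
    simp [hess_normSqPoly, hne h12 i hi j hj, hne h13 i hi k hk, hne h14 i hi l hl]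
  simp only [pseudoExp, LinearMap.add_apply, LinearMap.sum_apply, LinearMap.smul_apply,
    smul_eq_mul, h0, zero_add]
  have := hp h12
  have := hp h13
  have := hp h14
  have := hp h23
  have := hp h24
  have := hp h34
  calc _ ≤ s * (16 * W + 16 * W + 16 * W + 16 * W + 16 * W + 16 * W) := by
        gcongr
    _ = 96 * s * W := by ring

lemma pderiv_prod_X (s : Finset (Fin n)) (j : Fin n) :
    pderiv j (∏ x ∈ s, (X x : MvPolynomial (Fin n) ℝ))
      = if j ∈ s then ∏ x ∈ s.erase j, X x else 0 := by
  have h0 : ∀ s : Finset (Fin n), j ∉ s →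
      pderiv j (∏ x ∈ s, (X x : MvPolynomial (Fin n) ℝ)) = 0 := by
    intro s
    induction s using Finset.induction_on with
    | empty => simp
    | insert a s ha ih =>
      intro hj
      rw [Finset.mem_insert, not_or] at hj
      rw [Finset.prod_insert ha, pderiv_mul, ih hj.2, pderiv_X_of_ne (Ne.symm hj.1)]
      simp
  split_ifs with h
  · rw [← Finset.mul_prod_erase s _ h, pderiv_mul, h0 _ (Finset.notMem_erase j s)]
    simp
  · exact h0 s h

open scoped Classical in
lemma pderiv_pderiv_cliquePoly (G : SimpleGraph (Fin n)) (j : Fin n) :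
    pderiv j (pderiv j (cliquePoly G)) = 0 := by
  simp only [cliquePoly, map_sum]
  refine Finset.sum_eq_zero fun s _ => ?_
  rw [pderiv_prod_X]
  split_ifs
  · rw [pderiv_prod_X, if_neg (Finset.notMem_erase j s)]
  · simp

-- For distinct indices the functional reads off the coefficient of one squarefree monomial.
open scoped Classical in
lemma polar_cliquePoly (G : SimpleGraph (Fin n)) {i j k l : Fin n} (hij : i ≠ j) (hik : i ≠ k)
    (hil : i ≠ l) (hjk : j ≠ k) (hjl : j ≠ l) (hkl : k ≠ l) :
    polar i j k l (cliquePoly G) = if G.IsNClique 4 {i, j, k, l} then 1 else 0 := by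
  have hs : ∀ s : Finset (Fin n), s.card = 4 → polar i j k l (∏ x ∈ s, X x)
      = if s = {i, j, k, l} then 1 else 0 := by
    intro s hs
    simp only [polar, LinearMap.coe_mk, AddHom.coe_mk, pderiv_prod_X]
    by_cases h : s = {i, j, k, l}
    · subst h
      rw [if_pos (by simp), pderiv_prod_X, if_pos (by simp [hkl]), pderiv_prod_X,
        if_pos (by simp [hjk, hjl]), pderiv_prod_X, if_pos (by simp [hij, hik, hil]), if_pos rfl]
      have : ((((({i, j, k, l} : Finset (Fin n)).erase l).erase k).erase j).erase i) = ∅ := by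
        ext x
        simp
        tauto
      rw [this]
      simp
    · rw [if_neg h]
      have hsub : ¬ ({i, j, k, l} : Finset (Fin n)) ⊆ s := by
        intro hsub
        refine h (Finset.eq_of_subset_of_card_le hsub ?_).symm
        rw [hs, Finset.card_insert_of_notMem (by simp [hij, hik, hil]),
          Finset.card_insert_of_notMem (by simp [hjk, hjl]), Finset.card_pair hkl]
      simp only [Finset.insert_subset_iff, Finset.singleton_subset_iff] at hsub
      by_cases hl : l ∈ s
      · by_cases hk : k ∈ s
        · by_cases hj : j ∈ s
          · have hi : i ∉ s := fun hi => hsub ⟨hi, hj, hk, hl⟩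
            rw [if_pos hl, pderiv_prod_X, if_pos (by simp [hk, hkl]), pderiv_prod_X,
              if_pos (by simp [hj, hjk, hjl]), pderiv_prod_X, if_neg (by simp [hi])]
            simp
          · rw [if_pos hl, pderiv_prod_X, if_pos (by simp [hk, hkl]), pderiv_prod_X,
              if_neg (by simp [hj])]
            simp
        · rw [if_pos hl, pderiv_prod_X, if_neg (by simp [hk])]
          simp
      · rw [if_neg hl]
        simp
  rw [cliquePoly, map_sum, Finset.sum_congr rfl fun s hs' =>
    hs s ((SimpleGraph.mem_cliqueFinset_iff.1 hs').card_eq), Finset.sum_ite_eq']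
  simp only [SimpleGraph.mem_cliqueFinset_iff]

/-- Pair functionals differentiate twice in one variable and so kill multilinear polynomials: the
positive correction is free on the clique polynomial. -/
lemma pairSum_cliquePoly (G : SimpleGraph (Fin n)) (c : Fin n → Fin n → ℝ)
    (A B : Finset (Fin n)) : pairSum c A B (cliquePoly G) = 0 := by
  simp only [pairSum, LinearMap.sum_apply, LinearMap.smul_apply]
  refine Finset.sum_eq_zero fun i _ => Finset.sum_eq_zero fun j _ => ?_
  simp [pairPolar, polar, pderiv_pderiv_cliquePoly]

lemma isNClique_four_iff (G : SimpleGraph (Fin n)) (i j k l : Fin n) :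
    G.IsNClique 4 {i, j, k, l} ↔
      G.Adj i j ∧ G.Adj i k ∧ G.Adj i l ∧ G.Adj j k ∧ G.Adj j l ∧ G.Adj k l := by
  constructor
  · intro h
    have hcard := h.card_eq
    have hd : i ≠ j ∧ i ≠ k ∧ i ≠ l ∧ j ≠ k ∧ j ≠ l ∧ k ≠ l := by
      have h3 : ∀ x y z : Fin n, ({x, y, z} : Finset (Fin n)).card ≤ 3 := fun _ _ _ =>
        Finset.card_le_three
      refine ⟨?_, ?_, ?_, ?_, ?_, ?_⟩ <;> rintro rfl
      · have := h3 i k l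
        simp at hcard; omega
      · have := h3 j i l
        rw [Finset.insert_eq_of_mem (by simp)] at hcard; omega
      · have := h3 j k i
        rw [Finset.insert_eq_of_mem (by simp)] at hcard; omega
      · have := h3 i j l
        simp at hcard; omega
      · have := h3 i k j
        rw [Finset.insert_eq_of_mem (s := {k, j}) (by simp)] at hcard; omega
      · have := h3 i j k
        simp at hcard; omega
    obtain ⟨h1, h2, h3, h4, h5, h6⟩ := hd
    have hc := h.isClique
    exact ⟨hc (by simp) (by simp) h1, hc (by simp) (by simp) h2, hc (by simp) (by simp) h3,
      hc (by simp) (by simp) h4, hc (by simp) (by simp) h5, hc (by simp) (by simp) h6⟩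
  · rintro ⟨h1, h2, h3, h4, h5, h6⟩
    rw [SimpleGraph.isNClique_iff]
    refine ⟨?_, ?_⟩
    · simp only [Finset.coe_insert, Finset.coe_singleton, SimpleGraph.isClique_insert,
        Set.mem_insert_iff, Set.mem_singleton_iff, forall_eq_or_imp, forall_eq]
      simp [h1, h2, h3, h4, h5, h6]
    · rw [Finset.card_insert_of_notMem (by simp [h1.ne, h2.ne, h3.ne]),
        Finset.card_insert_of_notMem (by simp [h4.ne, h5.ne]), Finset.card_pair h6.ne]

/-- The number of cliques with one vertex in each of four classes. -/
noncomputable def cliqueCount (ω : Finset (Sym2 (Fin n))) (V₁ V₂ V₃ V₄ : Finset (Fin n)) : ℝ :=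
  ∑ i ∈ V₁, ∑ j ∈ V₂, ∑ k ∈ V₃, ∑ l ∈ V₄, sixProd (edgeInd ω) i j k l

/-- Only actual cliques survive, and on these every centred indicator equals 1 - p. -/
lemma pseudoExp_cliquePoly {p : ℝ} {ω : Finset (Sym2 (Fin n))} (hω : ω ⊆ allEdges n)
    {V₁ V₂ V₃ V₄ : Finset (Fin n)}
    (h12 : Disjoint V₁ V₂) (h13 : Disjoint V₁ V₃) (h23 : Disjoint V₂ V₃) (h14 : Disjoint V₁ V₄)
    (h24 : Disjoint V₂ V₄) (h34 : Disjoint V₃ V₄) (s : ℝ) :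
    pseudoExp (edgeDev p ω) V₁ V₂ V₃ V₄ s (cliquePoly (edgeGraph ω))
      = (1 - p) ^ 6 * cliqueCount ω V₁ V₂ V₃ V₄ := by
  classical
  have hne : ∀ {A B : Finset (Fin n)}, Disjoint A B → ∀ i ∈ A, ∀ j ∈ B, i ≠ j :=
    fun h i hi j hj e => Finset.disjoint_left.1 h hi (e ▸ hj)
  simp only [pseudoExp, LinearMap.add_apply, LinearMap.sum_apply, LinearMap.smul_apply,
    pairSum_cliquePoly, add_zero, smul_eq_mul, mul_zero, cliqueCount, Finset.mul_sum]
  refine Finset.sum_congr rfl fun i hi => Finset.sum_congr rfl fun j hj => Finset.sum_congr rfl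
    fun k hk => Finset.sum_congr rfl fun l hl => ?_
  rw [polar_cliquePoly _ (hne h12 i hi j hj) (hne h13 i hi k hk) (hne h14 i hi l hl)
    (hne h23 j hj k hk) (hne h24 j hj l hl) (hne h34 k hk l hl)]
  simp only [isNClique_four_iff, edgeGraph_adj hω, sixProd, edgeDev, edgeInd]
  by_cases h1 : s(i, j) ∈ ω
  swap
  · simp [h1]
  by_cases h2 : s(i, k) ∈ ω
  swap
  · simp [h2]
  by_cases h3 : s(i, l) ∈ ω
  swap
  · simp [h3]
  by_cases h4 : s(j, k) ∈ ω
  swap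
  · simp [h4]
  by_cases h5 : s(j, l) ∈ ω
  swap
  · simp [h5]
  by_cases h6 : s(k, l) ∈ ω
  swap
  · simp [h6]
  simp only [h1, h2, h3, h4, h5, h6, and_self, if_true]
  ring

end PseudoExpectation

/-! ### Weak duality for the relaxation. -/

section SosDuality

open Matrix

variable {n : ℕ}

lemma dotProduct_mulVec_le_maxQuadForm {ι : Type*} [Fintype ι] (M : Matrix ι ι ℝ) (z : ι → ℝ) :
    z ⬝ᵥ M *ᵥ z ≤ maxQuadForm M * (z ⬝ᵥ z) := by
  -- Needed since the supremum of an unbounded set of reals is 0 by convention.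
  have hbdd : BddAbove {r : ℝ | ∃ z : ι → ℝ, ∑ i, z i ^ 2 = 1 ∧ r = z ⬝ᵥ M.mulVec z} := by
    refine ⟨∑ i, ∑ j, |M i j|, ?_⟩
    rintro r ⟨z, hz, rfl⟩
    have hz1 : ∀ i, |z i| ≤ 1 := by
      intro i
      rw [← sq_le_one_iff_abs_le_one, ← hz]
      exact Finset.single_le_sum (f := fun i => z i ^ 2) (fun j _ => sq_nonneg _)
        (Finset.mem_univ i)
    simp only [dotProduct, mulVec, Finset.mul_sum]
    refine Finset.sum_le_sum fun i _ => Finset.sum_le_sum fun j _ => ?_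
    refine (le_abs_self _).trans ?_
    rw [abs_mul, abs_mul]
    calc |z i| * (|M i j| * |z j|) ≤ 1 * (|M i j| * 1) := by
          gcongr
          · exact hz1 i
          · exact hz1 j
      _ = |M i j| := by ring
  have hzz : z ⬝ᵥ z = ∑ i, z i ^ 2 := by simp [dotProduct, sq]
  rcases eq_or_ne z 0 with rfl | hz
  · simp
  have hpos : 0 < ∑ i, z i ^ 2 := by
    obtain ⟨i, hi⟩ := Function.ne_iff.1 hz
    exact Finset.sum_pos' (fun j _ => sq_nonneg _) ⟨i, Finset.mem_univ i, sq_pos_of_ne_zero hi⟩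
  set N := √(∑ i, z i ^ 2) with hN
  have hN0 : 0 < N := Real.sqrt_pos.2 hpos
  have hN2 : N ^ 2 = ∑ i, z i ^ 2 := Real.sq_sqrt hpos.le
  have h := le_csSup hbdd ⟨N⁻¹ • z, by
    simp only [Pi.smul_apply, smul_eq_mul, mul_pow, ← Finset.mul_sum, ← hN2]
    field_simp, rfl⟩
  rw [mulVec_smul, smul_dotProduct, dotProduct_smul, smul_eq_mul, smul_eq_mul] at h
  rw [hzz, ← hN2]
  have h2 : N⁻¹ * (N⁻¹ * (z ⬝ᵥ M *ᵥ z)) = (z ⬝ᵥ M *ᵥ z) / N ^ 2 := by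
    field_simp
  rw [h2, div_le_iff₀ (by positivity)] at h
  exact h

/-- Weak duality: a functional that is non-negative on squares bounds the relaxation from below. -/
lemma le_maxQuadForm_of_isMatrixRep {f : MvPolynomial (Fin n) ℝ}
    (L : MvPolynomial (Fin n) ℝ →ₗ[ℝ] ℝ)
    (hL : ∀ q : MvPolynomial (Fin n) ℝ, q.IsHomogeneous 2 → 0 ≤ L (q * q))
    {M : Matrix (Fin 2 → Fin n) (Fin 2 → Fin n) ℝ} (hM : IsMatrixRep 2 f M) :
    L f ≤ maxQuadForm M * L (normSqPoly n * normSqPoly n) := by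
  set lam := maxQuadForm M with hlam
  have hpsd : (lam • 1 - M).PosSemidef := by
    rw [posSemidef_iff_dotProduct_mulVec]
    refine ⟨?_, fun z => ?_⟩
    · refine (isHermitian_one.smul (IsSelfAdjoint.all _)).sub ?_
      rw [IsHermitian, conjTranspose_eq_transpose_of_trivial]
      exact hM.1
    · rw [star_trivial, sub_mulVec, dotProduct_sub, smul_mulVec, one_mulVec, dotProduct_smul,
        smul_eq_mul, sub_nonneg]
      exact dotProduct_mulVec_le_maxQuadForm M z
  obtain ⟨U, d, hU, hU', hNd⟩ := exists_orthogonal_diagonalization hpsd.1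
  have hd : ∀ x, 0 ≤ d x := by
    intro x
    have h := (hpsd.conjTranspose_mul_mul_same U).diag_nonneg (i := x)
    rw [conjTranspose_eq_transpose_of_trivial, hNd] at h
    rw [conj_diagonal_cancel hU] at h
    simpa using h
  set q : (Fin 2 → Fin n) → MvPolynomial (Fin n) ℝ := fun r =>
    ∑ I, C (U I r) * ∏ j, X (I j) with hq
  have hqh : ∀ r, (q r).IsHomogeneous 2 := by
    intro r
    refine IsHomogeneous.sum _ _ _ fun I _ => IsHomogeneous.C_mul ?_ _
    have := IsHomogeneous.prod Finset.univ (fun j : Fin 2 => (X (I j) : MvPolynomial (Fin n) ℝ))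
      (fun _ => 1) (fun j _ => isHomogeneous_X ℝ (I j))
    simpa using this
  -- Eigenvectors of λ - M, read as quadratic forms, write λ‖x‖⁴ - f as a non-negative combination
  -- of squares; apply `L`.
  have hid : ∑ r, d r • (q r * q r) = lam • (normSqPoly n * normSqPoly n) - f := by
    refine MvPolynomial.funext fun x => ?_
    have hy := hM.2 x
    set y := tensorPow 2 x with hydef
    have hqy : ∀ r, eval x (q r) = (Uᵀ *ᵥ y) r := by
      intro r
      simp only [hq, map_sum, map_mul, eval_C, map_prod, eval_X, mulVec, dotProduct, hydef,
        tensorPow, transpose_apply]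
    have hyy : (∑ i, x i ^ 2) * (∑ i, x i ^ 2) = y ⬝ᵥ y := by
      rw [← sq, Fintype.sum_pow]
      simp only [dotProduct, hydef, tensorPow, ← Finset.prod_mul_distrib, sq]
    have hquad : y ⬝ᵥ (lam • 1 - M) *ᵥ y = ∑ r, d r * ((Uᵀ *ᵥ y) r * (Uᵀ *ᵥ y) r) := by
      rw [hNd, ← mulVec_mulVec, ← mulVec_mulVec, dotProduct_mulVec, ← mulVec_transpose]
      simp only [dotProduct, mulVec_diagonal]
      exact Finset.sum_congr rfl fun r _ => by ring
    rw [sub_mulVec, dotProduct_sub, smul_mulVec, one_mulVec, dotProduct_smul, smul_eq_mul, hy]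
      at hquad
    simp only [map_sum, smul_eval, map_mul, map_sub, hqy, normSqPoly, map_pow, eval_X, hyy]
    exact hquad.symm
  have h := congrArg L hid
  rw [map_sum, map_sub, map_smul, smul_eq_mul] at h
  have hnn : 0 ≤ ∑ r, L (d r • (q r * q r)) := by
    refine Finset.sum_nonneg fun r _ => ?_
    rw [map_smul, smul_eq_mul]
    exact mul_nonneg (hd r) (hL _ (hqh r))
  linarith

lemma IsMatrixRep.add {k : ℕ} {f g : MvPolynomial (Fin n) ℝ}
    {M N : Matrix (Fin k → Fin n) (Fin k → Fin n) ℝ} (hM : IsMatrixRep k f M)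
    (hN : IsMatrixRep k g N) : IsMatrixRep k (f + g) (M + N) := by
  refine ⟨hM.1.add hN.1, fun x => ?_⟩
  rw [add_mulVec, dotProduct_add, hM.2, hN.2, map_add]

lemma exists_isMatrixRep_prod_X (v : Fin 4 → Fin n) :
    ∃ M, IsMatrixRep 2 (∏ a, (X (v a) : MvPolynomial (Fin n) ℝ)) M := by
  classical
  set I : Fin 2 → Fin n := ![v 0, v 1]
  set J : Fin 2 → Fin n := ![v 2, v 3]
  refine ⟨(1 / 2 : ℝ) • (Matrix.single I J 1 + Matrix.single J I 1), ?_, fun x => ?_⟩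
  · rw [IsSymm, transpose_smul, transpose_add, transpose_single, transpose_single, add_comm]
  · have h : ∀ A B : Fin 2 → Fin n, tensorPow 2 x ⬝ᵥ Matrix.single A B 1 *ᵥ tensorPow 2 x
        = tensorPow 2 x A * tensorPow 2 x B := by
      intro A B
      simp [dotProduct, mulVec, Matrix.single_apply, ite_and]
    rw [smul_mulVec, dotProduct_smul, add_mulVec, dotProduct_add, h, h]
    simp [tensorPow, I, J, Fin.prod_univ_four]
    ring

/-- The infimum defining `sosValue` must run over a nonempty set, or it would be 0 by convention. -/
lemma exists_isMatrixRep_cliquePoly (G : SimpleGraph (Fin n)) :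
    ∃ M, IsMatrixRep 2 (cliquePoly G) M := by
  classical
  rw [cliquePoly]
  have : ∀ S : Finset (Finset (Fin n)), (∀ s ∈ S, s.card = 4) →
      ∃ M, IsMatrixRep 2 (∑ s ∈ S, ∏ i ∈ s, (X i : MvPolynomial (Fin n) ℝ)) M := by
    intro S
    induction S using Finset.induction_on with
    | empty =>
      intro _
      exact ⟨0, isSymm_zero, fun x => by simp⟩
    | insert s S hs ih =>
      intro h
      obtain ⟨M, hM⟩ := ih fun s hs => h s (Finset.mem_insert_of_mem hs)
      have hcard := h s (Finset.mem_insert_self s S)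
      obtain ⟨N, hN⟩ := exists_isMatrixRep_prod_X
        (fun a => ((s.equivFinOfCardEq hcard).symm a : Fin n))
      refine ⟨N + M, ?_⟩
      rw [Finset.sum_insert hs]
      refine IsMatrixRep.add ?_ hM
      convert hN using 1
      rw [← Finset.prod_coe_sort]
      exact ((s.equivFinOfCardEq hcard).symm.prod_comp (fun a => (X (a : Fin n)))).symm
  refine this _ fun s hs => ?_
  exact (SimpleGraph.mem_cliqueFinset_iff.1 hs).card_eq

/-- Lower bound for the value of the relaxation from a non-negative functional. -/
lemma le_sosValue_cliquePoly {G : SimpleGraph (Fin n)} (L : MvPolynomial (Fin n) ℝ →ₗ[ℝ] ℝ)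
    (hL : ∀ q : MvPolynomial (Fin n) ℝ, q.IsHomogeneous 2 → 0 ≤ L (q * q)) {b T : ℝ} (hT : 0 < T)
    (hb : 0 < b) (hLT : L (normSqPoly n * normSqPoly n) ≤ T) (hLf : b * T ≤ L (cliquePoly G)) :
    b ≤ sosValue 2 (cliquePoly G) := by
  obtain ⟨M₀, hM₀⟩ := exists_isMatrixRep_cliquePoly G
  refine le_csInf ⟨_, M₀, hM₀, rfl⟩ ?_
  rintro r ⟨M, hM, rfl⟩
  have h := le_maxQuadForm_of_isMatrixRep L hL hM
  have h0 := hL _ (normSqPoly_isHomogeneous (n := n))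
  by_contra hlt
  push Not at hlt
  have hbT : 0 < b * T := mul_pos hb hT
  -- `hLT` only bounds L(‖x‖⁴) from above, so it helps only for a positive multiplier; a
  -- non-positive one contradicts bT > 0 directly.
  rcases le_or_gt (maxQuadForm M) 0 with h1 | h1
  · nlinarith [mul_nonneg_of_nonpos_of_nonpos h1 (neg_nonpos.2 h0)]
  · have h2 : maxQuadForm M * L (normSqPoly n * normSqPoly n) ≤ maxQuadForm M * T := by gcongr
    have h3 : maxQuadForm M * T < b * T := by gcongr
    linarith

end SosDuality

/-! ### Counting transversal cliques by the second moment method. -/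

section SecondMoment

variable {n : ℕ}

/-- The pairs of positions in a `4`-tuple. -/
def posPairs : Finset (Fin 4 × Fin 4) := Finset.univ.filter fun x => x.1 < x.2

/-- The six edges spanned by a `4`-tuple of vertices. -/
def tupleEdges (v : Fin 4 → Fin n) : Finset (Sym2 (Fin n)) :=
  posPairs.image fun x => s(v x.1, v x.2)

/-- Since the classes are disjoint, a vertex determines its position, so a shared edge occupies the
same two positions in both tuples. -/
lemma tupleEdges_eq_of_mem {V : Fin 4 → Finset (Fin n)}
    (hV : ∀ a b, a ≠ b → Disjoint (V a) (V b)) {v v' : Fin 4 → Fin n} (hv : ∀ a, v a ∈ V a)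
    (hv' : ∀ a, v' a ∈ V a) {x y : Fin 4 × Fin 4} (hx : x ∈ posPairs) (hy : y ∈ posPairs)
    (h : s(v x.1, v x.2) = s(v' y.1, v' y.2)) :
    x = y ∧ v x.1 = v' x.1 ∧ v x.2 = v' x.2 := by
  have hpos : ∀ a b, v a = v' b → a = b := by
    intro a b hab
    by_contra hne
    exact Finset.disjoint_left.1 (hV a b hne) (hv a) (hab ▸ hv' b)
  have hx := (Finset.mem_filter.1 hx).2
  have hy := (Finset.mem_filter.1 hy).2
  rw [Sym2.eq_iff] at h
  rcases h with ⟨h1, h2⟩ | ⟨h1, h2⟩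
  · have e1 := hpos _ _ h1
    have e2 := hpos _ _ h2
    refine ⟨Prod.ext e1 e2, ?_, ?_⟩
    · rw [h1, e1]
    · rw [h2, e2]
  · have e1 := hpos _ _ h1
    have e2 := hpos _ _ h2
    rw [e1, e2] at hx
    exact absurd hx (not_lt.2 hy.le)

lemma card_tupleEdges {V : Fin 4 → Finset (Fin n)} (hV : ∀ a b, a ≠ b → Disjoint (V a) (V b))
    {v : Fin 4 → Fin n} (hv : ∀ a, v a ∈ V a) : (tupleEdges v).card = 6 := by
  rw [tupleEdges, Finset.card_image_of_injOn]
  · decide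
  · intro x hx y hy h
    exact (tupleEdges_eq_of_mem hV hv hv hx hy h).1

lemma tupleEdges_subset {V : Fin 4 → Finset (Fin n)} (hV : ∀ a b, a ≠ b → Disjoint (V a) (V b))
    {v : Fin 4 → Fin n} (hv : ∀ a, v a ∈ V a) : tupleEdges v ⊆ allEdges n := by
  intro e he
  obtain ⟨x, hx, rfl⟩ := Finset.mem_image.1 he
  rw [mem_allEdges]
  intro h
  have hx := (Finset.mem_filter.1 hx).2
  exact Finset.disjoint_left.1 (hV _ _ hx.ne) (hv x.1) (h ▸ hv x.2)

/-- The positions where two tuples agree. -/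
def agree (v v' : Fin 4 → Fin n) : Finset (Fin 4) := Finset.univ.filter fun a => v a = v' a

/-- A common edge has both ends at positions where the tuples agree. -/
lemma card_tupleEdges_union {V : Fin 4 → Finset (Fin n)}
    (hV : ∀ a b, a ≠ b → Disjoint (V a) (V b)) {v v' : Fin 4 → Fin n} (hv : ∀ a, v a ∈ V a)
    (hv' : ∀ a, v' a ∈ V a) :
    12 - (agree v v').card.choose 2 ≤ (tupleEdges v ∪ tupleEdges v').card := by
  have h1 := Finset.card_union_add_card_inter (tupleEdges v) (tupleEdges v')
  rw [card_tupleEdges hV hv, card_tupleEdges hV hv'] at h1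
  have h2 : (tupleEdges v ∩ tupleEdges v').card ≤ (agree v v').card.choose 2 := by
    have hsub : tupleEdges v ∩ tupleEdges v' ⊆
        (posPairs.filter fun x => x.1 ∈ agree v v' ∧ x.2 ∈ agree v v').image
          fun x => s(v x.1, v x.2) := by
      intro e he
      obtain ⟨he1, he2⟩ := Finset.mem_inter.1 he
      obtain ⟨x, hx, rfl⟩ := Finset.mem_image.1 he1
      obtain ⟨y, hy, hxy⟩ := Finset.mem_image.1 he2
      have := tupleEdges_eq_of_mem hV hv hv' hx hy hxy.symm
      refine Finset.mem_image_of_mem _ (Finset.mem_filter.2 ⟨hx, ?_, ?_⟩)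
      · simp [agree, this.2.1]
      · simp [agree, this.2.2]
    refine (Finset.card_le_card hsub).trans (Finset.card_image_le.trans ?_)
    have hdec : ∀ A : Finset (Fin 4), (posPairs.filter fun x => x.1 ∈ A ∧ x.2 ∈ A).card
        ≤ A.card.choose 2 := by decide
    exact hdec _
  omega

lemma card_agree_superset {V : Fin 4 → Finset (Fin n)} {m : ℕ} (hm : ∀ a, (V a).card = m)
    {v : Fin 4 → Fin n} (hv : ∀ a, v a ∈ V a) (B : Finset (Fin 4)) :
    ((Fintype.piFinset V).filter fun v' => B ⊆ agree v v').card = m ^ (4 - B.card) := by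
  have h : (Fintype.piFinset V).filter (fun v' => B ⊆ agree v v')
      = Fintype.piFinset fun a => if a ∈ B then {v a} else V a := by
    ext v'
    simp only [Finset.mem_filter, Fintype.mem_piFinset, Finset.subset_iff, agree,
      Finset.mem_univ, true_and]
    constructor
    · rintro ⟨h1, h2⟩ a
      split_ifs with ha
      · simp [h2 ha]
      · exact h1 a
    · intro h
      refine ⟨fun a => ?_, fun a ha => ?_⟩
      · have := h a
        split_ifs at this with ha
        · rw [Finset.mem_singleton.1 this]
          exact hv a
        · exact this
      · have := h a
        rw [if_pos ha, Finset.mem_singleton] at this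
        exact this.symm
  rw [h, Fintype.card_piFinset]
  have : ∀ a, (if a ∈ B then {v a} else V a : Finset (Fin n)).card = if a ∈ B then 1 else m := by
    intro a
    split_ifs <;> simp [hm]
  simp only [this]
  rw [Finset.prod_ite]
  simp only [Finset.prod_const_one, one_mul, Finset.prod_const]
  congr 1
  rw [Finset.filter_not, Finset.card_sdiff_of_subset (Finset.filter_subset _ _)]
  simp

lemma cliqueCount_eq_sum_piFinset (ω : Finset (Sym2 (Fin n))) (V : Fin 4 → Finset (Fin n)) :
    cliqueCount ω (V 0) (V 1) (V 2) (V 3)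
      = ∑ v ∈ Fintype.piFinset V, if tupleEdges v ⊆ ω then 1 else 0 := by
  have h : ∀ v : Fin 4 → Fin n, (if tupleEdges v ⊆ ω then (1 : ℝ) else 0)
      = sixProd (edgeInd ω) (v 0) (v 1) (v 2) (v 3) := by
    intro v
    have hp : posPairs = {(0, 1), (2, 3), (0, 2), (0, 3), (1, 2), (1, 3)} := by decide
    simp only [tupleEdges, hp, Finset.image_insert, Finset.image_singleton,
      Finset.insert_subset_iff, Finset.singleton_subset_iff, sixProd, edgeInd]
    simp only [ite_and, mul_ite, mul_one, mul_zero]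
    split_ifs <;> rfl
  simp only [h, cliqueCount]
  rw [← Finset.sum_product', ← Finset.sum_product', ← Finset.sum_product']
  symm
  refine Finset.sum_nbij' (fun v => (((v 0, v 1), v 2), v 3))
    (fun x => ![x.1.1.1, x.1.1.2, x.1.2, x.2]) ?_ ?_ ?_ ?_ ?_
  · intro v hv
    rw [Fintype.mem_piFinset] at hv
    simp [hv]
  · intro x hx
    simp only [Finset.mem_product] at hx
    rw [Fintype.mem_piFinset, Fin.forall_fin_succ, Fin.forall_fin_succ, Fin.forall_fin_two]
    simpa using ⟨hx.1.1.1, hx.1.1.2, hx.1.2, hx.2⟩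
  · intro v _
    ext a
    fin_cases a <;> rfl
  · intro x _
    rfl
  · intro v _
    rfl

lemma bexp_cliqueCount {p : ℝ} {V : Fin 4 → Finset (Fin n)}
    (hV : ∀ a b, a ≠ b → Disjoint (V a) (V b)) {m : ℕ} (hm : ∀ a, (V a).card = m) :
    bexp (allEdges n) p (fun ω => cliqueCount ω (V 0) (V 1) (V 2) (V 3)) = m ^ 4 * p ^ 6 := by
  simp only [cliqueCount_eq_sum_piFinset]
  rw [bexp_sum]
  have h : ∀ v ∈ Fintype.piFinset V, bexp (allEdges n) p
      (fun ω => if tupleEdges v ⊆ ω then 1 else 0) = p ^ 6 := by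
    intro v hv
    have hv := Fintype.mem_piFinset.1 hv
    rw [← card_tupleEdges hV hv, ← bexp_subset (tupleEdges_subset hV hv)]
  rw [Finset.sum_congr rfl h, Finset.sum_const, Fintype.card_piFinset]
  simp [hm]

/-- Classify pairs of tuples by their agreement set; fewer than two agreements share no edge. A set
of b ≥ 2 positions contributes m^{8-b} p^{12 - b(b-1)/2}, and there are 6, 4, 1 such sets for b = 2,
3, 4. -/
lemma bexp_cliqueCount_sq_le {p : ℝ} (hp0 : 0 ≤ p) (hp1 : p ≤ 1) {V : Fin 4 → Finset (Fin n)}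
    (hV : ∀ a b, a ≠ b → Disjoint (V a) (V b)) {m : ℕ} (hm : ∀ a, (V a).card = m) :
    bexp (allEdges n) p (fun ω => cliqueCount ω (V 0) (V 1) (V 2) (V 3) ^ 2)
      ≤ m ^ 8 * p ^ 12 + 6 * (m ^ 6 * p ^ 11) + 4 * (m ^ 5 * p ^ 9) + m ^ 4 * p ^ 6 := by
  obtain ⟨S, hS⟩ : ∃ S, S = (Finset.univ : Finset (Finset (Fin 4))).filter fun B => 2 ≤ B.card :=
    ⟨_, rfl⟩
  have h1 : ∀ v ∈ Fintype.piFinset V, ∀ v' ∈ Fintype.piFinset V,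
      bexp (allEdges n) p (fun ω => (if tupleEdges v ⊆ ω then 1 else 0)
        * if tupleEdges v' ⊆ ω then 1 else 0)
      ≤ p ^ 12 + ∑ B ∈ S, (if B ⊆ agree v v' then 1 else 0) * p ^ (12 - B.card.choose 2) := by
    intro v hv v' hv'
    have hv := Fintype.mem_piFinset.1 hv
    have hv' := Fintype.mem_piFinset.1 hv'
    have e1 : bexp (allEdges n) p (fun ω => (if tupleEdges v ⊆ ω then 1 else 0)
        * if tupleEdges v' ⊆ ω then 1 else 0) = p ^ (tupleEdges v ∪ tupleEdges v').card := by
      rw [← bexp_subset (Finset.union_subset (tupleEdges_subset hV hv) (tupleEdges_subset hV hv'))]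
      refine bexp_congr fun ω _ => ?_
      by_cases h1 : tupleEdges v ⊆ ω <;> by_cases h2 : tupleEdges v' ⊆ ω <;>
        simp [Finset.union_subset_iff, h1, h2]
    rw [e1]
    have e2 : p ^ (tupleEdges v ∪ tupleEdges v').card
        ≤ p ^ (12 - (agree v v').card.choose 2) :=
      pow_le_pow_of_le_one hp0 hp1 (card_tupleEdges_union hV hv hv')
    refine e2.trans ?_
    have hnn : ∀ B ∈ S, 0 ≤ (if B ⊆ agree v v' then (1 : ℝ) else 0)
        * p ^ (12 - B.card.choose 2) := by
      intro B _
      have : (0 : ℝ) ≤ if B ⊆ agree v v' then 1 else 0 := by split_ifs <;> norm_num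
      positivity
    by_cases hA : 2 ≤ (agree v v').card
    · have hmem : agree v v' ∈ S := by rw [hS, Finset.mem_filter]; exact ⟨Finset.mem_univ _, hA⟩
      have := Finset.single_le_sum (f := fun B => (if B ⊆ agree v v' then (1 : ℝ) else 0)
        * p ^ (12 - B.card.choose 2)) hnn hmem
      rw [if_pos subset_rfl, one_mul] at this
      exact le_add_of_nonneg_of_le (pow_nonneg hp0 12) this
    · have : (agree v v').card.choose 2 = 0 := Nat.choose_eq_zero_of_lt (by omega)
      rw [this]
      have := Finset.sum_nonneg hnn
      simpa using this
  have h2 : bexp (allEdges n) p (fun ω => cliqueCount ω (V 0) (V 1) (V 2) (V 3) ^ 2)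
      = ∑ v ∈ Fintype.piFinset V, ∑ v' ∈ Fintype.piFinset V,
        bexp (allEdges n) p (fun ω => (if tupleEdges v ⊆ ω then 1 else 0)
        * if tupleEdges v' ⊆ ω then 1 else 0) := by
    simp only [cliqueCount_eq_sum_piFinset, sq, Finset.sum_mul_sum, bexp_sum]
  rw [h2]
  refine (Finset.sum_le_sum fun v hv => Finset.sum_le_sum fun v' hv' => h1 v hv v' hv').trans ?_
  have hcard : (Fintype.piFinset V).card = m ^ 4 := by
    rw [Fintype.card_piFinset]; simp [hm]
  have h3 : ∀ v ∈ Fintype.piFinset V, ∑ v' ∈ Fintype.piFinset V, (p ^ 12 +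
      ∑ B ∈ S, (if B ⊆ agree v v' then 1 else 0) * p ^ (12 - B.card.choose 2))
      = m ^ 4 * p ^ 12 + ∑ B ∈ S, (m : ℝ) ^ (4 - B.card) * p ^ (12 - B.card.choose 2) := by
    intro v hv
    have hv := Fintype.mem_piFinset.1 hv
    rw [Finset.sum_add_distrib, Finset.sum_const, hcard, Finset.sum_comm]
    congr 1
    · simp
    · refine Finset.sum_congr rfl fun B _ => ?_
      rw [← Finset.sum_mul, Finset.sum_boole, card_agree_superset hm hv]
      simp
  rw [Finset.sum_congr rfl h3, Finset.sum_const, hcard]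
  have h4 : ∑ B ∈ S, (m : ℝ) ^ (4 - B.card) * p ^ (12 - B.card.choose 2)
      = 6 * (m ^ 2 * p ^ 11) + 4 * (m * p ^ 9) + p ^ 6 := by
    have hfib := Finset.sum_fiberwise_of_maps_to (s := S) (t := {2, 3, 4}) (g := Finset.card)
      (by rw [hS]; decide) (fun B => (m : ℝ) ^ (4 - B.card) * p ^ (12 - B.card.choose 2))
    rw [← hfib]
    have hc : ∀ c, ∑ B ∈ S.filter (fun B => B.card = c),
        (m : ℝ) ^ (4 - B.card) * p ^ (12 - B.card.choose 2)
        = (S.filter fun B => B.card = c).card * ((m : ℝ) ^ (4 - c) * p ^ (12 - c.choose 2)) := by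
      intro c
      rw [← nsmul_eq_mul, ← Finset.sum_const]
      refine Finset.sum_congr rfl fun B hB => ?_
      rw [(Finset.mem_filter.1 hB).2]
    simp only [hc]
    have c2 : (S.filter fun B => B.card = 2).card = 6 := by rw [hS]; decide
    have c3 : (S.filter fun B => B.card = 3).card = 4 := by rw [hS]; decide
    have c4 : (S.filter fun B => B.card = 4).card = 1 := by rw [hS]; decide
    rw [Finset.sum_insert (by decide), Finset.sum_insert (by decide), Finset.sum_singleton,
      c2, c3, c4]
    norm_num [Nat.choose]
    ring
  rw [h4, nsmul_eq_mul]
  push_cast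
  apply le_of_eq
  ring

/-- Second moment bound for the lower tail of the clique count. -/
lemma bprob_cliqueCount_lt {p : ℝ} (hp0 : 0 < p) (hp1 : p ≤ 1) {V : Fin 4 → Finset (Fin n)}
    (hV : ∀ a b, a ≠ b → Disjoint (V a) (V b)) {m : ℕ} (hm0 : 0 < m) (hm : ∀ a, (V a).card = m) :
    bprob (allEdges n) p (fun ω => cliqueCount ω (V 0) (V 1) (V 2) (V 3) < m ^ 4 * p ^ 6 / 2)
      ≤ 24 / (m ^ 2 * p) + 16 / (m ^ 3 * p ^ 3) + 4 / (m ^ 4 * p ^ 6) := by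
  set M : ℝ := m ^ 4 * p ^ 6 with hM
  have hm' : (0 : ℝ) < m := by exact_mod_cast hm0
  have hM0 : 0 < M := by positivity
  -- Chebyshev: a count below M/2 deviates from its mean by more than M/2.
  have h := bprob_le_bexp (E := allEdges n) (p := p)
    (S := fun ω => cliqueCount ω (V 0) (V 1) (V 2) (V 3) < M / 2)
    (f := fun ω => (cliqueCount ω (V 0) (V 1) (V 2) (V 3) - M) ^ 2) (a := M ^ 2 / 4) hp0.le hp1
    (by positivity) (fun ω _ => sq_nonneg _) (by
      intro ω _ h
      nlinarith)
  refine h.trans ?_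
  have h1 : bexp (allEdges n) p (fun ω => (cliqueCount ω (V 0) (V 1) (V 2) (V 3) - M) ^ 2)
      = bexp (allEdges n) p (fun ω => cliqueCount ω (V 0) (V 1) (V 2) (V 3) ^ 2) - M ^ 2 := by
    have e : ∀ ω : Finset (Sym2 (Fin n)), (cliqueCount ω (V 0) (V 1) (V 2) (V 3) - M) ^ 2
        = (cliqueCount ω (V 0) (V 1) (V 2) (V 3) ^ 2
          + (-2 * M) * cliqueCount ω (V 0) (V 1) (V 2) (V 3)) + M ^ 2 := fun ω => by ring
    simp only [e]
    rw [bexp_add, bexp_add, bexp_const_mul, bexp_const, bexp_cliqueCount hV hm, ← hM]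
    ring
  rw [h1, div_le_iff₀ (by positivity)]
  have h2 := bexp_cliqueCount_sq_le hp0.le hp1 hV hm
  have h3 : (24 / (m ^ 2 * p) + 16 / (m ^ 3 * p ^ 3) + 4 / (m ^ 4 * p ^ 6)) * (M ^ 2 / 4)
      = 6 * (m ^ 6 * p ^ 11) + 4 * (m ^ 5 * p ^ 9) + m ^ 4 * p ^ 6 := by
    rw [hM]
    field_simp
    ring
  rw [h3]
  have h4 : M ^ 2 = m ^ 8 * p ^ 12 := by rw [hM]; ring
  linarith

end SecondMoment

/-! ### Triangles between vertex sets of a typical graph. -/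

section Triangles

variable {n : ℕ} {ω : Finset (Sym2 (Fin n))} {p a ℓ : ℝ}

lemma card_filter_eq_sum_edgeInd (S : Finset (Fin n)) (k : Fin n) :
    ((S.filter fun i => s(i, k) ∈ ω).card : ℝ) = ∑ i ∈ S, edgeInd ω i k := by
  simp only [edgeInd, Finset.sum_boole]

/-- Sum of squared degrees into a set. -/
lemma Typical.sum_sq_deg_le (h : Typical ω p ℓ) (hn : (n : ℝ) = a ^ 3) (hp : p * a = 1)
    (ha : 1 ≤ a) (hℓ : 1 ≤ ℓ) (S T : Finset (Fin n)) {s : ℝ} (hs : (S.card : ℝ) ≤ s) :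
    ∑ k ∈ T, (∑ i ∈ S, edgeInd ω i k) ^ 2 ≤ 12 * ℓ * s * a * (a + s) := by
  have h1 : ∑ k ∈ T, (∑ i ∈ S, edgeInd ω i k) ^ 2
      ≤ ∑ i ∈ S, ∑ j ∈ S, ∑ k, edgeInd ω i k * edgeInd ω j k := by
    refine (Finset.sum_le_univ_sum_of_nonneg fun k => sq_nonneg _).trans (le_of_eq ?_)
    simp only [sq, Finset.sum_mul_sum]
    rw [Finset.sum_comm]
    exact Finset.sum_congr rfl fun i _ => Finset.sum_comm
  refine h1.trans ?_
  have h2 : ∀ i ∈ S, ∀ j ∈ S, ∑ k, edgeInd ω i k * edgeInd ω j k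
      ≤ (if i = j then 12 * ℓ * a ^ 2 else 0) + 12 * ℓ * a := by
    intro i _ j _
    split_ifs with hij
    · subst hij
      simp only [edgeInd_mul_self]
      have := h.deg_le hn hp ha hℓ i
      have : 0 ≤ 12 * ℓ * a := by positivity
      linarith
    · rw [zero_add]
      exact h.codeg_le hn hp ha hℓ hij
  refine (Finset.sum_le_sum fun i hi => Finset.sum_le_sum fun j hj => h2 i hi j hj).trans ?_
  simp only [Finset.sum_add_distrib, Finset.sum_ite_eq, Finset.sum_const, nsmul_eq_mul]
  rw [← Finset.sum_filter, Finset.filter_mem_eq_inter, Finset.inter_self, Finset.sum_const,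
    nsmul_eq_mul]
  have h0 : (0 : ℝ) ≤ S.card := by positivity
  have hs0 : 0 ≤ s := h0.trans hs
  calc (S.card : ℝ) * (12 * ℓ * a ^ 2) + S.card * (S.card * (12 * ℓ * a))
      ≤ s * (12 * ℓ * a ^ 2) + s * (s * (12 * ℓ * a)) := by gcongr
    _ = _ := by ring

/-- The number of triangles across three sets in a typical graph. -/
lemma Typical.triangles_le (h : Typical ω p ℓ) (hω : ω ⊆ allEdges n) (hn : (n : ℝ) = a ^ 3)
    (hp : p * a = 1) (hp0 : 0 ≤ p) (hp1 : p ≤ 1) (ha : 1 ≤ a) (hℓ : 1 ≤ ℓ)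
    (S₁ S₂ S₃ : Finset (Fin n)) {s₁ s₂ s₃ : ℝ} (h1 : 1 ≤ s₁) (h12 : s₁ ≤ s₂) (h23 : s₂ ≤ s₃)
    (hS₁ : (S₁.card : ℝ) ≤ s₁ ^ 2) (hS₂ : (S₂.card : ℝ) ≤ s₂ ^ 2) (hS₃ : (S₃.card : ℝ) ≤ s₃ ^ 2) :
    ∑ i ∈ S₁, ∑ j ∈ S₂, ∑ k ∈ S₃, edgeInd ω i j * edgeInd ω i k * edgeInd ω j k
      ≤ 3000 * ℓ ^ 2 * (s₁ * s₂ * s₃ ^ 2) := by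
  set g := edgeInd ω with hg
  have hg0 : ∀ i j, 0 ≤ g i j := edgeInd_nonneg ω
  have hgc : ∀ i j, g i j = g j i := edgeInd_comm ω
  have hℓ2 : ℓ ≤ ℓ ^ 2 := by nlinarith
  have hs₂ : 1 ≤ s₂ := h1.trans h12
  have hs₃ : 1 ≤ s₃ := hs₂.trans h23
  set x := s₁ * s₂ * s₃ ^ 2 with hx
  have hx0 : 0 ≤ x := by positivity
  -- When S₂ may be much larger than S₁, choose i and k first and bound the number of j by the
  -- codegree.
  rcases lt_or_ge (a * s₁) s₂ with hcase | hcase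
  · calc _ = ∑ i ∈ S₁, ∑ k ∈ S₃, g i k * ∑ j ∈ S₂, g i j * g k j := by
          refine Finset.sum_congr rfl fun i _ => ?_
          rw [Finset.sum_comm]
          refine Finset.sum_congr rfl fun k _ => ?_
          rw [Finset.mul_sum]
          refine Finset.sum_congr rfl fun j _ => ?_
          rw [hgc k j]
          ring
      _ ≤ ∑ i ∈ S₁, ∑ k ∈ S₃, 12 * ℓ * a := by
          refine Finset.sum_le_sum fun i _ => Finset.sum_le_sum fun k _ => ?_
          by_cases hik : i = k
          · subst hik
            rw [hg, edgeInd_self hω, zero_mul]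
            positivity
          · have e1 : ∑ j ∈ S₂, g i j * g k j ≤ 12 * ℓ * a :=
              (Finset.sum_le_univ_sum_of_nonneg fun j => mul_nonneg (hg0 i j) (hg0 k j)).trans
                (h.codeg_le hn hp ha hℓ hik)
            have e2 : g i k ≤ 1 := edgeInd_le_one ω i k
            calc g i k * ∑ j ∈ S₂, g i j * g k j ≤ 1 * ∑ j ∈ S₂, g i j * g k j := by
                  refine mul_le_mul_of_nonneg_right e2 ?_
                  exact Finset.sum_nonneg fun j _ => mul_nonneg (hg0 i j) (hg0 k j)
              _ ≤ _ := by rw [one_mul]; exact e1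
      _ = S₁.card * (S₃.card * (12 * ℓ * a)) := by simp
      _ ≤ s₁ ^ 2 * (s₃ ^ 2 * (12 * ℓ * a)) := by gcongr
      _ = 12 * ℓ * (s₁ * (a * s₁) * s₃ ^ 2) := by ring
      _ ≤ 12 * ℓ * (s₁ * s₂ * s₃ ^ 2) := by gcongr
      _ ≤ 3000 * ℓ ^ 2 * x := by
          rw [hx]
          gcongr
          linarith
  set A : Fin n → ℝ := fun k => ∑ i ∈ S₁, g i k with hA
  set B : Fin n → ℝ := fun k => ∑ j ∈ S₂, g j k with hB
  have hA0 : ∀ k, 0 ≤ A k := fun k => Finset.sum_nonneg fun i _ => hg0 i k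
  have hB0 : ∀ k, 0 ≤ B k := fun k => Finset.sum_nonneg fun i _ => hg0 i k
  have hstep : ∑ i ∈ S₁, ∑ j ∈ S₂, ∑ k ∈ S₃, g i j * g i k * g j k
      ≤ ∑ k ∈ S₃, 2 * (2 * (A k * B k * p) + 10 * (ℓ * (A k + B k + 1))) := by
    have e1 : ∑ i ∈ S₁, ∑ j ∈ S₂, ∑ k ∈ S₃, g i j * g i k * g j k
        = ∑ k ∈ S₃, ∑ i ∈ S₁, ∑ j ∈ S₂, g i j * g i k * g j k := by
      rw [Finset.sum_congr rfl fun i _ => Finset.sum_comm, Finset.sum_comm]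
    rw [e1]
    refine Finset.sum_le_sum fun k _ => ?_
    -- For fixed k, triangles are the edges between its neighbourhoods in S₁ and S₂, of sizes A k
    -- and B k.
    have e2 := h.edges (S₁.filter fun i => s(i, k) ∈ ω) (S₂.filter fun i => s(i, k) ∈ ω)
    rw [card_filter_eq_sum_edgeInd, card_filter_eq_sum_edgeInd] at e2
    refine le_trans (le_of_eq ?_) e2
    rw [Finset.sum_filter]
    refine Finset.sum_congr rfl fun i _ => ?_
    by_cases hik : s(i, k) ∈ ω
    · rw [if_pos hik, Finset.sum_filter]
      refine Finset.sum_congr rfl fun j _ => ?_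
      simp only [hg, edgeInd, hik, if_true, mul_one]
      split_ifs <;> simp
    · rw [if_neg hik]
      refine Finset.sum_eq_zero fun j _ => ?_
      simp [hg, edgeInd, hik]
  refine hstep.trans ?_
  have x1 : s₁ ^ 2 ≤ x := by
    rw [hx]
    calc s₁ ^ 2 = s₁ * s₁ * 1 := by ring
      _ ≤ s₁ * s₂ * s₃ ^ 2 := by gcongr; exact one_le_pow₀ hs₃
  have x3 : s₃ ^ 2 ≤ x := by
    rw [hx]
    calc s₃ ^ 2 = 1 * 1 * s₃ ^ 2 := by ring
      _ ≤ s₁ * s₂ * s₃ ^ 2 := by gcongr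
  have x2 : s₂ ^ 2 ≤ x := le_trans (by gcongr) x3
  have x0 : 1 ≤ x := le_trans (one_le_pow₀ hs₃) x3
  have hsumA : ∑ k ∈ S₃, A k ≤ 64 * ℓ * x := by
    have e := h.edges S₁ S₃
    rw [Finset.sum_comm] at e
    refine e.trans ?_
    calc _ ≤ 2 * (2 * (s₁ ^ 2 * s₃ ^ 2 * p) + 10 * (ℓ * (s₁ ^ 2 + s₃ ^ 2 + 1))) := by gcongr
      _ ≤ 2 * (2 * x + 10 * (ℓ * (x + x + x))) := by
          have : s₁ ^ 2 * s₃ ^ 2 * p ≤ x := by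
            rw [hx]
            calc s₁ ^ 2 * s₃ ^ 2 * p ≤ s₁ ^ 2 * s₃ ^ 2 * 1 := by gcongr
              _ = s₁ * s₁ * s₃ ^ 2 := by ring
              _ ≤ _ := by gcongr
          gcongr
      _ ≤ 64 * ℓ * x := by nlinarith
  have hsumB : ∑ k ∈ S₃, B k ≤ 64 * ℓ * x := by
    have e := h.edges S₂ S₃
    rw [Finset.sum_comm] at e
    refine e.trans ?_
    calc _ ≤ 2 * (2 * (s₂ ^ 2 * s₃ ^ 2 * p) + 10 * (ℓ * (s₂ ^ 2 + s₃ ^ 2 + 1))) := by gcongr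
      _ ≤ 2 * (2 * x + 10 * (ℓ * (x + x + x))) := by
          have : s₂ ^ 2 * s₃ ^ 2 * p ≤ x := by
            have hps : p * s₂ ≤ s₁ := by
              calc p * s₂ ≤ p * (a * s₁) := by gcongr
                _ = s₁ := by rw [← mul_assoc, hp, one_mul]
            rw [hx]
            calc s₂ ^ 2 * s₃ ^ 2 * p = p * s₂ * s₂ * s₃ ^ 2 := by ring
              _ ≤ _ := by gcongr
          gcongr
      _ ≤ 64 * ℓ * x := by nlinarith
  have hAB : p * ∑ k ∈ S₃, A k * B k ≤ 64 * ℓ * x := by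
    -- For small sets A k ≤ a = 1/p, so p A k ≤ 1 suffices; otherwise use Cauchy–Schwarz and the
    -- second moments of the degrees.
    rcases lt_or_ge (s₃ ^ 2) a with hs | hs
    · refine le_trans ?_ hsumB
      rw [Finset.mul_sum]
      refine Finset.sum_le_sum fun k _ => ?_
      rw [← mul_assoc]
      refine mul_le_of_le_one_left (hB0 k) ?_
      have hAk : A k ≤ a := by
        calc A k ≤ ∑ i ∈ S₁, 1 := Finset.sum_le_sum fun i _ => edgeInd_le_one ω i k
          _ = S₁.card := by simp
          _ ≤ s₁ ^ 2 := hS₁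
          _ ≤ s₃ ^ 2 := by gcongr; linarith
          _ ≤ a := hs.le
      calc p * A k ≤ p * a := by gcongr
        _ = 1 := hp
    · have hcs := Finset.sum_mul_sq_le_sq_mul_sq S₃ A B
      have hA2 : ∑ k ∈ S₃, A k ^ 2 ≤ 24 * ℓ * s₁ ^ 2 * a * s₃ ^ 2 := by
        refine (h.sum_sq_deg_le hn hp ha hℓ S₁ S₃ hS₁).trans ?_
        have : a + s₁ ^ 2 ≤ 2 * s₃ ^ 2 := by
          have : s₁ ^ 2 ≤ s₃ ^ 2 := by gcongr; linarith
          linarith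
        calc 12 * ℓ * s₁ ^ 2 * a * (a + s₁ ^ 2) ≤ 12 * ℓ * s₁ ^ 2 * a * (2 * s₃ ^ 2) := by gcongr
          _ = _ := by ring
      have hB2 : ∑ k ∈ S₃, B k ^ 2 ≤ 24 * ℓ * s₂ ^ 2 * a * s₃ ^ 2 := by
        refine (h.sum_sq_deg_le hn hp ha hℓ S₂ S₃ hS₂).trans ?_
        have : a + s₂ ^ 2 ≤ 2 * s₃ ^ 2 := by
          have : s₂ ^ 2 ≤ s₃ ^ 2 := by gcongr
          linarith
        calc 12 * ℓ * s₂ ^ 2 * a * (a + s₂ ^ 2) ≤ 12 * ℓ * s₂ ^ 2 * a * (2 * s₃ ^ 2) := by gcongr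
          _ = _ := by ring
      have hsq : (∑ k ∈ S₃, A k * B k) ^ 2 ≤ (24 * ℓ * a * x) ^ 2 := by
        refine hcs.trans ?_
        calc _ ≤ (24 * ℓ * s₁ ^ 2 * a * s₃ ^ 2) * (24 * ℓ * s₂ ^ 2 * a * s₃ ^ 2) := by
              refine mul_le_mul hA2 hB2 (Finset.sum_nonneg fun k _ => sq_nonneg _) (by positivity)
          _ = _ := by rw [hx]; ring
      have hle := le_of_sq_le_sq hsq (by positivity)
      calc p * ∑ k ∈ S₃, A k * B k ≤ p * (24 * ℓ * a * x) := by gcongr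
        _ = 24 * ℓ * x := by linear_combination 24 * ℓ * x * hp
        _ ≤ 64 * ℓ * x := by gcongr; norm_num
  have hfin : ∑ k ∈ S₃, 2 * (2 * (A k * B k * p) + 10 * (ℓ * (A k + B k + 1)))
      = 4 * (p * ∑ k ∈ S₃, A k * B k)
        + 20 * ℓ * (∑ k ∈ S₃, A k + ∑ k ∈ S₃, B k + S₃.card) := by
    rw [show (S₃.card : ℝ) = ∑ k ∈ S₃, 1 by simp, ← Finset.sum_add_distrib,
      ← Finset.sum_add_distrib, Finset.mul_sum, Finset.mul_sum, Finset.mul_sum,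
      ← Finset.sum_add_distrib]
    exact Finset.sum_congr rfl fun k _ => by ring
  rw [hfin]
  have hS3x : (S₃.card : ℝ) ≤ ℓ * x := by nlinarith
  calc _ ≤ 4 * (64 * ℓ * x) + 20 * ℓ * (64 * ℓ * x + 64 * ℓ * x + ℓ * x) := by gcongr
    _ = 256 * ℓ * x + 2580 * ℓ ^ 2 * x := by ring
    _ ≤ 256 * ℓ ^ 2 * x + 2580 * ℓ ^ 2 * x := by gcongr
    _ ≤ 3000 * ℓ ^ 2 * x := by nlinarith [mul_nonneg (sq_nonneg ℓ) hx0]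

end Triangles

/-! ### The sphere norm via dyadic levels. -/

section SphereNorm

variable {n : ℕ} {ω : Finset (Sym2 (Fin n))} {p a ℓ : ℝ}

/-- Dyadic level sets of a unit vector. -/
lemma exists_levels {x : Fin n → ℝ} (hx : ∑ i, x i ^ 2 = 1) {m : ℕ} (hm : n ≤ 4 ^ m) :
    ∃ lev : Fin n → ℕ, (∀ i, lev i ≤ m) ∧ (∀ i, |x i| ≤ (1 / 2) ^ lev i) ∧
      ∀ h, ((Finset.univ.filter fun i => lev i = h).card : ℝ) ≤ (2 ^ (h + 1)) ^ 2 := by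
  have hx1 : ∀ i, |x i| ≤ 1 := fun i => by
    rw [← sq_le_one_iff_abs_le_one, ← hx]
    exact Finset.single_le_sum (f := fun i => x i ^ 2) (fun j _ => sq_nonneg _)
      (Finset.mem_univ i)
  refine ⟨fun i => Nat.findGreatest (fun h => |x i| ≤ (1 / 2) ^ h) m,
    fun i => Nat.findGreatest_le _, fun i => ?_, fun h => ?_⟩
  · exact Nat.findGreatest_spec (P := fun h => |x i| ≤ (1 / 2) ^ h) (Nat.zero_le m)
      (by simpa using hx1 i)
  · set S := Finset.univ.filter fun i => Nat.findGreatest (fun h => |x i| ≤ (1 / 2) ^ h) m = h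
      with hS
    have e4 : ((2 : ℝ) ^ (h + 1)) ^ 2 = 4 ^ (h + 1) := by
      rw [← pow_mul, mul_comm, pow_mul]; norm_num
    rw [e4]
    -- Below the cap m, membership forces |x_i| > 2^{-(h+1)}; at the cap the trivial bound n ≤ 4^m
    -- is used.
    rcases lt_or_ge h m with hh | hh
    · have hbig : ∀ i ∈ S, ((1 : ℝ) / 4) ^ (h + 1) ≤ x i ^ 2 := by
        intro i hi
        have hi' := (Finset.mem_filter.1 hi).2
        have hn : ¬ |x i| ≤ (1 / 2) ^ (h + 1) :=
          Nat.findGreatest_is_greatest (P := fun h => |x i| ≤ (1 / 2) ^ h) (n := m)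
            (by rw [hi']; exact Nat.lt_succ_self h) hh
        rw [← sq_abs, show (1 : ℝ) / 4 = (1 / 2) ^ 2 by norm_num, ← pow_mul, mul_comm, pow_mul]
        exact pow_le_pow_left₀ (by positivity) (not_le.1 hn).le 2
      have hle : (S.card : ℝ) * (1 / 4) ^ (h + 1) ≤ 1 := by
        rw [← nsmul_eq_mul]
        exact ((Finset.card_nsmul_le_sum S _ _ hbig).trans
          (Finset.sum_le_univ_sum_of_nonneg fun i => sq_nonneg _)).trans hx.le
      rw [one_div, inv_pow, ← div_eq_mul_inv, div_le_one (by positivity)] at hle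
      exact hle
    · have hc : S.card ≤ 4 ^ (h + 1) := by
        calc S.card ≤ n := by simpa using Finset.card_le_univ S
          _ ≤ 4 ^ m := hm
          _ ≤ 4 ^ (h + 1) := Nat.pow_le_pow_right (by norm_num) (by omega)
      exact_mod_cast hc

lemma exists_sorted_of_card_four (lev : Fin n → ℕ) {s : Finset (Fin n)} (hs : s.card = 4) :
    ∃ q : Fin n × Fin n × Fin n × Fin n, s = {q.1, q.2.1, q.2.2.1, q.2.2.2} ∧
      lev q.1 ≤ lev q.2.1 ∧ lev q.2.1 ≤ lev q.2.2.1 ∧ lev q.2.2.1 ≤ lev q.2.2.2 := by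
  obtain ⟨i, hi, hi'⟩ := Finset.exists_min_image s lev (Finset.card_pos.1 (by omega))
  have c1 := Finset.card_erase_of_mem hi
  obtain ⟨j, hj, hj'⟩ :=
    Finset.exists_min_image (s.erase i) lev (Finset.card_pos.1 (by omega))
  have c2 := Finset.card_erase_of_mem hj
  obtain ⟨k, hk, hk'⟩ :=
    Finset.exists_min_image ((s.erase i).erase j) lev (Finset.card_pos.1 (by omega))
  have c3 := Finset.card_erase_of_mem hk
  obtain ⟨l, hl⟩ := Finset.card_eq_one.1
    (show (((s.erase i).erase j).erase k).card = 1 by omega)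
  have hl4 : l ∈ (((s.erase i).erase j).erase k) := by rw [hl]; simp
  refine ⟨(i, j, k, l), ?_, hi' j (Finset.mem_of_mem_erase hj), hj' k (Finset.mem_of_mem_erase hk),
    hk' l (Finset.mem_of_mem_erase hl4)⟩
  rw [← Finset.insert_erase hi, ← Finset.insert_erase hj, ← Finset.insert_erase hk, hl]

open scoped Classical in
/-- Each clique is counted by at least one ordering that is monotone in `lev`. -/
lemma sum_cliques_le_sorted (hω : ω ⊆ allEdges n) (lev : Fin n → ℕ) {y : Fin n → ℝ}
    (hy : ∀ i, 0 ≤ y i) :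
    ∑ s ∈ (edgeGraph ω).cliqueFinset 4, ∏ i ∈ s, y i
      ≤ ∑ i, ∑ j, ∑ k, ∑ l, if lev i ≤ lev j ∧ lev j ≤ lev k ∧ lev k ≤ lev l then
        sixProd (edgeInd ω) i j k l * (y i * (y j * (y k * y l))) else 0 := by
  set F : Fin n × Fin n × Fin n × Fin n → ℝ := fun q =>
    if lev q.1 ≤ lev q.2.1 ∧ lev q.2.1 ≤ lev q.2.2.1 ∧ lev q.2.2.1 ≤ lev q.2.2.2 then
      sixProd (edgeInd ω) q.1 q.2.1 q.2.2.1 q.2.2.2 *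
        (y q.1 * (y q.2.1 * (y q.2.2.1 * y q.2.2.2))) else 0 with hF
  have hg := edgeInd_nonneg ω
  have hF0 : ∀ q, 0 ≤ F q := by
    intro q
    simp only [hF]
    split_ifs
    · unfold sixProd
      have := hy q.1; have := hy q.2.1; have := hy q.2.2.1; have := hy q.2.2.2
      have := hg q.1 q.2.1; have := hg q.1 q.2.2.1; have := hg q.1 q.2.2.2
      have := hg q.2.1 q.2.2.1; have := hg q.2.1 q.2.2.2; have := hg q.2.2.1 q.2.2.2
      positivity
    · exact le_rfl
  have hRHS : ∑ q, F q = ∑ i, ∑ j, ∑ k, ∑ l,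
      if lev i ≤ lev j ∧ lev j ≤ lev k ∧ lev k ≤ lev l then
        sixProd (edgeInd ω) i j k l * (y i * (y j * (y k * y l))) else 0 := by
    simp only [Fintype.sum_prod_type, hF]
  rw [← hRHS]
  have hex : ∀ s : Finset (Fin n), s ∈ (edgeGraph ω).cliqueFinset 4 →
      ∃ q : Fin n × Fin n × Fin n × Fin n, s = {q.1, q.2.1, q.2.2.1, q.2.2.2} ∧
      lev q.1 ≤ lev q.2.1 ∧ lev q.2.1 ≤ lev q.2.2.1 ∧ lev q.2.2.1 ≤ lev q.2.2.2 := fun s hs =>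
    exists_sorted_of_card_four lev ((SimpleGraph.mem_cliqueFinset_iff.1 hs).card_eq)
  rcases ((edgeGraph ω).cliqueFinset 4).eq_empty_or_nonempty with hem | ⟨s₀, hs₀⟩
  · rw [hem, Finset.sum_empty]
    exact Finset.sum_nonneg fun q _ => hF0 q
  obtain ⟨q₀, _⟩ := hex s₀ hs₀
  have : Nonempty (Fin n × Fin n × Fin n × Fin n) := ⟨q₀⟩
  choose! f hf using hex
  have hinj : Set.InjOn f ((edgeGraph ω).cliqueFinset 4 : Set (Finset (Fin n))) := by
    intro s hs t ht hst
    rw [(hf s hs).1, (hf t ht).1, hst]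
  have hle : ∀ s ∈ (edgeGraph ω).cliqueFinset 4, ∏ i ∈ s, y i ≤ F (f s) := by
    intro s hs
    obtain ⟨h1, h2⟩ := hf s hs
    have hc := SimpleGraph.mem_cliqueFinset_iff.1 hs
    set q := f s
    rw [h1] at hc
    have had := (isNClique_four_iff _ _ _ _ _).1 hc
    have hprod : ∏ i ∈ s, y i = y q.1 * (y q.2.1 * (y q.2.2.1 * y q.2.2.2)) := by
      obtain ⟨a1, a2, a3, a4, a5, a6⟩ := had
      rw [h1, Finset.prod_insert (by simp [a1.ne, a2.ne, a3.ne]),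
        Finset.prod_insert (by simp [a4.ne, a5.ne]), Finset.prod_insert (by simp [a6.ne]),
        Finset.prod_singleton]
    simp only [edgeGraph_adj hω] at had
    obtain ⟨a1, a2, a3, a4, a5, a6⟩ := had
    rw [hprod, hF]
    simp only [h2, sixProd, edgeInd, a1, a2, a3, a4, a5, a6, if_true, and_self, mul_one, one_mul,
      le_refl]
  calc _ ≤ ∑ s ∈ (edgeGraph ω).cliqueFinset 4, F (f s) := Finset.sum_le_sum hle
    _ = ∑ q ∈ ((edgeGraph ω).cliqueFinset 4).image f, F q := (Finset.sum_image hinj).symm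
    _ ≤ ∑ q, F q := Finset.sum_le_univ_sum_of_nonneg hF0

lemma sum_fiberwise_three {m : ℕ} {lev : Fin n → ℕ} (hlev : ∀ i, lev i ≤ m)
    (F : Fin n → Fin n → Fin n → ℝ) :
    ∑ i, ∑ j, ∑ k, F i j k = ∑ h₁ ∈ Finset.range (m + 1), ∑ h₂ ∈ Finset.range (m + 1),
      ∑ h₃ ∈ Finset.range (m + 1), ∑ i ∈ Finset.univ.filter (fun i => lev i = h₁),
        ∑ j ∈ Finset.univ.filter (fun i => lev i = h₂),
          ∑ k ∈ Finset.univ.filter (fun i => lev i = h₃), F i j k := by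
  have fib : ∀ f : Fin n → ℝ, ∑ i, f i = ∑ h ∈ Finset.range (m + 1),
      ∑ i ∈ Finset.univ.filter (fun i => lev i = h), f i := fun f =>
    (Finset.sum_fiberwise_of_maps_to
      (fun i _ => Finset.mem_range.2 (Nat.lt_succ_of_le (hlev i))) f).symm
  rw [fib]
  refine Finset.sum_congr rfl fun h₁ _ => ?_
  rw [Finset.sum_comm, fib]
  refine Finset.sum_congr rfl fun h₂ _ => ?_
  rw [Finset.sum_comm]
  simp only [fib fun k => F _ _ k]
  rw [Finset.sum_congr rfl fun i _ => Finset.sum_comm, Finset.sum_comm]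

/-- Values of the clique polynomial of a typical graph on the unit sphere. -/
lemma Typical.abs_eval_cliquePoly_le (h : Typical ω p ℓ) (hω : ω ⊆ allEdges n)
    (hn : (n : ℝ) = a ^ 3) (hp : p * a = 1) (hp0 : 0 ≤ p) (hp1 : p ≤ 1) (ha : 1 ≤ a) (hℓ : 1 ≤ ℓ)
    {m : ℕ} (hm : n ≤ 4 ^ m) {x : Fin n → ℝ} (hx : ∑ i, x i ^ 2 = 1) :
    |eval x (cliquePoly (edgeGraph ω))| ≤ 576000 * ℓ ^ 3 * (m + 1) ^ 3 := by
  classical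
  obtain ⟨lev, hlev, hxl, hcard⟩ := exists_levels hx hm
  set y : Fin n → ℝ := fun i => (1 / 2) ^ lev i with hy
  have hy0 : ∀ i, 0 ≤ y i := fun i => by positivity
  set g := edgeInd ω with hgdef
  have hg : ∀ i j, 0 ≤ g i j := edgeInd_nonneg ω
  have h1 : |eval x (cliquePoly (edgeGraph ω))|
      ≤ ∑ s ∈ (edgeGraph ω).cliqueFinset 4, ∏ i ∈ s, y i := by
    simp only [cliquePoly, map_sum, map_prod, eval_X]
    refine (Finset.abs_sum_le_sum_abs _ _).trans (Finset.sum_le_sum fun s _ => ?_)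
    rw [Finset.abs_prod]
    exact Finset.prod_le_prod (fun i _ => abs_nonneg _) fun i _ => hxl i
  refine (h1.trans (sum_cliques_le_sorted hω lev hy0)).trans ?_
  -- Sum out the vertex of smallest weight: y_l ≤ y_k, and i, j, k have at most 12ℓ common
  -- neighbours.
  have h2 : ∀ i j k, ∑ l, (if lev i ≤ lev j ∧ lev j ≤ lev k ∧ lev k ≤ lev l then
        sixProd g i j k l * (y i * (y j * (y k * y l))) else 0)
      ≤ if lev i ≤ lev j ∧ lev j ≤ lev k then
        12 * ℓ * (g i j * g i k * g j k * (y i * y j * y k ^ 2)) else 0 := by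
    intro i j k
    split_ifs with hs
    · have hpos : 0 ≤ g i j * g i k * g j k * (y i * y j * y k ^ 2) := by
        have := hg i j; have := hg i k; have := hg j k
        have := hy0 i; have := hy0 j; have := hy0 k
        positivity
      calc _ ≤ ∑ l, g i j * g i k * g j k * (y i * y j * y k ^ 2) * (g i l * g j l * g k l) := by
            refine Finset.sum_le_sum fun l _ => ?_
            have hG : 0 ≤ g i l * g j l * g k l :=
              mul_nonneg (mul_nonneg (hg i l) (hg j l)) (hg k l)
            split_ifs with hl
            · have hyl : y l ≤ y k :=
                pow_le_pow_of_le_one (by norm_num) (by norm_num) hl.2.2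
              calc _ = g i j * g i k * g j k * (y i * y j * y k) * (g i l * g j l * g k l) * y l := by
                    unfold sixProd; ring
                _ ≤ g i j * g i k * g j k * (y i * y j * y k) * (g i l * g j l * g k l) * y k := by
                    refine mul_le_mul_of_nonneg_left hyl (mul_nonneg ?_ hG)
                    have := hg i j; have := hg i k; have := hg j k
                    have := hy0 i; have := hy0 j; have := hy0 k
                    positivity
                _ = _ := by ring
            · exact mul_nonneg hpos hG
        _ = g i j * g i k * g j k * (y i * y j * y k ^ 2) * ∑ l, g i l * g j l * g k l := by
            rw [Finset.mul_sum]
        _ ≤ _ := by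
            by_cases hij : i = j
            · subst hij
              simp [hgdef, edgeInd_self hω]
            by_cases hik : i = k
            · subst hik
              simp [hgdef, edgeInd_self hω]
            by_cases hjk : j = k
            · subst hjk
              simp [hgdef, edgeInd_self hω]
            rw [mul_comm (12 * ℓ)]
            exact mul_le_mul_of_nonneg_left (h.codeg_three_le hn hp hℓ hij hik hjk) hpos
    · refine le_of_eq (Finset.sum_eq_zero fun l _ => if_neg fun hl => hs ⟨hl.1, hl.2.1⟩)
  refine (Finset.sum_le_sum fun i _ => Finset.sum_le_sum fun j _ =>
    Finset.sum_le_sum fun k _ => h2 i j k).trans ?_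
  rw [sum_fiberwise_three hlev]
  have h3 : ∀ h₁ h₂ h₃ : ℕ, ∑ i ∈ Finset.univ.filter (fun i => lev i = h₁),
        ∑ j ∈ Finset.univ.filter (fun i => lev i = h₂),
          ∑ k ∈ Finset.univ.filter (fun i => lev i = h₃),
      (if lev i ≤ lev j ∧ lev j ≤ lev k then
        12 * ℓ * (g i j * g i k * g j k * (y i * y j * y k ^ 2)) else 0)
      ≤ 576000 * ℓ ^ 3 := by
    intro h₁ h₂ h₃
    set S : ℕ → Finset (Fin n) := fun h => Finset.univ.filter fun i => lev i = h with hS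
    by_cases hs : h₁ ≤ h₂ ∧ h₂ ≤ h₃
    · set D : ℝ := 12 * ℓ * ((1 / 2) ^ h₁ * (1 / 2) ^ h₂ * ((1 / 2) ^ h₃) ^ 2) with hD
      have hmem : ∀ {h i}, i ∈ S h → lev i = h := fun hi => (Finset.mem_filter.1 hi).2
      have htri := h.triangles_le hω hn hp hp0 hp1 ha hℓ (S h₁) (S h₂) (S h₃)
        (one_le_pow₀ (by norm_num : (1 : ℝ) ≤ 2))
        (pow_le_pow_right₀ (by norm_num : (1 : ℝ) ≤ 2) (Nat.succ_le_succ hs.1))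
        (pow_le_pow_right₀ (by norm_num : (1 : ℝ) ≤ 2) (Nat.succ_le_succ hs.2))
        (hcard h₁) (hcard h₂) (hcard h₃)
      calc _ = D * ∑ i ∈ S h₁, ∑ j ∈ S h₂, ∑ k ∈ S h₃, g i j * g i k * g j k := by
            simp only [Finset.mul_sum]
            refine Finset.sum_congr rfl fun i hi => Finset.sum_congr rfl fun j hj =>
              Finset.sum_congr rfl fun k hk => ?_
            simp only [hy, hmem hi, hmem hj, hmem hk, hs, and_self, if_true, hD]
            ring
        _ ≤ D * (3000 * ℓ ^ 2 * (2 ^ (h₁ + 1) * 2 ^ (h₂ + 1) * (2 ^ (h₃ + 1)) ^ 2)) :=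
            mul_le_mul_of_nonneg_left htri (by positivity)
        -- 12 · 3000 · 2⁴, the last factor from the four shifts h + 1; all level-dependent powers
        -- cancel.
        _ = 576000 * ℓ ^ 3 := by
            have e : ∀ h : ℕ, ((1 : ℝ) / 2) ^ h * 2 ^ h = 1 := fun h => by
              rw [← mul_pow]; norm_num
            calc _ = 576000 * ℓ ^ 3 * (((1 / 2) ^ h₁ * 2 ^ h₁) * ((1 / 2) ^ h₂ * 2 ^ h₂)
                  * ((1 / 2) ^ h₃ * 2 ^ h₃) ^ 2) := by rw [hD]; ring
              _ = _ := by rw [e, e, e]; ring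
    · refine le_trans (le_of_eq ?_) (by positivity : (0 : ℝ) ≤ 576000 * ℓ ^ 3)
      refine Finset.sum_eq_zero fun i hi => Finset.sum_eq_zero fun j hj =>
        Finset.sum_eq_zero fun k hk => if_neg ?_
      rwa [(Finset.mem_filter.1 hi).2, (Finset.mem_filter.1 hj).2, (Finset.mem_filter.1 hk).2]
  refine (Finset.sum_le_sum fun h₁ _ => Finset.sum_le_sum fun h₂ _ =>
    Finset.sum_le_sum fun h₃ _ => h3 h₁ h₂ h₃).trans (le_of_eq ?_)
  simp only [Finset.sum_const, Finset.card_range, nsmul_eq_mul]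
  push_cast
  ring

/-- The sphere norm of the clique polynomial of a typical graph is polylogarithmic. -/
lemma Typical.sphereNorm_cliquePoly_le (h : Typical ω p (Real.log n)) (hω : ω ⊆ allEdges n)
    (hn : (n : ℝ) = a ^ 3) (hp : p * a = 1) (hp0 : 0 ≤ p) (hp1 : p ≤ 1) (ha : 1 ≤ a)
    (hℓ : 3 ≤ Real.log n) :
    sphereNorm (cliquePoly (edgeGraph ω)) ≤ Real.log n ^ 22 := by
  set ℓ := Real.log n with hℓdef
  have hn0 : (0 : ℝ) < n := by rw [hn]; positivity
  have hm : n ≤ 4 ^ ⌈ℓ⌉₊ := by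
    have e : (n : ℝ) ≤ 4 ^ ⌈ℓ⌉₊ := by
      calc (n : ℝ) = Real.exp ℓ := (Real.exp_log hn0).symm
        _ ≤ Real.exp (⌈ℓ⌉₊ * 1) := by rw [mul_one]; exact Real.exp_le_exp.2 (Nat.le_ceil ℓ)
        _ = Real.exp 1 ^ ⌈ℓ⌉₊ := by rw [Real.exp_nat_mul]
        _ ≤ 4 ^ ⌈ℓ⌉₊ := by
            gcongr
            exact Real.exp_one_lt_d9.le.trans (by norm_num)
    exact_mod_cast e
  have hceil : (⌈ℓ⌉₊ : ℝ) + 1 ≤ 3 * ℓ := by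
    have := Nat.ceil_lt_add_one (by linarith : 0 ≤ ℓ)
    linarith
  refine Real.sSup_le ?_ (by positivity)
  rintro r ⟨x, hx, rfl⟩
  refine (h.abs_eval_cliquePoly_le hω hn hp hp0 hp1 ha (by linarith) hm hx).trans ?_
  calc 576000 * ℓ ^ 3 * ((⌈ℓ⌉₊ : ℝ) + 1) ^ 3 ≤ 576000 * ℓ ^ 3 * (3 * ℓ) ^ 3 := by gcongr
    _ = 15552000 * ℓ ^ 6 := by ring
    -- As ℓ ≥ 3, sixteen extra powers of ℓ absorb the numerical constant; hence the exponent 22.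
    _ ≤ 3 ^ 16 * ℓ ^ 6 := by gcongr; norm_num
    _ ≤ ℓ ^ 16 * ℓ ^ 6 := by gcongr
    _ = ℓ ^ 22 := by ring

end SphereNorm

/-! ### Assembling the two probability bounds. -/

section Main

variable {n : ℕ} {ω : Finset (Sym2 (Fin n))} {p a ℓ : ℝ}

lemma Typical.sum_abs_edgeDev_le (h : Typical ω p ℓ) (hn : (n : ℝ) = a ^ 3) (hp : p * a = 1)
    (hp0 : 0 ≤ p) (ha : 1 ≤ a) (hℓ : 1 ≤ ℓ) (A B : Finset (Fin n)) :
    ∑ i ∈ A, ∑ j ∈ B, |edgeDev p ω i j| ≤ 13 * ℓ * a ^ 5 := by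
  have h1 : ∀ i, ∑ j ∈ B, |edgeDev p ω i j| ≤ 12 * ℓ * a ^ 2 + a ^ 2 := by
    intro i
    calc ∑ j ∈ B, |edgeDev p ω i j| ≤ ∑ j, |edgeDev p ω i j| :=
          Finset.sum_le_univ_sum_of_nonneg fun j => abs_nonneg _
      _ ≤ ∑ j, (edgeInd ω i j + p) := Finset.sum_le_sum fun j _ => abs_edgeDev_le hp0 i j
      _ = ∑ j, edgeInd ω i j + n * p := by simp [Finset.sum_add_distrib]
      _ ≤ 12 * ℓ * a ^ 2 + a ^ 2 := by
          refine add_le_add (h.deg_le hn hp ha hℓ i) (le_of_eq ?_)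
          rw [hn]
          linear_combination a ^ 2 * hp
  calc ∑ i ∈ A, ∑ j ∈ B, |edgeDev p ω i j| ≤ ∑ i, ∑ j ∈ B, |edgeDev p ω i j| :=
        Finset.sum_le_univ_sum_of_nonneg fun i => Finset.sum_nonneg fun j _ => abs_nonneg _
    _ ≤ ∑ i : Fin n, (12 * ℓ * a ^ 2 + a ^ 2) := Finset.sum_le_sum fun i _ => h1 i
    _ = 12 * ℓ * a ^ 5 + 1 * a ^ 5 := by
        rw [Finset.sum_const, Finset.card_univ, Fintype.card_fin, nsmul_eq_mul, hn]
        ring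
    _ ≤ 12 * ℓ * a ^ 5 + ℓ * a ^ 5 := by gcongr
    _ = _ := by ring

lemma exists_four_classes {m : ℕ} (hm : 4 * m ≤ n) :
    ∃ V : Fin 4 → Finset (Fin n), (∀ b c, b ≠ c → Disjoint (V b) (V c)) ∧
      ∀ b, (V b).card = m := by
  obtain ⟨f⟩ : Nonempty (Fin 4 × Fin m ↪ Fin n) :=
    Function.Embedding.nonempty_of_card_le (by simpa using hm)
  refine ⟨fun b => Finset.univ.image fun t => f (b, t), fun b c hbc => ?_, fun b => ?_⟩
  · rw [Finset.disjoint_left]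
    intro i hi hj
    obtain ⟨t, -, rfl⟩ := Finset.mem_image.1 hi
    obtain ⟨u, -, hu⟩ := Finset.mem_image.1 hj
    exact hbc (congrArg Prod.fst (f.injective hu)).symm
  · rw [Finset.card_image_of_injective _ fun t u htu => congrArg Prod.snd (f.injective htu)]
    simp

/-- On the good event the relaxation value is large. -/
lemma Typical.le_sosValue (h : Typical ω p ℓ) (hω : ω ⊆ allEdges n) (hn : (n : ℝ) = a ^ 3)
    (hp : p * a = 1) (hp0 : 0 ≤ p) (hp1 : p ≤ 1 / 2) (ha : 1 ≤ a) (hℓ : 1 ≤ ℓ)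
    {V : Fin 4 → Finset (Fin n)} (hV : ∀ b c, b ≠ c → Disjoint (V b) (V c)) {m : ℕ}
    (hm : a ^ 3 / 8 ≤ m)
    (h1 : CliqueFormBounded p ω (V 0) (V 1) (V 2) (V 3) (3000 * ℓ ^ 2 * √a))
    (h2 : CliqueFormBounded p ω (V 0) (V 2) (V 1) (V 3) (3000 * ℓ ^ 2 * √a))
    (h3 : CliqueFormBounded p ω (V 0) (V 3) (V 1) (V 2) (3000 * ℓ ^ 2 * √a))
    (hcount : (m : ℝ) ^ 4 * p ^ 6 / 2 ≤ cliqueCount ω (V 0) (V 1) (V 2) (V 3)) :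
    1 / 10 ^ 12 * √a / ℓ ^ 22 ≤ sosValue 2 (cliquePoly (edgeGraph ω)) := by
  have ha0 : 0 < a := by linarith
  have hℓ0 : 0 < ℓ := by linarith
  have hsa : 0 < √a := Real.sqrt_pos.2 ha0
  have d : ∀ b c : Fin 4, b ≠ c → Disjoint (V b) (V c) := hV
  refine le_sosValue_cliquePoly (T := 96 * (3000 * ℓ ^ 2 * √a / 4) * (13 * ℓ * a ^ 5))
    (pseudoExp (edgeDev p ω) (V 0) (V 1) (V 2) (V 3) (3000 * ℓ ^ 2 * √a / 4))
    (fun q hq => pseudoExp_mul_self_nonneg (by positivity) h1 h2 h3 hq) (by positivity)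
    (by positivity)
    (pseudoExp_normSq (by positivity) (d 0 1 (by decide)) (d 0 2 (by decide)) (d 1 2 (by decide))
      (d 0 3 (by decide)) (d 1 3 (by decide)) (d 2 3 (by decide))
      (h.sum_abs_edgeDev_le hn hp hp0 ha hℓ)) ?_
  rw [pseudoExp_cliquePoly hω (d 0 1 (by decide)) (d 0 2 (by decide)) (d 1 2 (by decide))
      (d 0 3 (by decide)) (d 1 3 (by decide)) (d 2 3 (by decide))]
  have hlow : a ^ 6 / 8192 ≤ cliqueCount ω (V 0) (V 1) (V 2) (V 3) := by
    refine le_trans ?_ hcount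
    calc a ^ 6 / 8192 = (a ^ 3 / 8) ^ 4 * p ^ 6 / 2 := by
          have : p ^ 6 * a ^ 6 = 1 := by rw [← mul_pow, hp, one_pow]
          linear_combination (-(a ^ 6 / 8192)) * this
      _ ≤ _ := by gcongr
  have hq : (1 / 2 : ℝ) ^ 6 ≤ (1 - p) ^ 6 := by gcongr; linarith
  -- Here 96 · 3000 · 13 / 4 = 936000, and 10^{-12} is small enough against 2^{-6}/8192; only ℓ³ of
  -- the available ℓ^{22} is needed.
  calc 1 / 10 ^ 12 * √a / ℓ ^ 22 * (96 * (3000 * ℓ ^ 2 * √a / 4) * (13 * ℓ * a ^ 5))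
      = 936000 / 10 ^ 12 * (√a * √a) * a ^ 5 / ℓ ^ 19 := by field_simp; ring
    _ = 936000 / 10 ^ 12 * a ^ 6 / ℓ ^ 19 := by rw [Real.mul_self_sqrt ha0.le]; ring
    _ ≤ 936000 / 10 ^ 12 * a ^ 6 := div_le_self (by positivity) (one_le_pow₀ hℓ)
    _ ≤ (1 / 2) ^ 6 * (a ^ 6 / 8192) := by
        have : 0 < a ^ 6 := by positivity
        linarith
    _ ≤ _ := mul_le_mul hq hlow (by positivity) (by positivity)

/-- The relaxation value is large with high probability. -/
lemma bprob_sosValue_ge (hn : (n : ℝ) = a ^ 3) (hp : p * a = 1) (ha : 2000 ≤ a)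
    (hℓ : 1 ≤ Real.log n) :
    1 - 1 / (n : ℝ) ≤ bprob (allEdges n) p fun ω =>
      1 / 10 ^ 12 * √a / Real.log n ^ 22 ≤ sosValue 2 (cliquePoly (edgeGraph ω)) := by
  have ha0 : 0 < a := by linarith
  have ha1 : 1 ≤ a := by linarith
  have hpa : p = 1 / a := by field_simp; exact hp
  have hp0 : 0 < p := by rw [hpa]; positivity
  have hp2 : p ≤ 1 / 2 := by rw [hpa]; gcongr; linarith
  have hp1 : p ≤ 1 := by linarith
  have hnbig : 8 ≤ n := by
    have : (8 : ℝ) ≤ n := by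
      rw [hn]
      calc (8 : ℝ) = 2 ^ 3 := by norm_num
        _ ≤ a ^ 3 := by gcongr; linarith
    exact_mod_cast this
  set m := n / 4 with hmdef
  have hm8 : a ^ 3 / 8 ≤ m := by
    have : n ≤ 8 * m := by omega
    have : (n : ℝ) ≤ 8 * m := by exact_mod_cast this
    rw [← hn]
    linarith
  have hm0 : 0 < m := by omega
  obtain ⟨V, hV, hVc⟩ := exists_four_classes (n := n) (m := m) (by omega)
  have d : ∀ b c : Fin 4, b ≠ c → Disjoint (V b) (V c) := hV
  set t := 3000 * Real.log n ^ 2 * √a with ht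
  set Ty : Finset (Sym2 (Fin n)) → Prop := fun ω => Typical ω p (Real.log n) with hTy
  have b0 : bprob (allEdges n) p (fun ω => ¬ Ty ω) ≤ 10 / (n : ℝ) ^ 3 :=
    bprob_not_typical_le hp0.le hp1 (by omega)
  have b1 : bprob (allEdges n) p (fun ω => Ty ω ∧
      ¬ CliqueFormBounded p ω (V 0) (V 1) (V 2) (V 3) t) ≤ 27 / (n : ℝ) ^ 8 :=
    bprob_cliqueForm_le hn hp hp0.le hp1 ha1 hℓ (d 0 1 (by decide)) (d 0 2 (by decide))
      (d 1 2 (by decide)) (d 0 3 (by decide)) (d 1 3 (by decide)) (d 2 3 (by decide))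
  have b2 : bprob (allEdges n) p (fun ω => Ty ω ∧
      ¬ CliqueFormBounded p ω (V 0) (V 2) (V 1) (V 3) t) ≤ 27 / (n : ℝ) ^ 8 :=
    bprob_cliqueForm_le hn hp hp0.le hp1 ha1 hℓ (d 0 2 (by decide)) (d 0 1 (by decide))
      (d 2 1 (by decide)) (d 0 3 (by decide)) (d 2 3 (by decide)) (d 1 3 (by decide))
  have b3 : bprob (allEdges n) p (fun ω => Ty ω ∧
      ¬ CliqueFormBounded p ω (V 0) (V 3) (V 1) (V 2) t) ≤ 27 / (n : ℝ) ^ 8 :=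
    bprob_cliqueForm_le hn hp hp0.le hp1 ha1 hℓ (d 0 3 (by decide)) (d 0 1 (by decide))
      (d 3 1 (by decide)) (d 0 2 (by decide)) (d 3 2 (by decide)) (d 1 2 (by decide))
  have b4 := bprob_cliqueCount_lt hp0 hp1 hV hm0 hVc
  have hbad : bprob (allEdges n) p (fun ω => ¬ (1 / 10 ^ 12 * √a / Real.log n ^ 22
      ≤ sosValue 2 (cliquePoly (edgeGraph ω)))) ≤ 1 / (n : ℝ) := by
    refine (bprob_mono hp0.le hp1 (T := fun ω => ¬ Ty ω ∨
      ((Ty ω ∧ ¬ CliqueFormBounded p ω (V 0) (V 1) (V 2) (V 3) t) ∨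
      ((Ty ω ∧ ¬ CliqueFormBounded p ω (V 0) (V 2) (V 1) (V 3) t) ∨
      ((Ty ω ∧ ¬ CliqueFormBounded p ω (V 0) (V 3) (V 1) (V 2) t) ∨
        cliqueCount ω (V 0) (V 1) (V 2) (V 3) < (m : ℝ) ^ 4 * p ^ 6 / 2)))) ?_).trans ?_
    · intro ω hω hS
      by_contra hcon
      push Not at hcon
      obtain ⟨hT, h1, h2, h3, h4⟩ := hcon
      have hT' : Typical ω p (Real.log n) := hT
      exact hS (hT'.le_sosValue hω hn hp hp0.le hp2 ha1 hℓ hV hm8 (h1 hT) (h2 hT) (h3 hT) h4)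
    refine (bprob_or_le hp0.le hp1 _ _).trans ?_
    have u1 := bprob_or_le (E := allEdges n) hp0.le hp1
      (fun ω => Ty ω ∧ ¬ CliqueFormBounded p ω (V 0) (V 1) (V 2) (V 3) t)
      (fun ω => (Ty ω ∧ ¬ CliqueFormBounded p ω (V 0) (V 2) (V 1) (V 3) t) ∨
      ((Ty ω ∧ ¬ CliqueFormBounded p ω (V 0) (V 3) (V 1) (V 2) t) ∨
        cliqueCount ω (V 0) (V 1) (V 2) (V 3) < (m : ℝ) ^ 4 * p ^ 6 / 2))
    have u2 := bprob_or_le (E := allEdges n) hp0.le hp1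
      (fun ω => Ty ω ∧ ¬ CliqueFormBounded p ω (V 0) (V 2) (V 1) (V 3) t)
      (fun ω => (Ty ω ∧ ¬ CliqueFormBounded p ω (V 0) (V 3) (V 1) (V 2) t) ∨
        cliqueCount ω (V 0) (V 1) (V 2) (V 3) < (m : ℝ) ^ 4 * p ^ 6 / 2)
    have u3 := bprob_or_le (E := allEdges n) hp0.le hp1
      (fun ω => Ty ω ∧ ¬ CliqueFormBounded p ω (V 0) (V 3) (V 1) (V 2) t)
      (fun ω => cliqueCount ω (V 0) (V 1) (V 2) (V 3) < (m : ℝ) ^ 4 * p ^ 6 / 2)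
    have c4 : 24 / ((m : ℝ) ^ 2 * p) + 16 / ((m : ℝ) ^ 3 * p ^ 3) + 4 / ((m : ℝ) ^ 4 * p ^ 6)
        ≤ 26112 / a ^ 5 := by
      have e1 : 24 / ((m : ℝ) ^ 2 * p) ≤ 1536 / a ^ 5 := by
        calc 24 / ((m : ℝ) ^ 2 * p) ≤ 24 / ((a ^ 3 / 8) ^ 2 * p) := by gcongr
          _ = 1536 / a ^ 5 := by rw [hpa]; field_simp; norm_num
      have e2 : 16 / ((m : ℝ) ^ 3 * p ^ 3) ≤ 8192 / a ^ 6 := by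
        calc 16 / ((m : ℝ) ^ 3 * p ^ 3) ≤ 16 / ((a ^ 3 / 8) ^ 3 * p ^ 3) := by gcongr
          _ = 8192 / a ^ 6 := by rw [hpa]; field_simp; norm_num
      have e3 : 4 / ((m : ℝ) ^ 4 * p ^ 6) ≤ 16384 / a ^ 6 := by
        calc 4 / ((m : ℝ) ^ 4 * p ^ 6) ≤ 4 / ((a ^ 3 / 8) ^ 4 * p ^ 6) := by gcongr
          _ = 16384 / a ^ 6 := by rw [hpa]; field_simp; norm_num
      have e4 : 24576 / a ^ 6 ≤ 24576 / a ^ 5 := by gcongr; linarith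
      have e5 : 8192 / a ^ 6 + 16384 / a ^ 6 = 24576 / a ^ 6 := by ring
      have e6 : 1536 / a ^ 5 + 24576 / a ^ 5 = 26112 / a ^ 5 := by ring
      linarith
    -- The second moment error a^{-5} dominates; it beats 1/n = a^{-3} because a ≥ 2000.
    have hfin : 10 / (n : ℝ) ^ 3 + 81 / (n : ℝ) ^ 8 + 26112 / a ^ 5 ≤ 1 / n := by
      have f1 : 10 / (n : ℝ) ^ 3 ≤ 10 / a ^ 5 := by
        rw [hn, ← pow_mul]; gcongr
        norm_num
      have f2 : 81 / (n : ℝ) ^ 8 ≤ 81 / a ^ 5 := by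
        rw [hn, ← pow_mul]; gcongr
        norm_num
      have f3 : 10 / a ^ 5 + 81 / a ^ 5 + 26112 / a ^ 5 = 26203 / a ^ 2 / a ^ 3 := by
        field_simp; norm_num
      have f4 : 26203 / a ^ 2 / a ^ 3 ≤ 1 / a ^ 3 := by
        gcongr
        rw [div_le_one (by positivity)]
        nlinarith
      rw [← hn] at f4
      rw [← hn] at f3
      linarith
    have f5 : 27 / (n : ℝ) ^ 8 + 27 / (n : ℝ) ^ 8 + 27 / (n : ℝ) ^ 8 = 81 / (n : ℝ) ^ 8 := by ring
    linarith
  rw [bprob_not] at hbad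
  linarith

/-- The sphere norm is small with high probability. -/
lemma bprob_sphereNorm_le (hn : (n : ℝ) = a ^ 3) (hp : p * a = 1) (ha : 2000 ≤ a)
    (hℓ : 3 ≤ Real.log n) :
    1 - 1 / (n : ℝ) ≤ bprob (allEdges n) p fun ω =>
      sphereNorm (cliquePoly (edgeGraph ω)) ≤ Real.log n ^ 22 := by
  have ha0 : 0 < a := by linarith
  have ha1 : 1 ≤ a := by linarith
  have hpa : p = 1 / a := by field_simp; exact hp
  have hp0 : 0 ≤ p := by rw [hpa]; positivity
  have hp1 : p ≤ 1 := by rw [hpa, div_le_one ha0]; exact ha1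
  have hn4 : (4 : ℝ) ≤ n := by
    rw [hn]
    calc (4 : ℝ) ≤ 2 ^ 3 := by norm_num
      _ ≤ a ^ 3 := by gcongr; linarith
  have hn2 : 2 ≤ n := by
    have : (2 : ℝ) ≤ n := by linarith
    exact_mod_cast this
  have h1 := bprob_not_typical_le hp0 hp1 hn2
  rw [bprob_not] at h1
  have h2 : bprob (allEdges n) p (fun ω => Typical ω p (Real.log n)) ≤ bprob (allEdges n) p fun ω =>
      sphereNorm (cliquePoly (edgeGraph ω)) ≤ Real.log n ^ 22 :=
    bprob_mono hp0 hp1 fun ω hω h => h.sphereNorm_cliquePoly_le hω hn hp hp0 hp1 ha1 hℓ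
  have h3 : 10 / (n : ℝ) ^ 3 ≤ 1 / n := by
    rw [div_le_div_iff₀ (by positivity) (by positivity)]
    nlinarith [mul_nonneg (by linarith : (0 : ℝ) ≤ n) (sq_nonneg ((n : ℝ) - 4))]
  linarith

lemma cliquePoly_isHomogeneous (G : SimpleGraph (Fin n)) : (cliquePoly G).IsHomogeneous 4 := by
  classical
  refine IsHomogeneous.sum _ _ _ fun s hs => ?_
  have h := IsHomogeneous.prod s (fun i => (X i : MvPolynomial (Fin n) ℝ)) (fun _ => 1)
    fun i _ => isHomogeneous_X ℝ i
  rw [Finset.sum_const, smul_eq_mul, mul_one,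
    (SimpleGraph.mem_cliqueFinset_iff.1 hs).card_eq] at h
  exact h

lemma coeff_cliquePoly_nonneg (G : SimpleGraph (Fin n)) (α : Fin n →₀ ℕ) :
    0 ≤ (cliquePoly G).coeff α := by
  classical
  rw [cliquePoly, coeff_sum]
  refine Finset.sum_nonneg fun s _ => ?_
  have h : ∏ i ∈ s, (X i : MvPolynomial (Fin n) ℝ)
      = monomial (∑ i ∈ s, Finsupp.single i 1) 1 := by
    rw [monomial_sum_one]
    rfl
  rw [h, coeff_monomial]
  split_ifs <;> norm_num

/-- Serves to show that a form with positive relaxation value is nonzero, so that its total degree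
is exactly 4. -/
lemma sosValue_zero_le (k : ℕ) : sosValue k (0 : MvPolynomial (Fin n) ℝ) ≤ 0 := by
  rw [sosValue]
  set S := {r : ℝ | ∃ M : Matrix (Fin k → Fin n) (Fin k → Fin n) ℝ,
    IsMatrixRep k (0 : MvPolynomial (Fin n) ℝ) M ∧ r = maxQuadForm M}
  by_cases hb : BddBelow S
  · refine (csInf_le hb ⟨0, ⟨Matrix.isSymm_zero, fun x => by simp⟩, rfl⟩).trans ?_
    refine Real.sSup_le ?_ le_rfl
    rintro r ⟨z, -, rfl⟩
    simp
  · exact (Real.sInf_of_not_bddBelow hb).le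

end Main

theorem mainTheorem3 :
    ∃ (C : ℕ) (c : ℝ) (N : ℕ), 0 < c ∧ ∀ n : ℕ, N ≤ n →
      -- each of the two bounds holds with probability at least `1 - 1/n` for `G ∼ G(n, n^{-1/3})`
      (1 - 1 / (n : ℝ) ≤ (SimpleGraph.binomialRandom (Fin n) (edgeProb n)).real
        {G | sphereNorm (cliquePoly G) ≤ Real.log n ^ C}) ∧
      (1 - 1 / (n : ℝ) ≤ (SimpleGraph.binomialRandom (Fin n) (edgeProb n)).real
        {G | c * (n : ℝ) ^ (1 / 6 : ℝ) / Real.log n ^ C ≤ sosValue 2 (cliquePoly G)}) ∧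
      -- hence there is a form as desired, and it can be taken to be a `4`-clique polynomial
      ∃ f : MvPolynomial (Fin n) ℝ,
        (∃ G : SimpleGraph (Fin n), f = cliquePoly G) ∧
        f.IsHomogeneous 4 ∧ f.totalDegree = 4 ∧ (∀ α, 0 ≤ f.coeff α) ∧
        sphereNorm f ≤ Real.log n ^ C ∧
        c * (n : ℝ) ^ (1 / 6 : ℝ) / Real.log n ^ C ≤ sosValue 2 f := by
  -- N = 10^{10} ensures n^{1/3} ≥ 2000, since 2000³ = 8 · 10⁹.
  refine ⟨22, 1 / 10 ^ 12, 10 ^ 10, by positivity, fun n hN => ?_⟩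
  have hNr : (10 : ℝ) ^ 10 ≤ n := by exact_mod_cast hN
  have hn0 : (0 : ℝ) < n := lt_of_lt_of_le (by positivity) hNr
  set a : ℝ := (n : ℝ) ^ (1 / 3 : ℝ) with ha
  have hn : (n : ℝ) = a ^ 3 := by
    rw [ha, ← Real.rpow_natCast, ← Real.rpow_mul hn0.le]
    norm_num
  have ha0 : 0 < a := Real.rpow_pos_of_pos hn0 _
  have hp : (edgeProb n : ℝ) * a = 1 := by
    change (n : ℝ) ^ (-(1 / 3) : ℝ) * (n : ℝ) ^ (1 / 3 : ℝ) = 1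
    rw [← Real.rpow_add hn0]
    norm_num
  have ha2 : 2000 ≤ a := by
    refine le_of_pow_le_pow_left₀ (n := 3) (by norm_num) ha0.le ?_
    rw [← hn]
    exact le_trans (by norm_num) hNr
  have hsq : (n : ℝ) ^ (1 / 6 : ℝ) = √a := by
    rw [Real.sqrt_eq_rpow, ha, ← Real.rpow_mul hn0.le]
    norm_num
  have hℓ : 3 ≤ Real.log n := by
    rw [Real.le_log_iff_exp_le hn0]
    calc Real.exp 3 = Real.exp 1 ^ 3 := by rw [← Real.exp_nat_mul]; norm_num
      _ ≤ 3 ^ 3 := by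
          gcongr
          exact Real.exp_one_lt_d9.le.trans (by norm_num)
      _ ≤ n := le_trans (by norm_num) hNr
  have hp0 : (0 : ℝ) ≤ edgeProb n := (edgeProb n).2.1
  have hp1 : (edgeProb n : ℝ) ≤ 1 := (edgeProb n).2.2
  have hA := bprob_sphereNorm_le hn hp ha2 hℓ
  have hB := bprob_sosValue_ge hn hp ha2 (by linarith)
  rw [hsq, binomialRandom_real_eq_bprob, binomialRandom_real_eq_bprob]
  refine ⟨hA, hB, ?_⟩
  obtain ⟨ω, h1, h2⟩ : ∃ ω, sphereNorm (cliquePoly (edgeGraph ω)) ≤ Real.log n ^ 22 ∧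
      1 / 10 ^ 12 * √a / Real.log n ^ 22 ≤ sosValue 2 (cliquePoly (edgeGraph (n := n) ω)) := by
    -- Two disjoint events cannot both have probability at least 1 - 10^{-10}.
    by_contra! hcon
    have hle := bprob_mono (E := allEdges n) hp0 hp1 (S := fun ω =>
      sphereNorm (cliquePoly (edgeGraph ω)) ≤ Real.log n ^ 22) (T := fun ω =>
      ¬ (1 / 10 ^ 12 * √a / Real.log n ^ 22 ≤ sosValue 2 (cliquePoly (edgeGraph ω))))
      fun ω _ h => not_le.2 (hcon ω h)
    rw [bprob_not] at hle
    have : 1 / (n : ℝ) ≤ 1 / 10 ^ 10 := by gcongr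
    norm_num at this hle hA hB
    linarith
  have hne : cliquePoly (edgeGraph (n := n) ω) ≠ 0 := by
    intro h0
    rw [h0] at h2
    have hpos : 0 < 1 / 10 ^ 12 * √a / Real.log n ^ 22 := by positivity
    exact absurd (h2.trans (sosValue_zero_le 2)) (not_le.2 hpos)
  exact ⟨_, ⟨_, rfl⟩, cliquePoly_isHomogeneous _, (cliquePoly_isHomogeneous _).totalDegree hne,
    coeff_cliquePoly_nonneg _, h1, h2⟩
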